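/- **Setting.** Let $L\ge 1$, $X\in\mathbb R^{d_{\mathrm{in}}\times n}$ with $X\neq 0$, $Y\in\mathbb R^{d_{\mathrm{out}}\times n}$ with $d_{\mathrm{out}}\ge 1$. For weight matrices $W_1,\dots,W_L$, where all hidden layers have width $m$ (for $L\ge2$: $W_1\in\mathbb R^{m\times d_{\mathrm{in}}}$, $W_2,\dots,W_{L-1}\in\mathbb R^{m\times m}$, $W_L\in\mathbb R^{d_{\mathrm{out}}\times m}$; for $L=1$: $W_1\in\mathbb R^{d_{\mathrm{out}}\times d_{\mathrm{in}}}$), let $$\ell(W_1,\dots,W_L)=\tfrac12\Big\|\tfrac{1}{\sqrt{m^{L-1}d_{\mathrm{out}}}}W_L\cdots W_1X-Y\Big\|_F^2 .$$ The entries of all $W_i(0)$ are i.i.d. $\mathcal N(0,1)$, and gradient descent is $W_i(t+1)=W_i(t)-\eta\,\frac{\partial \ell}{\partial W_i}(W_1(t),\dots,W_L(t))$ for all $i$ and $t\ge0$; write $\ell(t)=\ell(W_1(t),\dots,W_L(t))$. Let $\mathsf{OPT}=\min_{W\in\mathbb R^{d_{\mathrm{out}}\times d_{\mathrm{in}}}}\tfrac12\|WX-Y\|_F^2$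 and let $\Phi$ be any minimizer of this problem (for instance one of minimum spectral norm). Let $\|\cdot\|$ be the spectral norm, $r=\operatorname{rank}X$, $\lambda_k(X^\top X)$ the $k$-th largest eigenvalue of $X^\top X$, and $\kappa=\lambda_{1}(X^\top X)/\lambda_r(X^\top X)$. **Theorem 1.** There are universal constants $C,C'>0$ such that the following holds. Let $\delta\in(0,1)$, suppose $$m\ \ge\ C\,L\,\max\Big\{r\kappa^3d_{\mathrm{out}}(1+\|\Phi\|^2),\ r\kappa^3\log\tfrac r\delta,\ \log L\Big\},$$ and let $0<\eta\le \frac{d_{\mathrm{out}}}{3L\|X^\top X\|}$. Then $\mathsf{OPT}$ is the global minimum value of $\ell$, and with probability at least $1-\delta$ over the random initialization, $$\ell(0)-\mathsf{OPT}\le C'\max\Big\{1,\tfrac{\log(r/\delta)}{d_{\mathrm{out}}},\|\Phi\|^2\Big\}\|X\|_F^2$$ and, for all $t\ge 0$, $$\ell(t)-\mathsf{OPT}\le\Big(1-\tfrac{\eta L\lambda_r(X^\top X)}{4d_{\mathrm{out}}}\Big)^t\big(\ell(0)-\mathsf{OPT}\big).$$ -/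

import Mathlib

open MeasureTheory ProbabilityTheory

noncomputable section

/-- The Frobenius norm `‖A‖_F` of a real matrix. -/
def frobNorm {p q : ℕ} (A : Matrix (Fin p) (Fin q) ℝ) : ℝ :=
  Real.sqrt (∑ i, ∑ j, A i j ^ 2)

open scoped Matrix.Norms.L2Operator in
/-- The spectral norm `‖A‖` of a real matrix, i.e. its operator norm between Euclidean spaces. -/
def specNorm {p q : ℕ} (A : Matrix (Fin p) (Fin q) ℝ) : ℝ := ‖A‖

theorem gram_isHermitian {p n : ℕ} (X : Matrix (Fin p) (Fin n) ℝ) :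
    (X.transpose * X).IsHermitian := by
  simpa using Matrix.isHermitian_conjTranspose_mul_self X

/-- `gramEig X k` is the `k`-th largest eigenvalue `λ_k(XᵀX)`, counted with multiplicity, for
`k = 1, …, n` (the value `0` outside this range is a convention that is never used). -/
def gramEig {p n : ℕ} (X : Matrix (Fin p) (Fin n) ℝ) (k : ℕ) : ℝ :=
  if h : k - 1 < Fintype.card (Fin n) then (gram_isHermitian X).eigenvalues₀ ⟨k - 1, h⟩ else 0

/-- The condition number `κ = λ_max(XᵀX) / λ_r(XᵀX)`, where `r = rank X`. -/
def condNum {p n : ℕ} (X : Matrix (Fin p) (Fin n) ℝ) : ℝ :=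
  gramEig X 1 / gramEig X X.rank

/-- The linear regression objective `f(W) = ½ ‖W X - Y‖_F²`. -/
def regLoss {din dout n : ℕ} (X : Matrix (Fin din) (Fin n) ℝ) (Y : Matrix (Fin dout) (Fin n) ℝ)
    (W : Matrix (Fin dout) (Fin din) ℝ) : ℝ :=
  1 / 2 * frobNorm (W * X - Y) ^ 2

/-- The optimal value `OPT` of the linear regression problem. -/
def optLoss {din dout n : ℕ} (X : Matrix (Fin din) (Fin n) ℝ)
    (Y : Matrix (Fin dout) (Fin n) ℝ) : ℝ :=
  ⨅ W : Matrix (Fin dout) (Fin din) ℝ, regLoss X Y W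

/-- The weights of an `L`-layer linear network whose layers have sizes `d 0` (input), `d 1`, …,
`d (L - 1)` (hidden), `d L` (output). Layers are numbered from `0`, so that `W i` is the matrix
of size `d (i + 1) × d i` that maps layer `i` to layer `i + 1`. -/
abbrev Weights (L : ℕ) (d : ℕ → ℕ) : Type :=
  ∀ i : Fin L, Fin (d (i + 1)) → Fin (d i) → ℝ

/-- The product of the first `k` weight matrices, the last of them leftmost. -/
def layerProd {L : ℕ} {d : ℕ → ℕ} (W : Weights L d) :
    (k : ℕ) → k ≤ L → Matrix (Fin (d k)) (Fin (d 0)) ℝ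
  | 0, _ => 1
  | k + 1, h => (Matrix.of (W ⟨k, h⟩) : Matrix (Fin (d (k + 1))) (Fin (d k)) ℝ) *
      layerProd W k (Nat.le_of_succ_le h)

/-- The training loss
`ℓ(W) = ½ ‖(m^(L-1) d_out)^(-1/2) • W_L ⋯ W_1 X - Y‖_F²`. -/
def netLoss {L : ℕ} {d : ℕ → ℕ} {n : ℕ} (m : ℕ) (X : Matrix (Fin (d 0)) (Fin n) ℝ)
    (Y : Matrix (Fin (d L)) (Fin n) ℝ) (W : Weights L d) : ℝ :=
  1 / 2 * frobNorm
    ((1 / Real.sqrt ((m : ℝ) ^ (L - 1) * (d L : ℝ))) • (layerProd W L le_rfl * X) - Y) ^ 2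

/-- The weights `W` with the entry `(a, b)` of the matrix in layer `i` replaced by `s`. -/
def setEntry {L : ℕ} {d : ℕ → ℕ} (W : Weights L d) (i : Fin L) (a : Fin (d (i + 1)))
    (b : Fin (d i)) (s : ℝ) : Weights L d :=
  Function.update W i (Function.update (W i) a (Function.update (W i a) b s))

/-- The partial derivatives `∂ℓ/∂W_i`, entry by entry. -/
def lossGrad {L : ℕ} {d : ℕ → ℕ} {n : ℕ} (m : ℕ) (X : Matrix (Fin (d 0)) (Fin n) ℝ)
    (Y : Matrix (Fin (d L)) (Fin n) ℝ) (W : Weights L d) : Weights L d :=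
  fun i a b => deriv (fun s : ℝ => netLoss m X Y (setEntry W i a b s)) (W i a b)

/-- The gradient descent iterates `W(t)` with step size `η`, started at `W0`. -/
def gdIter {L : ℕ} {d : ℕ → ℕ} {n : ℕ} (m : ℕ) (X : Matrix (Fin (d 0)) (Fin n) ℝ)
    (Y : Matrix (Fin (d L)) (Fin n) ℝ) (η : ℝ) (W0 : Weights L d) : ℕ → Weights L d
  | 0 => W0
  | t + 1 => gdIter m X Y η W0 t - η • lossGrad m X Y (gdIter m X Y η W0 t)

/-- The law of the initialization: all entries of all weight matrices are independent standard
Gaussians. -/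
def initLaw (L : ℕ) (d : ℕ → ℕ) : Measure (Weights L d) :=
  Measure.pi fun _ => Measure.pi fun _ => Measure.pi fun _ => gaussianReal 0 1

end

/-! Put `E = c • W_L ⋯ W_1 X - Φ X`, where `c` is the normalization. The normal equations make `Φ X
- Y` orthogonal to everything of the form `V X`, so the excess loss over `OPT` is exactly `½
‖E‖_F²`, and the gradient in each layer is `c Pᵀ E (S X)ᵀ`, with `P` the product of the layers above
and `S` the product of those below.

Deterministic part. Suppose that the `S`, on the column space of `X`, and the `Pᵀ` are nearly
isometric after scaling by powers of `√m`. Then every layer gradient has norm between constant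
multiples of `√(λ_r / d_out) ‖E‖` and `‖X‖ ‖E‖ / √d_out`. The first-order change of `E` therefore
contracts it at a rate of order `η L λ_r / d_out`, and the step-size bound lets the quadratic term
be absorbed (`WellConditioned.residual_contract`). The remainder involves products of interior
layers, for which a crude norm bound of order `√L` suffices. Conditioning survives small changes of
the layers (`WellConditioned.perturb`). Since the residual decays geometrically, the total movement
of the weights is a convergent geometric series, and a large width keeps it inside the region where
conditioning holds (`residual_convergence`).

Random part. A Gaussian matrix maps a fixed `u` to `‖u‖` times a standard Gaussian vector, so
moments of `‖W_j ⋯ W_i v‖`, both positive and negative, factor over the layers and follow from a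
Gamma recursion. Markov's inequality at an order proportional to `m / L` gives failure probability
`exp(-Ω(m / L))` for one vector. A net upgrades this to subspaces of dimension up to a multiple of
`m / L`, which covers the column space of `X`, the output space, and blocks of hidden coordinates;
there are `O(L)` blocks, hence the factor `√L` for interior products. The union bound over `O(L³)`
events costs the `log L` in the width (`measure_not_wellConditioned_le`). The size of the initial
output needs only positive moments, of order about `log (2 / δ)` (`measure_output_ge_le`). -/

/-! ### Frobenius and spectral norms -/

/-- The squared Euclidean norm of a vector. -/
def nsq {p : ℕ} (v : Fin p → ℝ) : ℝ := ∑ i, v i ^ 2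

theorem nsq_eq_norm_sq {p : ℕ} (v : Fin p → ℝ) :
    nsq v = ‖(WithLp.toLp 2 v : EuclideanSpace ℝ (Fin p))‖ ^ 2 := by
  rw [EuclideanSpace.real_norm_sq_eq]; rfl

theorem nsq_nonneg {p : ℕ} (v : Fin p → ℝ) : 0 ≤ nsq v := Finset.sum_nonneg fun _ _ => sq_nonneg _

/-- The entries of a matrix as a Euclidean vector. -/
def frobVec {p q : ℕ} : Matrix (Fin p) (Fin q) ℝ →ₗ[ℝ] EuclideanSpace ℝ (Fin p × Fin q) where
  toFun A := WithLp.toLp 2 fun x => A x.1 x.2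
  map_add' _ _ := rfl
  map_smul' _ _ := rfl

/-- The Frobenius inner product. -/
def frobInner {p q : ℕ} (A B : Matrix (Fin p) (Fin q) ℝ) : ℝ := ∑ i, ∑ j, A i j * B i j

theorem frobVec_apply {p q : ℕ} (A : Matrix (Fin p) (Fin q) ℝ) (x : Fin p × Fin q) :
    frobVec A x = A x.1 x.2 := rfl

theorem frobNorm_eq_norm {p q : ℕ} (A : Matrix (Fin p) (Fin q) ℝ) :
    frobNorm A = ‖frobVec A‖ := by
  rw [EuclideanSpace.norm_eq, frobNorm, Fintype.sum_prod_type]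
  simp only [frobVec_apply, Real.norm_eq_abs, sq_abs]

theorem frobInner_eq_inner {p q : ℕ} (A B : Matrix (Fin p) (Fin q) ℝ) :
    frobInner A B = inner ℝ (frobVec A) (frobVec B) := by
  simp only [PiLp.inner_apply, frobInner, Fintype.sum_prod_type, frobVec_apply]
  simp [mul_comm]

theorem frobNorm_sq {p q : ℕ} (A : Matrix (Fin p) (Fin q) ℝ) :
    frobNorm A ^ 2 = ∑ i, ∑ j, A i j ^ 2 :=
  Real.sq_sqrt (Finset.sum_nonneg fun _ _ => Finset.sum_nonneg fun _ _ => sq_nonneg _)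

theorem frobNorm_nonneg {p q : ℕ} (A : Matrix (Fin p) (Fin q) ℝ) : 0 ≤ frobNorm A :=
  Real.sqrt_nonneg _

theorem frobNorm_sq_eq_inner {p q : ℕ} (A : Matrix (Fin p) (Fin q) ℝ) :
    frobNorm A ^ 2 = frobInner A A := by
  rw [frobNorm_sq]; simp [frobInner, sq]

theorem frobNorm_sq_eq_sum_nsq {p q : ℕ} (A : Matrix (Fin p) (Fin q) ℝ) :
    frobNorm A ^ 2 = ∑ j, nsq fun i => A i j := by
  rw [frobNorm_sq, Finset.sum_comm]; rfl

theorem frobNorm_transpose {p q : ℕ} (A : Matrix (Fin p) (Fin q) ℝ) :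
    frobNorm A.transpose = frobNorm A := by
  rw [frobNorm, frobNorm, Finset.sum_comm]; rfl

theorem frobNorm_add_le {p q : ℕ} (A B : Matrix (Fin p) (Fin q) ℝ) :
    frobNorm (A + B) ≤ frobNorm A + frobNorm B := by
  simp only [frobNorm_eq_norm, map_add]; exact norm_add_le _ _

theorem frobNorm_neg {p q : ℕ} (A : Matrix (Fin p) (Fin q) ℝ) : frobNorm (-A) = frobNorm A := by
  simp only [frobNorm_eq_norm, map_neg, norm_neg]

theorem frobNorm_smul {p q : ℕ} (c : ℝ) (A : Matrix (Fin p) (Fin q) ℝ) :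
    frobNorm (c • A) = |c| * frobNorm A := by
  simp only [frobNorm_eq_norm, map_smul, norm_smul, Real.norm_eq_abs]

theorem frobNorm_sum_le {p q : ℕ} {ι : Type*} (s : Finset ι)
    (A : ι → Matrix (Fin p) (Fin q) ℝ) : frobNorm (∑ k ∈ s, A k) ≤ ∑ k ∈ s, frobNorm (A k) := by
  simp only [frobNorm_eq_norm, map_sum]; exact norm_sum_le _ _

theorem frobNorm_add_sq {p q : ℕ} (A B : Matrix (Fin p) (Fin q) ℝ) :
    frobNorm (A + B) ^ 2 = frobNorm A ^ 2 + 2 * frobInner A B + frobNorm B ^ 2 := by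
  simp only [frobNorm_eq_norm, map_add, frobInner_eq_inner]; exact norm_add_sq_real _ _

theorem frobNorm_sub_sq {p q : ℕ} (A B : Matrix (Fin p) (Fin q) ℝ) :
    frobNorm (A - B) ^ 2 = frobNorm A ^ 2 - 2 * frobInner A B + frobNorm B ^ 2 := by
  simp only [frobNorm_eq_norm, map_sub, frobInner_eq_inner]; exact norm_sub_sq_real _ _

theorem frobInner_eq_trace {p q : ℕ} (A B : Matrix (Fin p) (Fin q) ℝ) :
    frobInner A B = (A.transpose * B).trace := by
  simp only [frobInner, Matrix.trace, Matrix.diag, Matrix.mul_apply, Matrix.transpose_apply]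
  exact Finset.sum_comm

theorem frobInner_comm {p q : ℕ} (A B : Matrix (Fin p) (Fin q) ℝ) :
    frobInner A B = frobInner B A := by
  simp only [frobInner, mul_comm]

theorem frobInner_sum_right {p q : ℕ} {ι : Type*} (s : Finset ι) (A : Matrix (Fin p) (Fin q) ℝ)
    (B : ι → Matrix (Fin p) (Fin q) ℝ) :
    frobInner A (∑ k ∈ s, B k) = ∑ k ∈ s, frobInner A (B k) := by
  simp only [frobInner_eq_inner, map_sum, inner_sum]

theorem frobInner_smul_right {p q : ℕ} (c : ℝ) (A B : Matrix (Fin p) (Fin q) ℝ) :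
    frobInner A (c • B) = c * frobInner A B := by
  simp only [frobInner_eq_inner, map_smul, inner_smul_right]

theorem frobInner_mul_right {p q s : ℕ} (A : Matrix (Fin p) (Fin q) ℝ)
    (B : Matrix (Fin p) (Fin s) ℝ) (C : Matrix (Fin s) (Fin q) ℝ) :
    frobInner A (B * C) = frobInner (A * C.transpose) B := by
  rw [frobInner_eq_trace, frobInner_eq_trace, Matrix.transpose_mul, Matrix.transpose_transpose,
    ← Matrix.mul_assoc, Matrix.trace_mul_comm, Matrix.mul_assoc]

theorem frobInner_mul_left {p q s : ℕ} (A : Matrix (Fin p) (Fin q) ℝ)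
    (B : Matrix (Fin p) (Fin s) ℝ) (C : Matrix (Fin s) (Fin q) ℝ) :
    frobInner A (B * C) = frobInner (B.transpose * A) C := by
  rw [frobInner_eq_trace, frobInner_eq_trace, Matrix.transpose_mul, Matrix.transpose_transpose,
    ← Matrix.mul_assoc]

open scoped Matrix.Norms.L2Operator in
theorem nsq_mulVec_le {p q : ℕ} (A : Matrix (Fin p) (Fin q) ℝ) (v : Fin q → ℝ) :
    nsq (A.mulVec v) ≤ specNorm A ^ 2 * nsq v := by
  rw [nsq_eq_norm_sq, nsq_eq_norm_sq, ← mul_pow]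
  exact pow_le_pow_left₀ (norm_nonneg _) (Matrix.l2_opNorm_mulVec A (WithLp.toLp 2 v)) 2

open scoped Matrix.Norms.L2Operator in
theorem specNorm_nonneg {p q : ℕ} (A : Matrix (Fin p) (Fin q) ℝ) : 0 ≤ specNorm A :=
  norm_nonneg _

open scoped Matrix.Norms.L2Operator in
theorem specNorm_le_of_nsq {p q : ℕ} (A : Matrix (Fin p) (Fin q) ℝ) (c : ℝ) (hc : 0 ≤ c)
    (h : ∀ v, nsq (A.mulVec v) ≤ c ^ 2 * nsq v) : specNorm A ≤ c := by
  rw [specNorm, Matrix.l2_opNorm_def]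
  refine ContinuousLinearMap.opNorm_le_bound _ hc fun x => ?_
  have := h x.ofLp
  rw [nsq_eq_norm_sq, nsq_eq_norm_sq, ← mul_pow] at this
  exact le_of_sq_le_sq this (by positivity)

open scoped Matrix.Norms.L2Operator in
theorem specNorm_mul_le {p q s : ℕ} (A : Matrix (Fin p) (Fin q) ℝ) (B : Matrix (Fin q) (Fin s) ℝ) :
    specNorm (A * B) ≤ specNorm A * specNorm B := Matrix.l2_opNorm_mul A B

open scoped Matrix.Norms.L2Operator in
theorem specNorm_add_le {p q : ℕ} (A B : Matrix (Fin p) (Fin q) ℝ) :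
    specNorm (A + B) ≤ specNorm A + specNorm B := norm_add_le A B

open scoped Matrix.Norms.L2Operator in
theorem specNorm_sum_le {p q : ℕ} {ι : Type*} (s : Finset ι)
    (A : ι → Matrix (Fin p) (Fin q) ℝ) : specNorm (∑ k ∈ s, A k) ≤ ∑ k ∈ s, specNorm (A k) :=
  norm_sum_le _ _

open scoped Matrix.Norms.L2Operator in
theorem specNorm_smul {p q : ℕ} (c : ℝ) (A : Matrix (Fin p) (Fin q) ℝ) :
    specNorm (c • A) = |c| * specNorm A := norm_smul c A

open scoped Matrix.Norms.L2Operator in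
theorem specNorm_neg {p q : ℕ} (A : Matrix (Fin p) (Fin q) ℝ) : specNorm (-A) = specNorm A :=
  norm_neg A

open scoped Matrix.Norms.L2Operator in
theorem specNorm_zero {p q : ℕ} : specNorm (0 : Matrix (Fin p) (Fin q) ℝ) = 0 := norm_zero

open scoped Matrix.Norms.L2Operator in
theorem specNorm_transpose {p q : ℕ} (A : Matrix (Fin p) (Fin q) ℝ) :
    specNorm A.transpose = specNorm A := by
  rw [← Matrix.conjTranspose_eq_transpose_of_trivial]; exact Matrix.l2_opNorm_conjTranspose A

open scoped Matrix.Norms.L2Operator in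
theorem specNorm_gram {p q : ℕ} (A : Matrix (Fin p) (Fin q) ℝ) :
    specNorm (A.transpose * A) = specNorm A ^ 2 := by
  rw [← Matrix.conjTranspose_eq_transpose_of_trivial, sq]
  exact Matrix.l2_opNorm_conjTranspose_mul_self A

theorem specNorm_pos {p q : ℕ} (A : Matrix (Fin p) (Fin q) ℝ) (h : A ≠ 0) : 0 < specNorm A := by
  open scoped Matrix.Norms.L2Operator in exact norm_pos_iff.2 h

theorem mul_col {p q s : ℕ} (A : Matrix (Fin p) (Fin q) ℝ) (B : Matrix (Fin q) (Fin s) ℝ)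
    (j : Fin s) : (fun i => (A * B) i j) = A.mulVec fun i => B i j := by
  ext i; simp [Matrix.mul_apply, Matrix.mulVec, dotProduct]

theorem frobNorm_mul_le {p q s : ℕ} (A : Matrix (Fin p) (Fin q) ℝ) (B : Matrix (Fin q) (Fin s) ℝ) :
    frobNorm (A * B) ≤ specNorm A * frobNorm B := by
  refine le_of_sq_le_sq ?_ (mul_nonneg (specNorm_nonneg _) (frobNorm_nonneg _))
  rw [mul_pow, frobNorm_sq_eq_sum_nsq, frobNorm_sq_eq_sum_nsq, Finset.mul_sum]
  exact Finset.sum_le_sum fun j _ => by rw [mul_col]; exact nsq_mulVec_le _ _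

theorem frobNorm_mul_le' {p q s : ℕ} (A : Matrix (Fin p) (Fin q) ℝ)
    (B : Matrix (Fin q) (Fin s) ℝ) : frobNorm (A * B) ≤ frobNorm A * specNorm B := by
  rw [← frobNorm_transpose, Matrix.transpose_mul, mul_comm, ← specNorm_transpose B,
    ← frobNorm_transpose A]
  exact frobNorm_mul_le _ _

theorem specNorm_le_frobNorm {p q : ℕ} (A : Matrix (Fin p) (Fin q) ℝ) :
    specNorm A ≤ frobNorm A := by
  refine specNorm_le_of_nsq A _ (frobNorm_nonneg _) fun v => ?_
  rw [frobNorm_sq, Finset.sum_mul]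
  refine Finset.sum_le_sum fun i _ => ?_
  exact Finset.sum_mul_sq_le_sq_mul_sq Finset.univ (fun j => A i j) v

/-! ### Products of consecutive layers -/

/-- A sequence of weight matrices of a network with layer sizes `d 0, d 1, …`. -/
abbrev Layers (d : ℕ → ℕ) : Type := ∀ k, Matrix (Fin (d (k + 1))) (Fin (d k)) ℝ

/-- `seg A i j = A_{j-1} ⋯ A_i` maps layer `i` to layer `j`. -/
def seg {d : ℕ → ℕ} (A : Layers d) (i : ℕ) : (j : ℕ) → Matrix (Fin (d j)) (Fin (d i)) ℝ
  -- For `j < i` the truncated identity is only a default value. At `j = i` it is the true identity,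
  -- and this form avoids a cast between `Fin (d j)` and `Fin (d i)`.
  | 0 => Matrix.of fun a b => if (a : ℕ) = b then 1 else 0
  | j + 1 => if j + 1 ≤ i then Matrix.of fun a b => if (a : ℕ) = b then 1 else 0 else A j * seg A i j

theorem seg_self {d : ℕ → ℕ} (A : Layers d) (i : ℕ) : seg A i i = 1 := by
  cases i with
  | zero => ext a b; simp [seg, Matrix.one_apply, Fin.ext_iff]
  | succ j => ext a b; simp [seg, Matrix.one_apply, Fin.ext_iff]

theorem seg_succ {d : ℕ → ℕ} (A : Layers d) {i j : ℕ} (h : i ≤ j) :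
    seg A i (j + 1) = A j * seg A i j := by
  rw [seg, if_neg (by omega)]

theorem seg_cons {d : ℕ → ℕ} (A : Layers d) {i j : ℕ} (h : i < j) :
    seg A i j = seg A (i + 1) j * A i := by
  induction j, h using Nat.le_induction with
  | base => rw [seg_succ A le_rfl, seg_self, seg_self, Matrix.mul_one, Matrix.one_mul]
  | succ j hj ih => rw [seg_succ A (by omega), seg_succ A hj, ih, Matrix.mul_assoc]

theorem seg_congr {d : ℕ → ℕ} {A B : Layers d} {i j : ℕ} (hij : i ≤ j)
    (h : ∀ k, i ≤ k → k < j → A k = B k) : seg A i j = seg B i j := by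
  induction j, hij using Nat.le_induction with
  | base => rw [seg_self, seg_self]
  | succ j hj ih =>
    rw [seg_succ A hj, seg_succ B hj, h j hj (by omega), ih fun k h1 h2 => h k h1 (by omega)]

/-- Telescoping: layers are exchanged one at a time. Each term has `A` on the output side and `B` on
the input side, which suits estimates where the outer factor is known for `A`. -/
theorem seg_eq_add_sum {d : ℕ → ℕ} (A B : Layers d) {i j : ℕ} (hij : i ≤ j) :
    seg B i j = seg A i j + ∑ k ∈ Finset.Ico i j, seg A (k + 1) j * (B k - A k) * seg B i k := by
  induction j, hij using Nat.le_induction with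
  | base => simp [seg_self]
  | succ j hj ih =>
    rw [Finset.sum_Ico_succ_top hj, seg_succ B hj, seg_succ A hj, seg_self, Matrix.one_mul,
      Matrix.sub_mul]
    have : ∀ k ∈ Finset.Ico i j, seg A (k + 1) (j + 1) * (B k - A k) * seg B i k =
        A j * (seg A (k + 1) j * (B k - A k) * seg B i k) := fun k hk => by
      rw [seg_succ A (Finset.mem_Ico.1 hk).2]; simp only [Matrix.mul_assoc]
    rw [Finset.sum_congr rfl this, ← Matrix.mul_sum]
    rw [← add_assoc, ← Matrix.mul_add, ← ih]; abel

/-- The mirror image of `seg_eq_add_sum`, with `B` on the output side and `A` on the input side. -/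
theorem seg_sub_eq_sum {d : ℕ → ℕ} (A B : Layers d) {i j : ℕ} (hij : i ≤ j) :
    seg B i j - seg A i j =
      ∑ k ∈ Finset.Ico i j, seg B (k + 1) j * (B k - A k) * seg A i k := by
  have h := seg_eq_add_sum B A hij
  have : ∑ k ∈ Finset.Ico i j, seg B (k + 1) j * (B k - A k) * seg A i k =
      - ∑ k ∈ Finset.Ico i j, seg B (k + 1) j * (A k - B k) * seg A i k := by
    rw [← Finset.sum_neg_distrib]
    exact Finset.sum_congr rfl fun k _ => by
      rw [← neg_sub (A k), Matrix.mul_neg, Matrix.neg_mul]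
  rw [this, sub_eq_iff_eq_add, neg_add_eq_sub]; exact eq_sub_of_add_eq h.symm

/-! ### The spectrum of the Gram matrix -/

theorem nsq_mulVec_eq_dotProduct {p n : ℕ} (X : Matrix (Fin p) (Fin n) ℝ) (e : Fin n → ℝ) :
    nsq (X.mulVec e) = e ⬝ᵥ (X.transpose * X).mulVec e := by
  rw [← Matrix.mulVec_mulVec, Matrix.dotProduct_mulVec, Matrix.vecMul_transpose]
  simp [nsq, dotProduct, sq]

/-- `‖X e‖²` in the eigenbasis of the Gram matrix. -/
theorem nsq_mulVec_eq_sum {p n : ℕ} (X : Matrix (Fin p) (Fin n) ℝ) (e : Fin n → ℝ) :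
    nsq (X.mulVec e) = ∑ i, (gram_isHermitian X).eigenvalues i *
      (((gram_isHermitian X).eigenvectorBasis i).ofLp ⬝ᵥ e) ^ 2 := by
  set hA := gram_isHermitian X
  have key := hA.eigenvectorBasis.sum_inner_mul_inner (WithLp.toLp 2 e)
    (WithLp.toLp 2 ((X.transpose * X).mulVec e))
  rw [nsq_mulVec_eq_dotProduct]
  have h1 : inner ℝ (WithLp.toLp 2 e : EuclideanSpace ℝ (Fin n))
      (WithLp.toLp 2 ((X.transpose * X).mulVec e)) = e ⬝ᵥ (X.transpose * X).mulVec e := by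
    simp [PiLp.inner_apply, dotProduct, mul_comm]
  rw [← h1, ← key]
  refine Finset.sum_congr rfl fun i _ => ?_
  have h2 : inner ℝ (WithLp.toLp 2 e : EuclideanSpace ℝ (Fin n)) (hA.eigenvectorBasis i) =
      (hA.eigenvectorBasis i).ofLp ⬝ᵥ e := by
    simp [PiLp.inner_apply, dotProduct]
  have h3 : inner ℝ (hA.eigenvectorBasis i) (WithLp.toLp 2 ((X.transpose * X).mulVec e)) =
      (hA.eigenvectorBasis i).ofLp ⬝ᵥ (X.transpose * X).mulVec e := by
    simp [PiLp.inner_apply, dotProduct, mul_comm]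
  rw [h2, h3, Matrix.dotProduct_mulVec, ← Matrix.mulVec_transpose, Matrix.transpose_mul,
    Matrix.transpose_transpose, hA.mulVec_eigenvectorBasis, smul_dotProduct, smul_eq_mul]
  ring

theorem nsq_eq_sum_eigen {p n : ℕ} (X : Matrix (Fin p) (Fin n) ℝ) (e : Fin n → ℝ) :
    nsq e = ∑ i, (((gram_isHermitian X).eigenvectorBasis i).ofLp ⬝ᵥ e) ^ 2 := by
  rw [nsq_eq_norm_sq, ← (gram_isHermitian X).eigenvectorBasis.sum_sq_norm_inner_right]
  refine Finset.sum_congr rfl fun i _ => ?_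
  rw [Real.norm_eq_abs, sq_abs]
  congr 1
  simp [PiLp.inner_apply, dotProduct, mul_comm]

theorem nsq_eigenvector {p n : ℕ} (X : Matrix (Fin p) (Fin n) ℝ) (i : Fin n) :
    nsq ((gram_isHermitian X).eigenvectorBasis i).ofLp = 1 := by
  rw [nsq_eq_norm_sq, WithLp.toLp_ofLp, OrthonormalBasis.norm_eq_one, one_pow]

theorem eigenvalues_eq_nsq {p n : ℕ} (X : Matrix (Fin p) (Fin n) ℝ) (i : Fin n) :
    (gram_isHermitian X).eigenvalues i =
      nsq (X.mulVec ((gram_isHermitian X).eigenvectorBasis i).ofLp) := by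
  have h := nsq_eigenvector X i
  rw [nsq_mulVec_eq_dotProduct, (gram_isHermitian X).mulVec_eigenvectorBasis, dotProduct_smul,
    smul_eq_mul]
  have : nsq ((gram_isHermitian X).eigenvectorBasis i).ofLp =
    ((gram_isHermitian X).eigenvectorBasis i).ofLp ⬝ᵥ
      ((gram_isHermitian X).eigenvectorBasis i).ofLp := by simp [nsq, dotProduct, sq]
  rw [← this, h, mul_one]

theorem eigenvalues_gram_nonneg {p n : ℕ} (X : Matrix (Fin p) (Fin n) ℝ) (i : Fin n) :
    0 ≤ (gram_isHermitian X).eigenvalues i := by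
  rw [eigenvalues_eq_nsq]; exact nsq_nonneg _

theorem eigenvalues_gram_le {p n : ℕ} (X : Matrix (Fin p) (Fin n) ℝ) (i : Fin n) :
    (gram_isHermitian X).eigenvalues i ≤ specNorm X ^ 2 := by
  rw [eigenvalues_eq_nsq]
  simpa [nsq_eigenvector] using nsq_mulVec_le X ((gram_isHermitian X).eigenvectorBasis i).ofLp

theorem eigenvalues₀_eq {p n : ℕ} (X : Matrix (Fin p) (Fin n) ℝ)
    (k : Fin (Fintype.card (Fin n))) :
    (gram_isHermitian X).eigenvalues₀ k = (gram_isHermitian X).eigenvalues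
      (Fintype.equivOfCardEq (Fintype.card_fin _) k) := by
  rw [Matrix.IsHermitian.eigenvalues, Equiv.symm_apply_apply]

theorem rank_eq_card_eigenvalues₀ {p n : ℕ} (X : Matrix (Fin p) (Fin n) ℝ) :
    X.rank = (Finset.univ.filter fun k => (gram_isHermitian X).eigenvalues₀ k ≠ 0).card := by
  rw [← Matrix.rank_transpose_mul_self, (gram_isHermitian X).rank_eq_card_non_zero_eigs,
    ← Fintype.card_subtype]
  exact Fintype.card_congr (Equiv.subtypeEquiv
    (Fintype.equivOfCardEq (Fintype.card_fin _)).symm fun a => Iff.rfl)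

theorem rank_pos_of_ne_zero {p n : ℕ} (X : Matrix (Fin p) (Fin n) ℝ) (hX : X ≠ 0) :
    0 < X.rank := by
  rcases Nat.eq_zero_or_pos X.rank with h | h
  · rw [Matrix.rank, Submodule.finrank_eq_zero, LinearMap.range_eq_bot] at h
    refine absurd (Matrix.ext_of_mulVec_single fun i => ?_) hX
    rw [Matrix.zero_mulVec]
    exact LinearMap.congr_fun h (Pi.single i 1)
  · exact h

/-- The eigenvalues with index below the rank are exactly the nonzero ones. -/
theorem eigenvalues₀_ne_zero_iff {p n : ℕ} (X : Matrix (Fin p) (Fin n) ℝ)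
    (k : Fin (Fintype.card (Fin n))) :
    (gram_isHermitian X).eigenvalues₀ k ≠ 0 ↔ (k : ℕ) < X.rank := by
  have hanti := (gram_isHermitian X).eigenvalues₀_antitone
  have hnn : ∀ k, 0 ≤ (gram_isHermitian X).eigenvalues₀ k := fun k => by
    rw [eigenvalues₀_eq]; exact eigenvalues_gram_nonneg X _
  have hr := rank_eq_card_eigenvalues₀ X
  constructor
  · intro hk
    -- The eigenvalues are nonnegative and decreasing, so the nonzero ones form an initial segment.
    -- Comparing its cardinality, which is the rank, with that of `Iic k` or `Iio k` settles each
    -- direction.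
    have hsub : Finset.Iic k ⊆
        Finset.univ.filter fun k => (gram_isHermitian X).eigenvalues₀ k ≠ 0 := fun j hj => by
      simp only [Finset.mem_filter, Finset.mem_univ, true_and]
      exact (((hnn k).lt_of_ne' hk).trans_le (hanti (Finset.mem_Iic.1 hj))).ne'
    have := Finset.card_le_card hsub
    rw [Fin.card_Iic, ← hr] at this
    omega
  · intro hk h0
    have hsub : (Finset.univ.filter fun k => (gram_isHermitian X).eigenvalues₀ k ≠ 0) ⊆
        Finset.Iio k := fun j hj => by
      simp only [Finset.mem_filter, Finset.mem_univ, true_and] at hj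
      rw [Finset.mem_Iio]
      by_contra hjk
      exact hj (le_antisymm (h0 ▸ hanti (not_lt.1 hjk)) (hnn j))
    have := Finset.card_le_card hsub
    rw [Fin.card_Iio, ← hr] at this
    omega

theorem gramEig_eq {p n : ℕ} (X : Matrix (Fin p) (Fin n) ℝ) (k : ℕ) (hk : k - 1 < n) :
    gramEig X k = (gram_isHermitian X).eigenvalues₀ ⟨k - 1, by simpa using hk⟩ := by
  rw [gramEig, dif_pos (by simpa using hk)]

theorem gramEig_rank_pos {p n : ℕ} (X : Matrix (Fin p) (Fin n) ℝ) (hX : X ≠ 0) :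
    0 < gramEig X X.rank := by
  have hr := rank_pos_of_ne_zero X hX
  have hn : X.rank ≤ n := X.rank_le_width
  rw [gramEig_eq X _ (by omega)]
  refine lt_of_le_of_ne ?_ ((eigenvalues₀_ne_zero_iff X _).2 (by simp only; omega)).symm
  rw [eigenvalues₀_eq]; exact eigenvalues_gram_nonneg X _

theorem gramEig_rank_le {p n : ℕ} (X : Matrix (Fin p) (Fin n) ℝ) (hX : X ≠ 0) :
    gramEig X X.rank ≤ specNorm X ^ 2 := by
  have hr := rank_pos_of_ne_zero X hX
  have hn : X.rank ≤ n := X.rank_le_width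
  rw [gramEig_eq X _ (by omega), eigenvalues₀_eq]
  exact eigenvalues_gram_le X _

theorem specNorm_sq_le_gramEig_one {p n : ℕ} (X : Matrix (Fin p) (Fin n) ℝ)
    (hX : X ≠ 0) : specNorm X ^ 2 ≤ gramEig X 1 := by
  have hr := rank_pos_of_ne_zero X hX
  have hn : X.rank ≤ n := X.rank_le_width
  rw [gramEig_eq X _ (by omega)]
  set l := (gram_isHermitian X).eigenvalues₀ ⟨1 - 1, by simp; omega⟩ with hl
  have hle : ∀ i, (gram_isHermitian X).eigenvalues i ≤ l := fun i =>
    (gram_isHermitian X).eigenvalues₀_antitone (Fin.mk_le_of_le_val (by simp))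
  have hl0 : 0 ≤ l := by rw [hl, eigenvalues₀_eq]; exact eigenvalues_gram_nonneg X _
  have : specNorm X ≤ √l := by
    refine specNorm_le_of_nsq X _ (Real.sqrt_nonneg _) fun v => ?_
    rw [Real.sq_sqrt hl0, nsq_mulVec_eq_sum, nsq_eq_sum_eigen X v, Finset.mul_sum]
    exact Finset.sum_le_sum fun i _ => mul_le_mul_of_nonneg_right (hle i) (sq_nonneg _)
  calc specNorm X ^ 2 ≤ √l ^ 2 := pow_le_pow_left₀ (specNorm_nonneg X) this 2
    _ = l := Real.sq_sqrt hl0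

/-- `X` is bounded below by `√λ_r` on its row space. -/
theorem gramEig_rank_mul_nsq_le {p n : ℕ} (X : Matrix (Fin p) (Fin n) ℝ) (w : Fin p → ℝ) :
    gramEig X X.rank * nsq (X.transpose.mulVec w) ≤
      nsq (X.mulVec (X.transpose.mulVec w)) := by
  rw [nsq_mulVec_eq_sum X (X.transpose.mulVec w), nsq_eq_sum_eigen X, Finset.mul_sum]
  refine Finset.sum_le_sum fun i _ => ?_
  by_cases h0 : (gram_isHermitian X).eigenvalues i = 0
  -- Eigenvectors with eigenvalue zero lie in the kernel of `X`, hence are orthogonal to `Xᵀ w` and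
  -- contribute to neither side.
  · have : X.mulVec ((gram_isHermitian X).eigenvectorBasis i).ofLp = 0 := by
      have h := eigenvalues_eq_nsq X i
      rw [h0, nsq_eq_norm_sq, eq_comm, sq_eq_zero_iff, norm_eq_zero] at h
      exact (WithLp.toLp_eq_zero 2).1 h
    have h1 : ((gram_isHermitian X).eigenvectorBasis i).ofLp ⬝ᵥ X.transpose.mulVec w = 0 := by
      rw [Matrix.dotProduct_mulVec, Matrix.vecMul_transpose, this, zero_dotProduct]
    simp [h1]
  · refine mul_le_mul_of_nonneg_right ?_ (sq_nonneg _)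
    set k := (Fintype.equivOfCardEq (Fintype.card_fin _)).symm i with hk
    have hki : (gram_isHermitian X).eigenvalues i = (gram_isHermitian X).eigenvalues₀ k := rfl
    have hlt : (k : ℕ) < X.rank := (eigenvalues₀_ne_zero_iff X k).1 (by rwa [← hki])
    have hn : X.rank ≤ n := X.rank_le_width
    rw [gramEig_eq X _ (by omega), hki]
    exact (gram_isHermitian X).eigenvalues₀_antitone (Fin.le_def.2 (by simp only; omega))

/-- The rows of `V X` lie in the row space of `X`, so the bound for vectors applies to each of them.
The residual has this form, which is why `λ_r` rather than the possibly vanishing smallest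
eigenvalue governs convergence. -/
theorem gramEig_rank_mul_frobNorm_le {p n q : ℕ} (X : Matrix (Fin p) (Fin n) ℝ)
    (V : Matrix (Fin q) (Fin p) ℝ) :
    gramEig X X.rank * frobNorm (V * X) ^ 2 ≤ frobNorm (X * (V * X).transpose) ^ 2 := by
  rw [← frobNorm_transpose (V * X), frobNorm_sq_eq_sum_nsq, frobNorm_sq_eq_sum_nsq,
    Finset.mul_sum]
  refine Finset.sum_le_sum fun j _ => ?_
  rw [mul_col, Matrix.transpose_mul, mul_col]
  exact gramEig_rank_mul_nsq_le X _

/-! ### Well-conditioned layers -/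

theorem nsq_eq_frobNorm_sq {p : ℕ} (v : Fin p → ℝ) :
    nsq v = frobNorm (Matrix.of fun i (_ : Fin 1) => v i) ^ 2 := by
  rw [frobNorm_sq]; simp [nsq]

theorem specNorm_le_of_frobNorm {p q : ℕ} (A : Matrix (Fin p) (Fin q) ℝ) (c : ℝ) (hc : 0 ≤ c)
    (h : ∀ Z : Matrix (Fin q) (Fin 1) ℝ, frobNorm (A * Z) ≤ c * frobNorm Z) :
    specNorm A ≤ c := by
  refine specNorm_le_of_nsq A c hc fun v => ?_
  rw [nsq_eq_frobNorm_sq, nsq_eq_frobNorm_sq, ← mul_pow]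
  exact pow_le_pow_left₀ (frobNorm_nonneg _) (h _) 2

/-- All products of consecutive layers that occur in the gradient of the loss are controlled:
products starting at the input are, on the column space of `X`, close to `μ ^ j` times an isometry,
so are the transposes of the products ending at the output, and all others have norm at most
`M * μ ^ (j - i)`. -/
structure WellConditioned {d : ℕ → ℕ} {n : ℕ} (L : ℕ) (μ α M : ℝ)
    (X : Matrix (Fin (d 0)) (Fin n) ℝ) (B : Layers d) : Prop where
  bot_lower : ∀ j < L, ∀ q, ∀ Z : Matrix (Fin n) (Fin q) ℝ,
    (1 - α) * μ ^ j * frobNorm (X * Z) ≤ frobNorm (seg B 0 j * (X * Z))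
  bot_upper : ∀ j < L, ∀ q, ∀ Z : Matrix (Fin n) (Fin q) ℝ,
    frobNorm (seg B 0 j * (X * Z)) ≤ (1 + α) * μ ^ j * frobNorm (X * Z)
  top_lower : ∀ i, 1 ≤ i → i ≤ L → ∀ q, ∀ Z : Matrix (Fin (d L)) (Fin q) ℝ,
    (1 - α) * μ ^ (L - i) * frobNorm Z ≤ frobNorm ((seg B i L).transpose * Z)
  top_upper : ∀ i, 1 ≤ i → i ≤ L → specNorm (seg B i L) ≤ (1 + α) * μ ^ (L - i)
  mid : ∀ i j, 1 ≤ i → i ≤ j → j < L → specNorm (seg B i j) ≤ M * μ ^ (j - i)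

theorem sum_Ico_le_of_le {i j L : ℕ} (hj : j ≤ L) {f : ℕ → ℝ} {c : ℝ} (hc : 0 ≤ c)
    (h : ∀ k ∈ Finset.Ico i j, f k ≤ c) : ∑ k ∈ Finset.Ico i j, f k ≤ L * c := by
  refine (Finset.sum_le_card_nsmul _ _ _ h).trans ?_
  rw [nsmul_eq_mul, Nat.card_Ico]
  exact mul_le_mul_of_nonneg_right (by exact_mod_cast (Nat.sub_le _ _).trans hj) hc

theorem specNorm_mul_mul_le {p q s t : ℕ} (A : Matrix (Fin p) (Fin q) ℝ)
    (B : Matrix (Fin q) (Fin s) ℝ) (C : Matrix (Fin s) (Fin t) ℝ) {a b c : ℝ}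
    (ha : specNorm A ≤ a) (hb : specNorm B ≤ b) (hc : specNorm C ≤ c) :
    specNorm (A * B * C) ≤ a * b * c := by
  have h0 := specNorm_nonneg A
  have h1 := specNorm_nonneg B
  have h2 := specNorm_nonneg C
  calc specNorm (A * B * C) ≤ specNorm A * specNorm B * specNorm C :=
        (specNorm_mul_le _ _).trans (mul_le_mul_of_nonneg_right (specNorm_mul_le _ _) h2)
    _ ≤ a * b * c := by
        have ha0 := h0.trans ha
        have := mul_nonneg ha0 (h1.trans hb)
        gcongr

theorem frobNorm_mul_mul_le {p q s t : ℕ} (A : Matrix (Fin p) (Fin q) ℝ)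
    (B : Matrix (Fin q) (Fin s) ℝ) (C : Matrix (Fin s) (Fin t) ℝ) {a b c : ℝ}
    (ha : specNorm A ≤ a) (hb : specNorm B ≤ b) (hc : frobNorm C ≤ c) :
    frobNorm (A * B * C) ≤ a * b * c := by
  have h0 := specNorm_nonneg A
  have h1 := specNorm_nonneg B
  have h2 := frobNorm_nonneg C
  calc frobNorm (A * B * C) ≤ specNorm A * specNorm B * frobNorm C :=
        (frobNorm_mul_le _ _).trans (mul_le_mul_of_nonneg_right (specNorm_mul_le _ _) h2)
    _ ≤ a * b * c := by
        have ha0 := h0.trans ha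
        have := mul_nonneg ha0 (h1.trans hb)
        gcongr

theorem frobNorm_mul_mul_le' {p q s t : ℕ} (A : Matrix (Fin p) (Fin q) ℝ)
    (B : Matrix (Fin q) (Fin s) ℝ) (C : Matrix (Fin s) (Fin t) ℝ) {a b c : ℝ}
    (ha : specNorm A ≤ a) (hb : frobNorm B ≤ b) (hc : specNorm C ≤ c) :
    frobNorm (A * B * C) ≤ a * b * c := by
  have h0 := specNorm_nonneg A
  have h1 := frobNorm_nonneg B
  have h2 := specNorm_nonneg C
  calc frobNorm (A * B * C) ≤ specNorm A * frobNorm B * specNorm C :=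
        (frobNorm_mul_le' _ _).trans (mul_le_mul_of_nonneg_right (frobNorm_mul_le _ _) h2)
    _ ≤ a * b * c := by
        have ha0 := h0.trans ha
        have := mul_nonneg ha0 (h1.trans hb)
        gcongr

/-- The ratio is `(1 + x / μ) ^ n ≤ exp (n x / μ) ≤ exp (1 / 2) ≤ 2`: a relative perturbation of
order `1 / L` per layer costs only a constant over `L` layers. -/
theorem add_pow_le_two_mul_pow {μ x : ℝ} (hμ : 0 < μ) (hx : 0 ≤ x) {n L : ℕ} (hn : n ≤ L)
    (h : L * x ≤ μ / 2) : (μ + x) ^ n ≤ 2 * μ ^ n := by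
  have h1 : (μ + x) ^ n = (1 + x / μ) ^ n * μ ^ n := by
    rw [← mul_pow]; congr 1; field_simp
  rw [h1]
  refine mul_le_mul_of_nonneg_right ?_ (by positivity)
  have h2 : 1 + x / μ ≤ Real.exp (x / μ) := by
    have := Real.add_one_le_exp (x / μ); linarith
  have h3 : (n : ℝ) * (x / μ) ≤ 1 / 2 := by
    rw [mul_div_assoc', div_le_iff₀ hμ]
    have : (n : ℝ) * x ≤ L * x := mul_le_mul_of_nonneg_right (by exact_mod_cast hn) hx
    linarith
  calc (1 + x / μ) ^ n ≤ Real.exp (x / μ) ^ n := pow_le_pow_left₀ (by positivity) h2 n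
    _ = Real.exp (n * (x / μ)) := (Real.exp_nat_mul _ _).symm
    _ ≤ Real.exp (1 / 2) := Real.exp_le_exp.2 h3
    _ ≤ 1 / (1 - 1 / 2) := Real.exp_bound_div_one_sub_of_interval (by norm_num) (by norm_num)
    _ = 2 := by norm_num

/-- With `B` on the input side of the telescoping sum, strong induction bounds the shorter products
of `B`. The resulting sum is the geometric one in `a ^ n - b ^ n = (a - b) ∑ a ^ l b ^ (n - 1 - l)`
for `a = μ + K R` and `b = μ`, so the recursion closes exactly. -/
theorem mid_perturb {d : ℕ → ℕ} {L : ℕ} {μ K R : ℝ}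
    {A B : Layers d} (hA : ∀ i j, 1 ≤ i → i ≤ j → j < L → specNorm (seg A i j) ≤ K * μ ^ (j - i))
    (hAB : ∀ k < L, specNorm (B k - A k) ≤ R) (i j : ℕ) (hi : 1 ≤ i) (hij : i ≤ j) (hj : j < L) :
    specNorm (seg B i j) ≤ K * (μ + K * R) ^ (j - i) := by
  induction j using Nat.strong_induction_on with
  | _ j ih =>
    rw [seg_eq_add_sum A B hij]
    refine (specNorm_add_le _ _).trans ((add_le_add (hA i j hi hij hj)
      (specNorm_sum_le _ _)).trans ?_)
    have h1 : ∑ k ∈ Finset.Ico i j, specNorm (seg A (k + 1) j * (B k - A k) * seg B i k) ≤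
        ∑ k ∈ Finset.Ico i j, (K * μ ^ (j - (k + 1))) * R * (K * (μ + K * R) ^ (k - i)) := by
      refine Finset.sum_le_sum fun k hk => ?_
      obtain ⟨h1, h2⟩ := Finset.mem_Ico.1 hk
      exact specNorm_mul_mul_le _ _ _ (hA _ _ (by omega) h2 hj) (hAB k (by omega))
        (ih k h2 h1 (by omega))
    refine (add_le_add le_rfl h1).trans (le_of_eq ?_)
    rw [Finset.sum_Ico_eq_sum_range]
    have h2 : ∀ l ∈ Finset.range (j - i),
        (K * μ ^ (j - (i + l + 1))) * R * (K * (μ + K * R) ^ (i + l - i)) =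
        (K * (K * R)) * ((μ + K * R) ^ l * μ ^ (j - i - 1 - l)) := fun l hl => by
      rw [show i + l - i = l by omega, show j - (i + l + 1) = j - i - 1 - l by omega]; ring
    rw [Finset.sum_congr rfl h2, ← Finset.mul_sum]
    have h3 := (Commute.all (μ + K * R) μ).geom_sum₂_mul (j - i)
    have h4 : (μ + K * R) ^ (j - i) = μ ^ (j - i) +
        (∑ l ∈ Finset.range (j - i), (μ + K * R) ^ l * μ ^ (j - i - 1 - l)) * (K * R) := by
      rw [add_sub_cancel_left] at h3; linarith
    rw [h4]; ring

/-- Every telescoping term loses one power of `μ` and gains a factor of order `K R`. With `L` terms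
the relative error is at most `2.1 L K R / μ ≤ 2.1 / 50`, below the `1 / 20` by which the isometry
constant is allowed to grow. Each telescoping form is chosen so that the end products are those of
`A` and only interior products of `B` occur. -/
theorem WellConditioned.perturb {d : ℕ → ℕ} {n L : ℕ} {μ K R : ℝ} (hμ : 0 < μ) (hK : 0 ≤ K)
    (hR : 0 ≤ R) {X : Matrix (Fin (d 0)) (Fin n) ℝ} {A B : Layers d}
    (hA : WellConditioned L μ (1 / 20) K X A) (hAB : ∀ k < L, specNorm (B k - A k) ≤ R)
    (hsmall : 50 * (L * (K * R)) ≤ μ) : WellConditioned L μ (1 / 10) (2 * K) X B := by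
  have hKR : 0 ≤ L * (K * R) := by positivity
  have hmid : ∀ i j, 1 ≤ i → i ≤ j → j < L → specNorm (seg B i j) ≤ 2 * K * μ ^ (j - i) := by
    intro i j hi hij hj
    refine (mid_perturb hA.mid hAB i j hi hij hj).trans ?_
    have := add_pow_le_two_mul_pow hμ (mul_nonneg hK hR) (show j - i ≤ L by omega) (by linarith)
    nlinarith
  have htop : ∀ i, 1 ≤ i → i ≤ L →
      specNorm (seg B i L - seg A i L) ≤ 1 / 20 * μ ^ (L - i) := by
    intro i hi hiL
    have h1 : specNorm (seg B i L - seg A i L) ≤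
        L * ((21 / 20 * R * (2 * K)) * (μ ^ (L - i) / μ)) := by
      rw [seg_eq_add_sum A B hiL, add_sub_cancel_left]
      refine (specNorm_sum_le _ _).trans (sum_Ico_le_of_le le_rfl (by positivity) fun k hk => ?_)
      obtain ⟨h1, h2⟩ := Finset.mem_Ico.1 hk
      refine (specNorm_mul_mul_le _ _ _ (hA.top_upper (k + 1) (by omega) h2) (hAB k h2)
        (hmid i k hi h1 h2)).trans (le_of_eq ?_)
      have : μ ^ (L - i) / μ = μ ^ (L - (k + 1)) * μ ^ (k - i) := by
        rw [← pow_add, div_eq_iff hμ.ne', ← pow_succ]; congr 1; omega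
      rw [this]; ring
    refine h1.trans ?_
    rw [mul_div_assoc', mul_div_assoc', div_le_iff₀ hμ]
    have := pow_pos hμ (L - i)
    nlinarith
  have hbot : ∀ j < L, ∀ q, ∀ Z : Matrix (Fin n) (Fin q) ℝ,
      frobNorm ((seg B 0 j - seg A 0 j) * (X * Z)) ≤ 1 / 20 * μ ^ j * frobNorm (X * Z) := by
    intro j hj q Z
    have h1 : frobNorm ((seg B 0 j - seg A 0 j) * (X * Z)) ≤
        L * ((2 * K * R * (21 / 20)) * (μ ^ j / μ) * frobNorm (X * Z)) := by
      rw [seg_sub_eq_sum A B (Nat.zero_le j), Matrix.sum_mul]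
      refine (frobNorm_sum_le _ _).trans (sum_Ico_le_of_le hj.le
        (mul_nonneg (by positivity) (frobNorm_nonneg _)) fun k hk => ?_)
      obtain ⟨-, h2⟩ := Finset.mem_Ico.1 hk
      rw [Matrix.mul_assoc]
      refine (frobNorm_mul_mul_le _ _ _ (hmid (k + 1) j (by omega) h2 hj) (hAB k (by omega))
        (hA.bot_upper k (by omega) q Z)).trans (le_of_eq ?_)
      have : μ ^ j / μ = μ ^ (j - (k + 1)) * μ ^ k := by
        rw [← pow_add, div_eq_iff hμ.ne', ← pow_succ]; congr 1; omega
      rw [this]; ring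
    refine h1.trans ?_
    have h3 : L * ((2 * K * R * (21 / 20)) * (μ ^ j / μ) * frobNorm (X * Z)) =
        (L * (K * R) * (21 / 10)) * (μ ^ j * frobNorm (X * Z)) / μ := by ring
    rw [h3, div_le_iff₀ hμ]
    have := mul_nonneg (pow_pos hμ j).le (frobNorm_nonneg (X * Z))
    nlinarith
  refine ⟨fun j hj q Z => ?_, fun j hj q Z => ?_, fun i hi hiL q Z => ?_, fun i hi hiL => ?_, hmid⟩
  · have h1 := hA.bot_lower j hj q Z
    have h2 := hbot j hj q Z
    have h3 := frobNorm_add_le (seg B 0 j * (X * Z)) (-((seg B 0 j - seg A 0 j) * (X * Z)))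
    rw [frobNorm_neg] at h3
    have h4 : seg B 0 j * (X * Z) + -((seg B 0 j - seg A 0 j) * (X * Z)) =
        seg A 0 j * (X * Z) := by rw [Matrix.sub_mul]; abel
    rw [h4] at h3
    linarith
  · have h1 := hA.bot_upper j hj q Z
    have h2 := hbot j hj q Z
    have h3 := frobNorm_add_le (seg A 0 j * (X * Z)) ((seg B 0 j - seg A 0 j) * (X * Z))
    have h4 : seg A 0 j * (X * Z) + ((seg B 0 j - seg A 0 j) * (X * Z)) =
        seg B 0 j * (X * Z) := by rw [Matrix.sub_mul]; abel
    rw [h4] at h3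
    linarith
  · have h1 := hA.top_lower i hi hiL q Z
    have h2 := htop i hi hiL
    have h3 := frobNorm_add_le ((seg B i L).transpose * Z)
      (-((seg B i L - seg A i L).transpose * Z))
    rw [frobNorm_neg] at h3
    have h4 : (seg B i L).transpose * Z + -((seg B i L - seg A i L).transpose * Z) =
        (seg A i L).transpose * Z := by rw [Matrix.transpose_sub, Matrix.sub_mul]; abel
    rw [h4] at h3
    have h5 := frobNorm_mul_le (seg B i L - seg A i L).transpose Z
    rw [specNorm_transpose] at h5
    have h6 := mul_le_mul_of_nonneg_right h2 (frobNorm_nonneg Z)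
    linarith
  · have h1 := hA.top_upper i hi hiL
    have h2 := htop i hi hiL
    have h3 := specNorm_add_le (seg A i L) (seg B i L - seg A i L)
    rw [add_sub_cancel] at h3
    linarith

theorem WellConditioned.specNorm_bot_le {d : ℕ → ℕ} {n L : ℕ} {μ α M : ℝ} (hμ : 0 < μ)
    (hα : 0 ≤ α) {X : Matrix (Fin (d 0)) (Fin n) ℝ} {B : Layers d}
    (hB : WellConditioned L μ α M X B) (j : ℕ) (hj : j < L) :
    specNorm (seg B 0 j * X) ≤ (1 + α) * μ ^ j * specNorm X := by
  refine specNorm_le_of_frobNorm _ _ (mul_nonneg (by positivity) (specNorm_nonneg X)) fun Z => ?_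
  rw [Matrix.mul_assoc, mul_assoc _ (specNorm X)]
  exact (hB.bot_upper j hj 1 Z).trans
    (mul_le_mul_of_nonneg_left (frobNorm_mul_le X Z) (by positivity))

/-! ### Gradient descent on well-conditioned layers -/

/-- The difference `c • B_{L-1} ⋯ B_0 X - Φ X` between the network output and its target on the
row space of the data. -/
def netResidual {d : ℕ → ℕ} {n : ℕ} (L : ℕ) (c : ℝ) (X : Matrix (Fin (d 0)) (Fin n) ℝ)
    (Φ : Matrix (Fin (d L)) (Fin (d 0)) ℝ) (B : Layers d) : Matrix (Fin (d L)) (Fin n) ℝ :=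
  c • (seg B 0 L * X) - Φ * X

/-- The gradient of half the squared residual with respect to layer `k`. -/
def layerGrad {d : ℕ → ℕ} {n : ℕ} (L : ℕ) (c : ℝ) (X : Matrix (Fin (d 0)) (Fin n) ℝ)
    (Φ : Matrix (Fin (d L)) (Fin (d 0)) ℝ) (B : Layers d) : Layers d := fun k =>
  c • ((seg B (k + 1) L).transpose * netResidual L c X Φ B * (seg B 0 k * X).transpose)

theorem netResidual_eq_mul {d : ℕ → ℕ} {n : ℕ} (L : ℕ) (c : ℝ) (X : Matrix (Fin (d 0)) (Fin n) ℝ)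
    (Φ : Matrix (Fin (d L)) (Fin (d 0)) ℝ) (B : Layers d) :
    netResidual L c X Φ B = (c • seg B 0 L - Φ) * X := by
  rw [netResidual, Matrix.sub_mul, Matrix.smul_mul]

theorem frobNorm_mul_transpose_comm {p q s : ℕ} (A : Matrix (Fin p) (Fin q) ℝ)
    (B : Matrix (Fin s) (Fin q) ℝ) : frobNorm (A * B.transpose) = frobNorm (B * A.transpose) := by
  rw [← frobNorm_transpose, Matrix.transpose_mul, Matrix.transpose_transpose]

theorem pow_split {μ : ℝ} {k L : ℕ} (hk : k < L) :
    μ ^ (L - (k + 1)) * μ ^ k = μ ^ (L - 1) := by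
  rw [← pow_add]; congr 1; omega

theorem frobNorm_layerGrad_le {d : ℕ → ℕ} {n L : ℕ} {μ M c γ : ℝ} (hμ : 0 < μ) (hc : 0 ≤ c)
    (hγ : c * μ ^ (L - 1) = γ) {X : Matrix (Fin (d 0)) (Fin n) ℝ}
    (Φ : Matrix (Fin (d L)) (Fin (d 0)) ℝ) {B : Layers d}
    (hB : WellConditioned L μ (1 / 10) M X B) (k : ℕ) (hk : k < L) :
    frobNorm (layerGrad L c X Φ B k) ≤
      121 / 100 * γ * specNorm X * frobNorm (netResidual L c X Φ B) := by
  set E := netResidual L c X Φ B with hE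
  have h1 : frobNorm (E * (seg B 0 k * X).transpose) ≤
      (1 + 1 / 10) * μ ^ k * (specNorm X * frobNorm E) := by
    rw [frobNorm_mul_transpose_comm, Matrix.mul_assoc]
    refine (hB.bot_upper k hk _ _).trans (mul_le_mul_of_nonneg_left ?_ (by positivity))
    exact (frobNorm_mul_le _ _).trans_eq (by rw [frobNorm_transpose])
  have h2 : frobNorm ((seg B (k + 1) L).transpose * (E * (seg B 0 k * X).transpose)) ≤
      (1 + 1 / 10) * μ ^ (L - (k + 1)) * ((1 + 1 / 10) * μ ^ k * (specNorm X * frobNorm E)) := by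
    refine (frobNorm_mul_le _ _).trans ?_
    rw [specNorm_transpose]
    exact mul_le_mul (hB.top_upper _ (by omega) hk) h1 (frobNorm_nonneg _) (by positivity)
  rw [layerGrad, frobNorm_smul, abs_of_nonneg hc, Matrix.mul_assoc]
  refine (mul_le_mul_of_nonneg_left h2 hc).trans (le_of_eq ?_)
  rw [← hγ, ← pow_split hk]; ring

/-- The residual is `V X` for some `V`, so multiplying its transpose by `X` loses at most a factor
`ρ`. The result has columns in the column space of `X`, where the lower product is nearly isometric;
the upper product is handled by `top_lower`. -/
theorem le_frobNorm_layerGrad {d : ℕ → ℕ} {n L : ℕ} {μ M c γ ρ : ℝ} (hμ : 0 < μ) (hc : 0 ≤ c)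
    (hγ : c * μ ^ (L - 1) = γ) {X : Matrix (Fin (d 0)) (Fin n) ℝ}
    (hρ : ∀ V : Matrix (Fin (d L)) (Fin (d 0)) ℝ,
      ρ * frobNorm (V * X) ≤ frobNorm (X * (V * X).transpose))
    (Φ : Matrix (Fin (d L)) (Fin (d 0)) ℝ) {B : Layers d}
    (hB : WellConditioned L μ (1 / 10) M X B) (k : ℕ) (hk : k < L) :
    81 / 100 * γ * ρ * frobNorm (netResidual L c X Φ B) ≤ frobNorm (layerGrad L c X Φ B k) := by
  set E := netResidual L c X Φ B with hE
  have h1 : (1 - 1 / 10) * μ ^ k * (ρ * frobNorm E) ≤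
      frobNorm (E * (seg B 0 k * X).transpose) := by
    rw [frobNorm_mul_transpose_comm, Matrix.mul_assoc]
    refine le_trans (mul_le_mul_of_nonneg_left ?_ (by positivity)) (hB.bot_lower k hk _ _)
    rw [hE, netResidual_eq_mul]; exact hρ _
  have h2 : (1 - 1 / 10) * μ ^ (L - (k + 1)) * ((1 - 1 / 10) * μ ^ k * (ρ * frobNorm E)) ≤
      frobNorm ((seg B (k + 1) L).transpose * (E * (seg B 0 k * X).transpose)) :=
    (mul_le_mul_of_nonneg_left h1 (by positivity)).trans (hB.top_lower _ (by omega) hk _ _)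
  rw [layerGrad, frobNorm_smul, abs_of_nonneg hc, Matrix.mul_assoc]
  refine le_trans (le_of_eq ?_) (mul_le_mul_of_nonneg_left h2 hc)
  rw [← hγ, ← pow_split hk]; ring

/-- The first-order change of the residual in a gradient step, divided by the step size. -/
def firstOrder {d : ℕ → ℕ} {n : ℕ} (L : ℕ) (c : ℝ) (X : Matrix (Fin (d 0)) (Fin n) ℝ)
    (Φ : Matrix (Fin (d L)) (Fin (d 0)) ℝ) (B : Layers d) : Matrix (Fin (d L)) (Fin n) ℝ :=
  c • ∑ k ∈ Finset.Ico 0 L, seg B (k + 1) L * layerGrad L c X Φ B k * (seg B 0 k * X)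

/-- The first-order change is `J Jᵀ E` for the derivative `J` of the output in the weights, so
pairing it with `E` gives `‖Jᵀ E‖²`. -/
theorem frobInner_firstOrder {d : ℕ → ℕ} {n : ℕ} (L : ℕ) (c : ℝ)
    (X : Matrix (Fin (d 0)) (Fin n) ℝ) (Φ : Matrix (Fin (d L)) (Fin (d 0)) ℝ) (B : Layers d) :
    frobInner (netResidual L c X Φ B) (firstOrder L c X Φ B) =
      ∑ k ∈ Finset.Ico 0 L, frobNorm (layerGrad L c X Φ B k) ^ 2 := by
  rw [firstOrder, frobInner_smul_right, frobInner_sum_right, Finset.mul_sum]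
  refine Finset.sum_congr rfl fun k _ => ?_
  rw [frobInner_mul_right, frobInner_mul_left, ← frobInner_smul_right, frobNorm_sq_eq_inner]
  nth_rewrite 3 [layerGrad]
  rw [frobInner_smul_right, frobInner_comm, ← Matrix.mul_assoc, frobInner_smul_right]

/-- The triangle inequality followed by Cauchy–Schwarz over the `L` layers. Bounding by the same sum
of squares as in `frobInner_firstOrder` allows the quadratic term to be absorbed into the descent
term without losing a condition number. -/
theorem frobNorm_firstOrder_sq_le {d : ℕ → ℕ} {n L : ℕ} {μ M c γ : ℝ} (hμ : 0 < μ) (hc : 0 ≤ c)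
    (hγ : c * μ ^ (L - 1) = γ) {X : Matrix (Fin (d 0)) (Fin n) ℝ}
    (Φ : Matrix (Fin (d L)) (Fin (d 0)) ℝ) {B : Layers d}
    (hB : WellConditioned L μ (1 / 10) M X B) :
    frobNorm (firstOrder L c X Φ B) ^ 2 ≤ (121 / 100 * γ * specNorm X) ^ 2 *
      (L * ∑ k ∈ Finset.Ico 0 L, frobNorm (layerGrad L c X Φ B k) ^ 2) := by
  have h1 : frobNorm (firstOrder L c X Φ B) ≤ 121 / 100 * γ * specNorm X *
      ∑ k ∈ Finset.Ico 0 L, frobNorm (layerGrad L c X Φ B k) := by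
    rw [firstOrder, frobNorm_smul, abs_of_nonneg hc]
    refine (mul_le_mul_of_nonneg_left (frobNorm_sum_le _ _) hc).trans ?_
    rw [Finset.mul_sum, Finset.mul_sum]
    refine Finset.sum_le_sum fun k hk => ?_
    have hk := (Finset.mem_Ico.1 hk).2
    refine (mul_le_mul_of_nonneg_left (frobNorm_mul_mul_le' _ _ _
      (hB.top_upper (k + 1) (by omega) hk) le_rfl
      (hB.specNorm_bot_le hμ (by norm_num) k hk)) hc).trans (le_of_eq ?_)
    rw [← hγ, ← pow_split hk]; ring
  refine (pow_le_pow_left₀ (frobNorm_nonneg _) h1 2).trans ?_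
  rw [mul_pow]
  refine mul_le_mul_of_nonneg_left ?_ (sq_nonneg _)
  simpa using sq_sum_le_card_mul_sum_sq (s := Finset.Ico 0 L)
    (f := fun k => frobNorm (layerGrad L c X Φ B k))

/-- In the telescoping sum the new weights occur only above the changed layer. Replacing them there
by the old ones gives the first-order term, and the difference is the whole remainder: no expansion
in powers of `η` is needed. -/
theorem residual_step {d : ℕ → ℕ} {n : ℕ} (L : ℕ) (c η : ℝ) (X : Matrix (Fin (d 0)) (Fin n) ℝ)
    (Φ : Matrix (Fin (d L)) (Fin (d 0)) ℝ) (B B' : Layers d)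
    (hB' : ∀ k < L, B' k = B k - η • layerGrad L c X Φ B k) :
    netResidual L c X Φ B' = netResidual L c X Φ B - η • firstOrder L c X Φ B +
      (-(η * c)) • ∑ k ∈ Finset.Ico 0 L, (seg B' (k + 1) L - seg B (k + 1) L) *
        layerGrad L c X Φ B k * (seg B 0 k * X) := by
  have h1 : seg B' 0 L = seg B 0 L - η • ∑ k ∈ Finset.Ico 0 L,
      seg B' (k + 1) L * layerGrad L c X Φ B k * seg B 0 k := by
    rw [eq_sub_iff_add_eq, ← eq_sub_iff_add_eq', ← neg_inj, neg_sub,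
      seg_sub_eq_sum B B' (Nat.zero_le L), Finset.smul_sum, ← Finset.sum_neg_distrib]
    refine Finset.sum_congr rfl fun k hk => ?_
    rw [hB' k (Finset.mem_Ico.1 hk).2, sub_sub_cancel_left, Matrix.mul_neg, Matrix.neg_mul,
      Matrix.mul_smul, Matrix.smul_mul]
  have h2 : ∑ k ∈ Finset.Ico 0 L, (seg B' (k + 1) L - seg B (k + 1) L) *
        layerGrad L c X Φ B k * (seg B 0 k * X) =
      (∑ k ∈ Finset.Ico 0 L, seg B' (k + 1) L * layerGrad L c X Φ B k * seg B 0 k) * X -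
      ∑ k ∈ Finset.Ico 0 L, seg B (k + 1) L * layerGrad L c X Φ B k * (seg B 0 k * X) := by
    rw [Matrix.sum_mul, ← Finset.sum_sub_distrib]
    refine Finset.sum_congr rfl fun k _ => ?_
    simp only [Matrix.sub_mul, Matrix.mul_assoc]
  rw [h2, netResidual, netResidual, firstOrder, h1, Matrix.sub_mul, Matrix.smul_mul]
  module

/-- The upper products change by `O(η g)` per layer, which gives two sums over layers and a factor
`(η L)²`. A second telescoping costs one power of `μ`, hence the `μ` on the left. -/
theorem WellConditioned.secondOrder_le {d : ℕ → ℕ} {n L : ℕ} {μ M c γ η g : ℝ} (hμ : 0 < μ)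
    (hM : 0 ≤ M) (hc : 0 ≤ c) (hη : 0 ≤ η) (hγ : c * μ ^ (L - 1) = γ)
    {X : Matrix (Fin (d 0)) (Fin n) ℝ} {B B' G : Layers d}
    (hB : WellConditioned L μ (1 / 10) M X B) (hB' : WellConditioned L μ (1 / 10) M X B')
    (hstep : ∀ k < L, B' k = B k - η • G k) (hg0 : 0 ≤ g) (hg : ∀ k < L, frobNorm (G k) ≤ g) :
    μ * frobNorm ((-(η * c)) • ∑ k ∈ Finset.Ico 0 L, (seg B' (k + 1) L - seg B (k + 1) L) *
      G k * (seg B 0 k * X)) ≤ 121 / 100 * (η * L) ^ 2 * M * g ^ 2 * γ * specNorm X := by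
  have hs := specNorm_nonneg X
  have h1 : ∀ i, 1 ≤ i → i ≤ L → specNorm (seg B' i L - seg B i L) ≤
      L * (11 / 10 * M * (η * g) * (μ ^ (L - i) / μ)) := by
    intro i hi hiL
    rw [seg_sub_eq_sum B B' hiL]
    refine (specNorm_sum_le _ _).trans (sum_Ico_le_of_le le_rfl (by positivity) fun l hl => ?_)
    obtain ⟨h1, h2⟩ := Finset.mem_Ico.1 hl
    have h3 : specNorm (B' l - B l) ≤ η * g := by
      rw [hstep l h2, sub_sub_cancel_left, specNorm_neg, specNorm_smul, abs_of_nonneg hη]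
      exact mul_le_mul_of_nonneg_left ((specNorm_le_frobNorm _).trans (hg l h2)) hη
    refine (specNorm_mul_mul_le _ _ _ (hB'.top_upper (l + 1) (by omega) h2) h3
      (hB.mid i l hi h1 h2)).trans (le_of_eq ?_)
    have : μ ^ (L - i) / μ = μ ^ (L - (l + 1)) * μ ^ (l - i) := by
      rw [← pow_add, div_eq_iff hμ.ne', ← pow_succ]; congr 1; omega
    rw [this]; ring
  have h2 : frobNorm (∑ k ∈ Finset.Ico 0 L, (seg B' (k + 1) L - seg B (k + 1) L) *
      G k * (seg B 0 k * X)) ≤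
      L * (L * (11 / 10 * M * (η * g)) * g * (11 / 10 * specNorm X) * (μ ^ (L - 1) / μ)) := by
    refine (frobNorm_sum_le _ _).trans (sum_Ico_le_of_le le_rfl (by positivity) fun k hk => ?_)
    have hk := (Finset.mem_Ico.1 hk).2
    refine (frobNorm_mul_mul_le' _ _ _ (h1 (k + 1) (by omega) hk) (hg k hk)
      (hB.specNorm_bot_le hμ (by norm_num) k hk)).trans (le_of_eq ?_)
    rw [← pow_split hk]; ring
  rw [frobNorm_smul, abs_neg, abs_of_nonneg (mul_nonneg hη hc)]
  refine (mul_le_mul_of_nonneg_left (mul_le_mul_of_nonneg_left h2 (mul_nonneg hη hc)) hμ.le).trans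
    (le_of_eq ?_)
  rw [← hγ]; field_simp; ring

/-- One step of gradient descent between well-conditioned weights contracts the residual. -/
theorem WellConditioned.residual_contract {d : ℕ → ℕ} {n L : ℕ} {μ M c γ η ρ : ℝ} (hμ : 0 < μ)
    (hM : 0 ≤ M) (hc : 0 ≤ c) (hη : 0 ≤ η) (hγ : c * μ ^ (L - 1) = γ) (hγ0 : 0 ≤ γ)
    (hρ0 : 0 ≤ ρ)
    {X : Matrix (Fin (d 0)) (Fin n) ℝ} (hρX : ρ ≤ specNorm X)
    (hρ : ∀ V : Matrix (Fin (d L)) (Fin (d 0)) ℝ,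
      ρ * frobNorm (V * X) ≤ frobNorm (X * (V * X).transpose))
    (Φ : Matrix (Fin (d L)) (Fin (d 0)) ℝ) {B B' : Layers d}
    (hB : WellConditioned L μ (1 / 10) M X B) (hB' : WellConditioned L μ (1 / 10) M X B')
    (hstep : ∀ k < L, B' k = B k - η • layerGrad L c X Φ B k)
    (hηL : 3 * (η * L * γ ^ 2 * specNorm X ^ 2) ≤ 1)
    (hbig : 3 * (M * specNorm X * frobNorm (netResidual L c X Φ B)) ≤ ρ ^ 2 * γ * μ) :
    frobNorm (netResidual L c X Φ B') ^ 2 ≤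
      (1 - η * L * γ ^ 2 * ρ ^ 2 / 4) * frobNorm (netResidual L c X Φ B) ^ 2 := by
  have hs := specNorm_nonneg X
  have he := frobNorm_nonneg (netResidual L c X Φ B)
  set s := specNorm X with hs_def
  set e := frobNorm (netResidual L c X Φ B) with he_def
  set y := η * L * γ ^ 2 * ρ ^ 2 with hy
  have hy0 : 0 ≤ y := by positivity
  have hy3 : y ≤ 1 / 3 := by
    have : y ≤ η * L * γ ^ 2 * s ^ 2 := by
      rw [hy]; gcongr
    linarith
  set Q := ∑ k ∈ Finset.Ico 0 L, frobNorm (layerGrad L c X Φ B k) ^ 2 with hQ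
  have hQ0 : 0 ≤ Q := Finset.sum_nonneg fun _ _ => sq_nonneg _
  have hQlow : L * (81 / 100 * γ * ρ * e) ^ 2 ≤ Q := by
    have := Finset.card_nsmul_le_sum (Finset.Ico 0 L)
      (fun k => frobNorm (layerGrad L c X Φ B k) ^ 2) ((81 / 100 * γ * ρ * e) ^ 2) fun k hk =>
        pow_le_pow_left₀ (by positivity)
          (le_frobNorm_layerGrad hμ hc hγ hρ Φ hB k (Finset.mem_Ico.1 hk).2) 2
    simpa [hQ] using this
  have hF := frobNorm_firstOrder_sq_le hμ hc hγ Φ hB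
  rw [← hQ, ← hs_def] at hF
  set H := (-(η * c)) • ∑ k ∈ Finset.Ico 0 L, (seg B' (k + 1) L - seg B (k + 1) L) *
        layerGrad L c X Φ B k * (seg B 0 k * X) with hH
  -- The smallness of the residual turns the second-order bound into `1.21³ / 9 < 1 / 5` times `y
  -- e`.
  have hHle : frobNorm H ≤ 1 / 5 * y * e := by
    have h1 := hB.secondOrder_le hμ hM hc hη hγ hB' hstep (g := 121 / 100 * γ * s * e)
      (by positivity) (frobNorm_layerGrad_le hμ hc hγ Φ hB)
    rw [← hH, ← hs_def] at h1
    have h2 : 121 / 100 * (η * L) ^ 2 * M * (121 / 100 * γ * s * e) ^ 2 * γ * s =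
        (121 / 100) ^ 3 * (η * L * γ ^ 2 * s ^ 2) * (η * L * γ * e) * (M * s * e) := by ring
    have h3 : (121 / 100) ^ 3 * (η * L * γ ^ 2 * s ^ 2) * (η * L * γ * e) * (M * s * e) ≤
        (121 / 100) ^ 3 * (1 / 3) * (η * L * γ * e) * (ρ ^ 2 * γ * μ / 3) := by
      have : M * s * e ≤ ρ ^ 2 * γ * μ / 3 := by linarith
      have h4 : η * L * γ ^ 2 * s ^ 2 ≤ 1 / 3 := by linarith
      gcongr
    have h5 : (121 / 100) ^ 3 * (1 / 3) * (η * L * γ * e) * (ρ ^ 2 * γ * μ / 3) ≤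
        μ * (1 / 5 * y * e) := by
      have : (121 / 100) ^ 3 * (1 / 3) * (η * L * γ * e) * (ρ ^ 2 * γ * μ / 3) =
        (121 / 100) ^ 3 / 9 * (μ * (y * e)) := by rw [hy]; ring
      rw [this]
      have : 0 ≤ μ * (y * e) := by positivity
      nlinarith
    exact le_of_mul_le_mul_left (h1.trans (h2.trans_le (h3.trans h5))) hμ
  -- The quadratic term is at most `1.21² / 3 ≤ 0.49` times `η Q`, leaving a decrease of `1.51 η Q`.
  -- Since `η Q ≥ 0.81² y e²` and `1.51 · 0.81² > 0.99`, the square is at most `(1 - 0.99 y) e² ≤ (1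
  -- - 99 / 200 y)² e²`.
  have hfirst : frobNorm (netResidual L c X Φ B - η • firstOrder L c X Φ B) ≤
      (1 - 99 / 200 * y) * e := by
    refine le_of_sq_le_sq ?_ (mul_nonneg (by linarith) he)
    rw [frobNorm_sub_sq, frobInner_smul_right, frobInner_firstOrder, ← hQ, frobNorm_smul,
      abs_of_nonneg hη, mul_pow, ← he_def]
    have h1 : η ^ 2 * frobNorm (firstOrder L c X Φ B) ^ 2 ≤ 49 / 100 * (η * Q) := by
      have h2 : η ^ 2 * frobNorm (firstOrder L c X Φ B) ^ 2 ≤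
          η ^ 2 * ((121 / 100 * γ * s) ^ 2 * (L * Q)) := by gcongr
      have h3 : η ^ 2 * ((121 / 100 * γ * s) ^ 2 * (L * Q)) =
          (121 / 100) ^ 2 * (η * L * γ ^ 2 * s ^ 2) * (η * Q) := by ring
      have h4 : 0 ≤ η * Q := by positivity
      nlinarith
    have h5 : η * (L * (81 / 100 * γ * ρ * e) ^ 2) ≤ η * Q := by gcongr
    have h6 : η * (L * (81 / 100 * γ * ρ * e) ^ 2) = (81 / 100) ^ 2 * y * e ^ 2 := by
      rw [hy]; ring
    have h7 : 0 ≤ y * e ^ 2 := by positivity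
    have h8 : 0 ≤ y ^ 2 * e ^ 2 := by positivity
    nlinarith
  have hfinal : frobNorm (netResidual L c X Φ B') ≤ (1 - 59 / 200 * y) * e := by
    rw [residual_step L c η X Φ B B' hstep, ← hH]
    refine (frobNorm_add_le _ _).trans ?_
    linarith
  refine (pow_le_pow_left₀ (frobNorm_nonneg _) hfinal 2).trans ?_
  rw [mul_pow]
  refine mul_le_mul_of_nonneg_right ?_ (sq_nonneg _)
  nlinarith

/-- Linear convergence of gradient descent from a well-conditioned initialization with a residual
that is small compared to the width. -/
theorem residual_convergence {d : ℕ → ℕ} {n L : ℕ} {μ K c γ η ρ : ℝ} (hμ : 0 < μ)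
    (hL : 1 ≤ L)
    (hK : 0 ≤ K) (hc : 0 ≤ c) (hη : 0 < η) (hγ : c * μ ^ (L - 1) = γ) (hγ0 : 0 < γ)
    (hρ0 : 0 < ρ)
    {X : Matrix (Fin (d 0)) (Fin n) ℝ} (hρX : ρ ≤ specNorm X)
    (hρ : ∀ V : Matrix (Fin (d L)) (Fin (d 0)) ℝ,
      ρ * frobNorm (V * X) ≤ frobNorm (X * (V * X).transpose))
    (Φ : Matrix (Fin (d L)) (Fin (d 0)) ℝ) {W : ℕ → Layers d}
    (hW0 : WellConditioned L μ (1 / 20) K X (W 0))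
    (hstep : ∀ t, ∀ k < L, W (t + 1) k = W t k - η • layerGrad L c X Φ (W t) k)
    (hηL : 3 * (η * L * γ ^ 2 * specNorm X ^ 2) ≤ 1)
    (hbig : 500 * (K * specNorm X * frobNorm (netResidual L c X Φ (W 0))) ≤ ρ ^ 2 * γ * μ) (t : ℕ) :
    frobNorm (netResidual L c X Φ (W t)) ^ 2 ≤
      (1 - η * L * γ ^ 2 * ρ ^ 2 / 4) ^ t * frobNorm (netResidual L c X Φ (W 0)) ^ 2 := by
  have hs := specNorm_nonneg X
  have he := frobNorm_nonneg (netResidual L c X Φ (W 0))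
  have hL0 : (0 : ℝ) < L := by exact_mod_cast hL
  set s := specNorm X with hs_def
  set e := frobNorm (netResidual L c X Φ (W 0)) with he_def
  set y := η * L * γ ^ 2 * ρ ^ 2 with hy
  have hy0 : 0 < y := by positivity
  have hy3 : y ≤ 1 / 3 := by
    have : y ≤ η * L * γ ^ 2 * s ^ 2 := by rw [hy]; gcongr
    linarith
  have hsum : ∀ t : ℕ, ∑ u ∈ Finset.range t, (1 - y / 8) ^ u ≤ 8 / y := by
    intro t
    have h := geom_sum_mul (1 - y / 8) t
    rw [le_div_iff₀ hy0]
    have : 0 ≤ (1 - y / 8) ^ t := pow_nonneg (by linarith) t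
    nlinarith
  -- The total distance travelled is at most `η · 1.21 γ s · e · 8 / y = 9.68 s e / (L ρ² γ)`, which
  -- `R` rounds up. The factor `500` in the smallness hypothesis is this `10` times the `50` of
  -- `WellConditioned.perturb`.
  set R := 10 * s * e / (L * ρ ^ 2 * γ) with hR
  have hR0 : 0 ≤ R := by positivity
  have hRsmall : 50 * (L * (K * R)) ≤ μ := by
    have : 50 * (L * (K * R)) = 500 * (K * s * e) / (ρ ^ 2 * γ) := by rw [hR]; field_simp; ring
    rw [this, div_le_iff₀ (by positivity)]; linarith
  have hdist : ∀ t : ℕ, η * (121 / 100 * γ * s) * (e * ∑ u ∈ Finset.range t, (1 - y / 8) ^ u) ≤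
      R := by
    intro t
    calc η * (121 / 100 * γ * s) * (e * ∑ u ∈ Finset.range t, (1 - y / 8) ^ u) ≤
        η * (121 / 100 * γ * s) * (e * (8 / y)) := by gcongr; exact hsum t
      _ = 968 / 1000 * R := by rw [hR, hy]; field_simp; ring
      _ ≤ R := by linarith
  have key : ∀ t : ℕ, (∀ k < L, specNorm (W t k - W 0 k) ≤
        η * (121 / 100 * γ * s) * (e * ∑ u ∈ Finset.range t, (1 - y / 8) ^ u)) ∧
      frobNorm (netResidual L c X Φ (W t)) ≤ (1 - y / 8) ^ t * e ∧
      frobNorm (netResidual L c X Φ (W t)) ^ 2 ≤ (1 - y / 4) ^ t * e ^ 2 := by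
    intro t
    induction t with
    | zero => exact ⟨fun k _ => by simp [specNorm_zero], by simp [he_def], by simp [he_def]⟩
    | succ t ih =>
      obtain ⟨h1, h2, h3⟩ := ih
      -- The contraction needs good conditioning at both ends of the step. The position of the next
      -- iterate is therefore bounded first, using only the gradient at the current one.
      have hBt := hW0.perturb hμ hK hR0 (fun k hk => (h1 k hk).trans (hdist t)) hRsmall
      have hnext : ∀ k < L, specNorm (W (t + 1) k - W 0 k) ≤
          η * (121 / 100 * γ * s) * (e * ∑ u ∈ Finset.range (t + 1), (1 - y / 8) ^ u) := by
        intro k hk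
        have h4 : W (t + 1) k - W 0 k = (W t k - W 0 k) + -(η • layerGrad L c X Φ (W t) k) := by
          rw [hstep t k hk]; abel
        rw [h4]
        refine (specNorm_add_le _ _).trans ?_
        rw [specNorm_neg, specNorm_smul, abs_of_pos hη, Finset.sum_range_succ]
        have h5 := (specNorm_le_frobNorm _).trans (frobNorm_layerGrad_le hμ hc hγ Φ hBt k hk)
        have h6 : η * specNorm (layerGrad L c X Φ (W t) k) ≤
            η * (121 / 100 * γ * s * ((1 - y / 8) ^ t * e)) := by
          refine mul_le_mul_of_nonneg_left (h5.trans ?_) hη.le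
          exact mul_le_mul_of_nonneg_left h2 (by positivity)
        have h7 := h1 k hk
        linarith
      have hBt' := hW0.perturb hμ hK hR0 (fun k hk => (hnext k hk).trans (hdist (t + 1))) hRsmall
      have hle : frobNorm (netResidual L c X Φ (W t)) ≤ e := h2.trans
        (mul_le_of_le_one_left he (pow_le_one₀ (by linarith) (by linarith)))
      have hcon := hBt.residual_contract hμ (by positivity) hc hη.le hγ hγ0.le hρ0.le hρX hρ Φ
        hBt' (hstep t) hηL (by
          have : K * s * frobNorm (netResidual L c X Φ (W t)) ≤ K * s * e := by gcongr
          have h0 : 0 ≤ K * s * e := by positivity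
          rw [← hs_def]; linarith)
      rw [← hy] at hcon
      refine ⟨hnext, ?_, ?_⟩
      -- From `1 - y / 4 ≤ (1 - y / 8)²`: the norm itself decays geometrically, which makes the
      -- distances summable.
      · have h8 : frobNorm (netResidual L c X Φ (W (t + 1))) ≤
            (1 - y / 8) * frobNorm (netResidual L c X Φ (W t)) := by
          refine le_of_sq_le_sq (hcon.trans ?_) (mul_nonneg (by linarith) (frobNorm_nonneg _))
          rw [mul_pow]
          refine mul_le_mul_of_nonneg_right ?_ (sq_nonneg _)
          nlinarith
        refine h8.trans ((mul_le_mul_of_nonneg_left h2 (by linarith)).trans (le_of_eq ?_))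
        rw [pow_succ]; ring
      · refine hcon.trans ((mul_le_mul_of_nonneg_left h3 (by linarith)).trans (le_of_eq ?_))
        rw [pow_succ]; ring
  exact (key t).2.2

/-! ### The training loss and its gradient in terms of layer products -/

/-- The weights of a network, continued by zero to a sequence of layers. -/
def toLayers {L : ℕ} {d : ℕ → ℕ} (W : Weights L d) : Layers d := fun k =>
  if h : k < L then Matrix.of (W ⟨k, h⟩) else 0

theorem toLayers_of_lt {L : ℕ} {d : ℕ → ℕ} (W : Weights L d) {k : ℕ} (h : k < L) :
    toLayers W k = Matrix.of (W ⟨k, h⟩) := dif_pos h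

theorem layerProd_eq_seg {L : ℕ} {d : ℕ → ℕ} (W : Weights L d) (k : ℕ) (h : k ≤ L) :
    layerProd W k h = seg (toLayers W) 0 k := by
  induction k with
  | zero => rw [seg_self]; rfl
  | succ k ih =>
    rw [layerProd, seg_succ _ (Nat.zero_le k), ih, toLayers_of_lt W h]

/-- The normalization `(m^(L-1) d_out)^(-1/2)` of the network output. -/
noncomputable def outScale (L m : ℕ) (d : ℕ → ℕ) : ℝ := 1 / Real.sqrt ((m : ℝ) ^ (L - 1) * (d L : ℝ))

theorem netLoss_eq {L : ℕ} {d : ℕ → ℕ} {n : ℕ} (m : ℕ) (X : Matrix (Fin (d 0)) (Fin n) ℝ)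
    (Y : Matrix (Fin (d L)) (Fin n) ℝ) (W : Weights L d) :
    netLoss m X Y W =
      1 / 2 * frobNorm (outScale L m d • (seg (toLayers W) 0 L * X) - Y) ^ 2 := by
  rw [netLoss, layerProd_eq_seg, outScale]

theorem eq_zero_of_quadratic_nonneg {a b : ℝ} (h : ∀ s : ℝ, 0 ≤ 2 * s * a + s ^ 2 * b)
    (hb : 0 ≤ b) : a = 0 := by
  -- This is nearly the minimizer `-a / b`; the shift by one covers `b = 0`.
  have h1 := h (-a / (b + 1))
  have h2 : 2 * (-a / (b + 1)) * a + (-a / (b + 1)) ^ 2 * b =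
      -(a ^ 2 * (b + 2)) / (b + 1) ^ 2 := by field_simp; ring
  rw [h2, le_div_iff₀ (by positivity)] at h1
  have h3 : a ^ 2 = 0 := by nlinarith [sq_nonneg a, mul_nonneg (sq_nonneg a) hb]
  exact pow_eq_zero_iff (two_ne_zero) |>.1 h3

/-- The normal equations of linear regression. -/
theorem normal_equations {din dout n : ℕ} (X : Matrix (Fin din) (Fin n) ℝ)
    (Y : Matrix (Fin dout) (Fin n) ℝ) (Φ : Matrix (Fin dout) (Fin din) ℝ)
    (hΦ : ∀ W, regLoss X Y Φ ≤ regLoss X Y W) : (Φ * X - Y) * X.transpose = 0 := by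
  set N := Φ * X - Y with hN
  have h : ∀ D : Matrix (Fin dout) (Fin din) ℝ, frobInner (N * X.transpose) D = 0 := by
    intro D
    rw [← frobInner_mul_right]
    refine eq_zero_of_quadratic_nonneg (b := frobNorm (D * X) ^ 2) (fun s => ?_) (sq_nonneg _)
    have h1 := hΦ (Φ + s • D)
    have h2 : (Φ + s • D) * X - Y = N + s • (D * X) := by
      rw [Matrix.add_mul, Matrix.smul_mul, hN]; abel
    rw [regLoss, regLoss, h2, ← hN, frobNorm_add_sq, frobInner_smul_right, frobNorm_smul,
      mul_pow, sq_abs] at h1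
    linarith
  -- The gradient is orthogonal to every direction, in particular to itself.
  have h0 := h (N * X.transpose)
  rw [← frobNorm_sq_eq_inner, sq_eq_zero_iff, frobNorm_eq_norm, norm_eq_zero] at h0
  ext i j
  simpa [frobVec_apply] using congrArg (fun v : EuclideanSpace ℝ _ => v (i, j)) h0

theorem optLoss_eq {din dout n : ℕ} (X : Matrix (Fin din) (Fin n) ℝ)
    (Y : Matrix (Fin dout) (Fin n) ℝ) (Φ : Matrix (Fin dout) (Fin din) ℝ)
    (hΦ : ∀ W, regLoss X Y Φ ≤ regLoss X Y W) : optLoss X Y = regLoss X Y Φ :=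
  le_antisymm (ciInf_le ⟨regLoss X Y Φ, by rintro _ ⟨W, rfl⟩; exact hΦ W⟩ Φ) (le_ciInf hΦ)

theorem netLoss_sub_optLoss {L : ℕ} {d : ℕ → ℕ} {n : ℕ} (m : ℕ)
    (X : Matrix (Fin (d 0)) (Fin n) ℝ) (Y : Matrix (Fin (d L)) (Fin n) ℝ)
    (Φ : Matrix (Fin (d L)) (Fin (d 0)) ℝ) (hΦ : ∀ W, regLoss X Y Φ ≤ regLoss X Y W)
    (W : Weights L d) :
    netLoss m X Y W - optLoss X Y =
      1 / 2 * frobNorm (netResidual L (outScale L m d) X Φ (toLayers W)) ^ 2 := by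
  have h1 : outScale L m d • (seg (toLayers W) 0 L * X) - Y = (Φ * X - Y) +
      netResidual L (outScale L m d) X Φ (toLayers W) := by rw [netResidual]; abel
  rw [netLoss_eq, optLoss_eq X Y Φ hΦ, regLoss, h1, frobNorm_add_sq]
  have h2 : frobInner (Φ * X - Y) (netResidual L (outScale L m d) X Φ (toLayers W)) = 0 := by
    rw [netResidual_eq_mul, frobInner_mul_right, normal_equations X Y Φ hΦ]
    simp [frobInner]
  rw [h2]; ring

theorem frobInner_single {p q : ℕ} (A : Matrix (Fin p) (Fin q) ℝ) (a : Fin p) (b : Fin q) :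
    frobInner A (Matrix.single a b 1) = A a b := by
  rw [frobInner, Finset.sum_eq_single a, Finset.sum_eq_single b]
  · simp
  · intro j _ hj; simp [hj.symm]
  · simp
  · intro i _ hi; simp [hi.symm]
  · simp

theorem toLayers_setEntry_self {L : ℕ} {d : ℕ → ℕ} (W : Weights L d) (i : Fin L)
    (a : Fin (d (i + 1))) (b : Fin (d i)) (s : ℝ) :
    toLayers (setEntry W i a b s) i - toLayers W i =
      (s - W i a b) • Matrix.single a b (1 : ℝ) := by
  rw [toLayers_of_lt _ i.2, toLayers_of_lt _ i.2]
  ext a' b'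
  simp only [Matrix.sub_apply, Matrix.of_apply, Matrix.smul_apply, Matrix.single_apply,
    smul_eq_mul, setEntry, Function.update_self, Fin.eta]
  by_cases ha : a' = a
  · subst ha
    by_cases hb : b' = b
    · subst hb; simp
    · simp [hb, Ne.symm hb]
  · simp [ha, Ne.symm ha]

theorem toLayers_setEntry_of_ne {L : ℕ} {d : ℕ → ℕ} (W : Weights L d) (i : Fin L)
    (a : Fin (d (i + 1))) (b : Fin (d i)) (s : ℝ) {k : ℕ} (hk : k ≠ i) :
    toLayers (setEntry W i a b s) k = toLayers W k := by
  unfold toLayers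
  split_ifs with h
  · rw [setEntry, Function.update_of_ne]
    exact fun h' => hk (congrArg Fin.val h')
  · rfl

theorem seg_setEntry {L : ℕ} {d : ℕ → ℕ} (W : Weights L d) (i : Fin L)
    (a : Fin (d (i + 1))) (b : Fin (d i)) (s : ℝ) :
    seg (toLayers (setEntry W i a b s)) 0 L = seg (toLayers W) 0 L + (s - W i a b) •
      (seg (toLayers W) (i + 1) L * Matrix.single a b (1 : ℝ) * seg (toLayers W) 0 i) := by
  rw [← sub_eq_iff_eq_add', seg_sub_eq_sum _ _ (Nat.zero_le L), Finset.sum_eq_single (i : ℕ)]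
  · rw [toLayers_setEntry_self, Matrix.mul_smul, Matrix.smul_mul,
      seg_congr (A := toLayers (setEntry W i a b s)) (B := toLayers W) (i.2)
        fun k hk _ => toLayers_setEntry_of_ne W i a b s (by omega)]
  · intro k _ hk
    rw [toLayers_setEntry_of_ne W i a b s hk, sub_self, Matrix.mul_zero, Matrix.zero_mul]
  · intro h; exact absurd (Finset.mem_Ico.2 ⟨Nat.zero_le _, i.2⟩) h

theorem lossGrad_eq {L : ℕ} {d : ℕ → ℕ} {n : ℕ} (m : ℕ)
    (X : Matrix (Fin (d 0)) (Fin n) ℝ) (Y : Matrix (Fin (d L)) (Fin n) ℝ)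
    (Φ : Matrix (Fin (d L)) (Fin (d 0)) ℝ) (hΦ : ∀ W, regLoss X Y Φ ≤ regLoss X Y W)
    (W : Weights L d) (i : Fin L) :
    Matrix.of (lossGrad m X Y W i) = layerGrad L (outScale L m d) X Φ (toLayers W) i := by
  ext a b
  set c := outScale L m d with hc
  set P := seg (toLayers W) (i + 1) L with hP
  set S := seg (toLayers W) 0 i with hS
  set N := c • (seg (toLayers W) 0 L * X) - Y with hN
  set D := c • (P * Matrix.single a b (1 : ℝ) * (S * X)) with hD
  -- The product is affine in a single entry, so the loss is a quadratic polynomial in `s`, and the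
  -- derivative is read off its linear coefficient.
  have h1 : (fun s : ℝ => netLoss m X Y (setEntry W i a b s)) = fun s =>
      1 / 2 * (frobNorm N ^ 2 + 2 * ((s - W i a b) * frobInner N D) +
        (s - W i a b) ^ 2 * frobNorm D ^ 2) := by
    funext s
    have h2 : c • (seg (toLayers (setEntry W i a b s)) 0 L * X) - Y =
        N + (s - W i a b) • D := by
      rw [seg_setEntry, Matrix.add_mul, Matrix.smul_mul, smul_add, hN, hD, ← hP, ← hS,
        Matrix.mul_assoc (P * _), smul_comm c]
      abel
    rw [netLoss_eq, ← hc, h2, frobNorm_add_sq, frobInner_smul_right, frobNorm_smul, mul_pow,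
      sq_abs]
  have h3 : HasDerivAt (fun s : ℝ => 1 / 2 * (frobNorm N ^ 2 + 2 * ((s - W i a b) *
      frobInner N D) + (s - W i a b) ^ 2 * frobNorm D ^ 2)) (frobInner N D) (W i a b) := by
    have h4 : HasDerivAt (fun s : ℝ => s - W i a b) 1 (W i a b) :=
      (hasDerivAt_id _).sub_const _
    have h5 := ((((h4.mul_const (frobInner N D)).const_mul 2).const_add (frobNorm N ^ 2)).add
      ((h4.pow 2).mul_const (frobNorm D ^ 2))).const_mul (1 / 2)
    exact h5.congr_deriv (by simp)
  change deriv (fun s : ℝ => netLoss m X Y (setEntry W i a b s)) (W i a b) = _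
  rw [h1, h3.deriv, hD, frobInner_smul_right, frobInner_mul_right, frobInner_mul_left,
    frobInner_single, layerGrad, ← hP, ← hS, Matrix.smul_apply, smul_eq_mul, Matrix.mul_assoc P.transpose]
  -- The full residual `N` differs from `netResidual` by `Φ X - Y`, which the normal equations
  -- annihilate on the right by `Xᵀ`.
  have h6 : N * (S * X).transpose =
      netResidual L c X Φ (toLayers W) * (S * X).transpose := by
    have h7 : N = netResidual L c X Φ (toLayers W) + (Φ * X - Y) := by
      rw [netResidual, hN]; abel
    rw [h7, Matrix.add_mul, Matrix.transpose_mul, ← Matrix.mul_assoc (Φ * X - Y),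
      normal_equations X Y Φ hΦ, Matrix.zero_mul, add_zero]
  rw [h6]

theorem toLayers_gdIter_succ {L : ℕ} {d : ℕ → ℕ} {n : ℕ} (m : ℕ)
    (X : Matrix (Fin (d 0)) (Fin n) ℝ) (Y : Matrix (Fin (d L)) (Fin n) ℝ)
    (Φ : Matrix (Fin (d L)) (Fin (d 0)) ℝ) (hΦ : ∀ W, regLoss X Y Φ ≤ regLoss X Y W)
    (η : ℝ) (W0 : Weights L d) (t k : ℕ) (hk : k < L) :
    toLayers (gdIter m X Y η W0 (t + 1)) k = toLayers (gdIter m X Y η W0 t) k -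
      η • layerGrad L (outScale L m d) X Φ (toLayers (gdIter m X Y η W0 t)) k := by
  rw [← lossGrad_eq m X Y Φ hΦ _ ⟨k, hk⟩, toLayers_of_lt _ hk, toLayers_of_lt _ hk]
  rfl

/-! ### Moments of Gaussian vectors -/

/-- The normalizing constant of the standard Gaussian density in dimension `p`. -/
noncomputable def gaussConst (p : ℕ) : ℝ := (2 * Real.pi) ^ (-(p / 2 : ℝ))

theorem integrable_exp_neg_half_norm_sq (p : ℕ) :
    Integrable fun x : EuclideanSpace ℝ (Fin p) =>
      gaussConst p * Real.exp (-(1 / 2) * ‖x‖ ^ 2) := by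
  refine Integrable.const_mul ?_ _
  have h := GaussianFourier.integrable_cexp_neg_mul_sq_norm_add (b := 1 / 2) (by norm_num) 0
    (0 : EuclideanSpace ℝ (Fin p))
  have h2 := h.re
  refine h2.congr (Filter.Eventually.of_forall fun x => ?_)
  have h3 : -(1 / 2 : ℂ) * (‖x‖ : ℂ) ^ 2 + 0 * ((inner ℝ (0 : EuclideanSpace ℝ (Fin p)) x : ℝ) : ℂ)
      = ((-(1 / 2) * ‖x‖ ^ 2 : ℝ) : ℂ) := by push_cast; ring
  simp only [h3, ← Complex.ofReal_exp]
  exact Complex.ofReal_re _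

/-- Both sides are finite measures with the same characteristic function. The density makes polar
coordinates available for the moments. -/
theorem stdGaussian_eq_withDensity (p : ℕ) :
    stdGaussian (EuclideanSpace ℝ (Fin p)) = volume.withDensity fun x =>
      ENNReal.ofReal (gaussConst p * Real.exp (-(1 / 2) * ‖x‖ ^ 2)) := by
  have hint := integrable_exp_neg_half_norm_sq p
  have := isFiniteMeasure_withDensity_ofReal hint.hasFiniteIntegral
  have hc : 0 ≤ gaussConst p := by unfold gaussConst; positivity
  apply Measure.ext_of_charFun
  ext t
  rw [charFun_stdGaussian, charFun_apply, integral_withDensity_eq_integral_toReal_smul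
    (by fun_prop) (by simp)]
  have h := GaussianFourier.integral_cexp_neg_mul_sq_norm_add (b := 1 / 2) (by norm_num)
    Complex.I t
  have h1 : ∀ x : EuclideanSpace ℝ (Fin p),
      (ENNReal.ofReal (gaussConst p * Real.exp (-(1 / 2) * ‖x‖ ^ 2))).toReal •
        Complex.exp (inner ℝ x t * Complex.I) = (gaussConst p : ℂ) *
        Complex.exp (-(1 / 2) * ‖x‖ ^ 2 + Complex.I * inner ℝ t x) := fun x => by
    rw [ENNReal.toReal_ofReal (by positivity), Complex.real_smul, Complex.exp_add,
      real_inner_comm]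
    push_cast
    ring_nf
  simp_rw [h1]
  rw [integral_const_mul, h, ← mul_assoc]
  have h2 : (gaussConst p : ℂ) * (Real.pi / (1 / 2) : ℂ) ^
      (Module.finrank ℝ (EuclideanSpace ℝ (Fin p)) / 2 : ℂ) = 1 := by
    have h3 : (Real.pi / (1 / 2) : ℂ) = ((2 * Real.pi : ℝ) : ℂ) := by push_cast; ring
    rw [h3, finrank_euclideanSpace_fin, gaussConst]
    have h4 : ((p : ℂ) / 2) = ((p / 2 : ℝ) : ℂ) := by push_cast; ring
    rw [h4, ← Complex.ofReal_cpow (by positivity), ← Complex.ofReal_mul,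
      ← Real.rpow_add (by positivity)]
    simp
  rw [h2, one_mul, Complex.I_sq]
  congr 1
  ring

/-- The moment `E ‖g‖ ^ s` of a standard Gaussian vector in dimension `p`. -/
noncomputable def gaussMoment (p : ℕ) (s : ℝ) : ℝ :=
  gaussConst p * (p * volume.real (Metric.ball (0 : EuclideanSpace ℝ (Fin p)) 1)) *
    ∫ r in Set.Ioi (0 : ℝ), r ^ (p - 1 + s) * Real.exp (-(1 / 2) * r ^ (2 : ℝ))

theorem lintegral_norm_rpow_stdGaussian (p : ℕ) (hp : 0 < p) (s : ℝ) (hs : 0 < p + s) :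
    ∫⁻ x, ENNReal.ofReal (‖x‖ ^ s) ∂(stdGaussian (EuclideanSpace ℝ (Fin p))) =
      ENNReal.ofReal (gaussMoment p s) := by
  have : Nonempty (Fin p) := ⟨⟨0, hp⟩⟩
  have hc : 0 ≤ gaussConst p := by unfold gaussConst; positivity
  rw [stdGaussian_eq_withDensity, lintegral_withDensity_eq_lintegral_mul₀ (by fun_prop)
    (by fun_prop)]
  have h1 : ∀ x : EuclideanSpace ℝ (Fin p),
      ((fun x => ENNReal.ofReal (gaussConst p * Real.exp (-(1 / 2) * ‖x‖ ^ 2))) *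
        (fun x => ENNReal.ofReal (‖x‖ ^ s)) : EuclideanSpace ℝ (Fin p) → ENNReal) x =
      ENNReal.ofReal (gaussConst p * (‖x‖ ^ s * Real.exp (-(1 / 2) * ‖x‖ ^ 2))) := fun x => by
    rw [Pi.mul_apply, ← ENNReal.ofReal_mul (by positivity)]; congr 1; ring
  simp_rw [h1]
  have h2 : Set.EqOn (fun y : ℝ => y ^ (Module.finrank ℝ (EuclideanSpace ℝ (Fin p)) - 1) •
      (gaussConst p * (y ^ s * Real.exp (-(1 / 2) * y ^ 2)))) (fun r : ℝ => gaussConst p *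
      (r ^ (p - 1 + s) * Real.exp (-(1 / 2) * r ^ (2 : ℝ)))) (Set.Ioi 0) := fun y hy => by
    have hy : 0 < y := hy
    simp only [finrank_euclideanSpace_fin, smul_eq_mul]
    rw [Real.rpow_add hy, ← Real.rpow_natCast y (p - 1), Nat.cast_sub hp, Nat.cast_one,
      Real.rpow_two]
    ring
  have hint : Integrable fun x : EuclideanSpace ℝ (Fin p) =>
      gaussConst p * (‖x‖ ^ s * Real.exp (-(1 / 2) * ‖x‖ ^ 2)) := by
    refine (integrable_fun_norm_addHaar volume
      (f := fun y => gaussConst p * (y ^ s * Real.exp (-(1 / 2) * y ^ 2)))).2 ?_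
    refine IntegrableOn.congr_fun (Integrable.const_mul (integrableOn_rpow_mul_exp_neg_mul_rpow
      (s := p - 1 + s) (p := 2) (b := 1 / 2) (by linarith) (by norm_num) (by norm_num))
      (gaussConst p)) h2.symm measurableSet_Ioi
  rw [← ofReal_integral_eq_lintegral_ofReal hint
    (Filter.Eventually.of_forall fun x => by positivity),
    integral_fun_norm_addHaar volume
      (fun y => gaussConst p * (y ^ s * Real.exp (-(1 / 2) * y ^ 2))),
    setIntegral_congr_fun measurableSet_Ioi h2, integral_const_mul, gaussMoment]
  congr 1
  simp only [finrank_euclideanSpace_fin, smul_eq_mul, nsmul_eq_mul]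
  ring

theorem gaussMoment_zero (p : ℕ) (hp : 0 < p) : gaussMoment p 0 = 1 := by
  have h := lintegral_norm_rpow_stdGaussian p hp 0 (by simpa using hp)
  simp only [Real.rpow_zero, ENNReal.ofReal_one, lintegral_const, measure_univ, mul_one] at h
  rw [eq_comm, ENNReal.ofReal_eq_one] at h
  exact h

/-- The radial integral is a Gamma value at `(p + s) / 2`, so this is `Γ(x + 1) = x Γ(x)`. Negative
`s` is allowed as long as `p + s > 0`; the recursion thus yields inverse moments too. -/
theorem gaussMoment_add_two (p : ℕ) (s : ℝ) (hs : 0 < p + s) :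
    gaussMoment p (s + 2) = (p + s) * gaussMoment p s := by
  unfold gaussMoment
  rw [integral_rpow_mul_exp_neg_mul_rpow (by norm_num) (by linarith) (by norm_num),
    integral_rpow_mul_exp_neg_mul_rpow (by norm_num) (by linarith) (by norm_num)]
  have h1 : ((p : ℝ) - 1 + (s + 2) + 1) / 2 = (p - 1 + s + 1) / 2 + 1 := by ring
  have h2 : -((p : ℝ) - 1 + (s + 2) + 1) / 2 = -(p - 1 + s + 1) / 2 - 1 := by ring
  have h3 : (p - 1 + s + 1) / 2 = (p + s) / 2 := by ring
  rw [h1, h2, Real.Gamma_add_one (by rw [h3]; positivity),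
    Real.rpow_sub_one (by norm_num), h3]
  ring

theorem gaussMoment_two_mul_le (p k : ℕ) (hp : 0 < p) :
    gaussMoment p (2 * k) ≤ ∏ j ∈ Finset.range k, ((p : ℝ) + 2 * j) := by
  induction k with
  | zero => simp [gaussMoment_zero p hp]
  | succ k ih =>
    rw [Finset.prod_range_succ, Nat.cast_succ, mul_add, mul_one,
      gaussMoment_add_two p _ (by positivity), mul_comm]
    exact mul_le_mul_of_nonneg_right ih (by positivity)

theorem gaussMoment_neg_two_mul_le (p k : ℕ) (hk : 2 * k < p) :
    gaussMoment p (-(2 * k)) ≤ ∏ j ∈ Finset.range k, (1 / ((p : ℝ) - 2 * (j + 1))) := by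
  induction k with
  | zero => simp [gaussMoment_zero p (by omega)]
  | succ k ih =>
    have hpk : (0 : ℝ) < p - 2 * (k + 1) := by
      have : ((2 * (k + 1) : ℕ) : ℝ) < p := by exact_mod_cast hk
      push_cast at this; linarith
    have h := gaussMoment_add_two p (-(2 * ((k : ℝ) + 1))) (by linarith)
    rw [show -(2 * ((k : ℝ) + 1)) + 2 = -(2 * k) by ring, ← sub_eq_add_neg] at h
    rw [Finset.prod_range_succ, Nat.cast_succ, mul_one_div, le_div_iff₀ hpk, mul_comm, ← h]
    exact ih (by omega)

/-! ### Gaussian matrices -/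

/-- The law of a `p × q` matrix with independent standard Gaussian entries. -/
noncomputable def gaussMat (p q : ℕ) : Measure (Fin p → Fin q → ℝ) :=
  Measure.pi fun _ => Measure.pi fun _ => gaussianReal 0 1

instance (p q : ℕ) : IsProbabilityMeasure (gaussMat p q) := by
  unfold gaussMat; infer_instance

instance (L : ℕ) (d : ℕ → ℕ) : IsProbabilityMeasure (initLaw L d) := by
  unfold initLaw; infer_instance

/-- The exponential factors over the independent entries. Only `‖t‖ ‖u‖` enters the result, so one
computation identifies the laws of both `Y u` and `Yᵀ t`. -/
theorem integral_cexp_bilin_gaussMat {p q : ℕ} (t : Fin p → ℝ) (u : Fin q → ℝ) :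
    ∫ Y, Complex.exp (((∑ a, ∑ b, t a * Y a b * u b : ℝ) : ℂ) * Complex.I) ∂gaussMat p q =
      Complex.exp (-(nsq t * nsq u) / 2 : ℝ) := by
  have h1 : ∀ Y : Fin p → Fin q → ℝ,
      Complex.exp (((∑ a, ∑ b, t a * Y a b * u b : ℝ) : ℂ) * Complex.I) =
      ∏ a, ∏ b, Complex.exp (((t a * u b * Y a b : ℝ) : ℂ) * Complex.I) := fun Y => by
    simp_rw [← Complex.exp_sum, ← Finset.sum_mul]
    congr 2
    push_cast
    exact Finset.sum_congr rfl fun a _ => Finset.sum_congr rfl fun b _ => by ring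
  simp_rw [h1]
  rw [gaussMat, integral_fintype_prod_eq_prod (fun (a : Fin p) (y : Fin q → ℝ) =>
    ∏ b, Complex.exp (((t a * u b * y b : ℝ) : ℂ) * Complex.I))]
  have h2 : ∀ a, ∫ y : Fin q → ℝ, ∏ b, Complex.exp (((t a * u b * y b : ℝ) : ℂ) * Complex.I)
      ∂(Measure.pi fun _ => gaussianReal 0 1) =
      ∏ b, Complex.exp (-((t a * u b) ^ 2) / 2 : ℝ) := fun a => by
    rw [integral_fintype_prod_eq_prod (fun (b : Fin q) (y : ℝ) =>
      Complex.exp (((t a * u b * y : ℝ) : ℂ) * Complex.I))]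
    refine Finset.prod_congr rfl fun b _ => ?_
    have := charFun_gaussianReal (μ := 0) (v := 1) (t a * u b)
    rw [charFun_apply_real] at this
    push_cast at this ⊢
    rw [this]
    congr 1
    simp
    ring
  simp_rw [h2, ← Complex.exp_sum, ← Complex.ofReal_sum]
  congr 2
  rw [nsq, nsq, Finset.sum_mul_sum, ← Finset.sum_neg_distrib, Finset.sum_div]
  refine Finset.sum_congr rfl fun a _ => ?_
  rw [← Finset.sum_neg_distrib, Finset.sum_div]
  exact Finset.sum_congr rfl fun b _ => by ring

theorem charFun_smul_stdGaussian {p : ℕ} (r : ℝ) (hr : 0 ≤ r)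
    (t : EuclideanSpace ℝ (Fin p)) :
    charFun ((stdGaussian (EuclideanSpace ℝ (Fin p))).map (√r • ·)) t =
      Complex.exp (-(nsq t.ofLp * r) / 2 : ℝ) := by
  rw [charFun_map_smul, charFun_stdGaussian, norm_smul, nsq_eq_norm_sq, WithLp.toLp_ofLp]
  congr 1
  rw [Real.norm_eq_abs, abs_of_nonneg (Real.sqrt_nonneg r)]
  have : ((√r : ℝ) : ℂ) ^ 2 = (r : ℂ) := by
    rw [← Complex.ofReal_pow, Real.sq_sqrt hr]
  push_cast
  rw [mul_pow, this]
  ring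

theorem continuous_mulVec_left {p q : ℕ} (u : Fin q → ℝ) :
    Continuous fun Y : Fin p → Fin q → ℝ => (Matrix.of Y).mulVec u :=
  Continuous.matrix_mulVec (A := fun Y : Fin p → Fin q → ℝ => Matrix.of Y)
    continuous_id continuous_const

theorem continuous_transpose_mulVec_left {p q : ℕ} (u : Fin p → ℝ) :
    Continuous fun Y : Fin p → Fin q → ℝ => (Matrix.of Y).transpose.mulVec u :=
  Continuous.matrix_mulVec (A := fun Y : Fin p → Fin q → ℝ => (Matrix.of Y).transpose)
    (Continuous.matrix_transpose continuous_id) continuous_const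

/-- A Gaussian matrix maps a fixed vector to a scaled standard Gaussian vector. -/
theorem map_mulVec_gaussMat {p q : ℕ} (u : Fin q → ℝ) :
    (gaussMat p q).map (fun Y => (WithLp.toLp 2 ((Matrix.of Y).mulVec u) :
      EuclideanSpace ℝ (Fin p))) =
      (stdGaussian (EuclideanSpace ℝ (Fin p))).map (√(nsq u) • ·) := by
  have hm : Measurable fun Y : Fin p → Fin q → ℝ =>
      (WithLp.toLp 2 ((Matrix.of Y).mulVec u) : EuclideanSpace ℝ (Fin p)) :=
    ((PiLp.continuous_toLp 2 _).comp (continuous_mulVec_left u)).measurable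
  have := Measure.isProbabilityMeasure_map (μ := gaussMat p q) hm.aemeasurable
  apply Measure.ext_of_charFun
  ext t
  rw [charFun_smul_stdGaussian _ (nsq_nonneg u), charFun_apply,
    integral_map hm.aemeasurable (by fun_prop), ← integral_cexp_bilin_gaussMat]
  refine integral_congr_ae (Filter.Eventually.of_forall fun Y => ?_)
  simp only [PiLp.inner_apply, Matrix.mulVec, dotProduct, Matrix.of_apply]
  congr 3
  refine Finset.sum_congr rfl fun a _ => ?_
  simp only [RCLike.inner_apply, conj_trivial, Finset.mul_sum]
  exact Finset.sum_congr rfl fun b _ => by ring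

theorem map_transpose_mulVec_gaussMat {p q : ℕ} (u : Fin p → ℝ) :
    (gaussMat p q).map (fun Y => (WithLp.toLp 2 ((Matrix.of Y).transpose.mulVec u) :
      EuclideanSpace ℝ (Fin q))) =
      (stdGaussian (EuclideanSpace ℝ (Fin q))).map (√(nsq u) • ·) := by
  have hm : Measurable fun Y : Fin p → Fin q → ℝ =>
      (WithLp.toLp 2 ((Matrix.of Y).transpose.mulVec u) : EuclideanSpace ℝ (Fin q)) :=
    ((PiLp.continuous_toLp 2 _).comp (continuous_transpose_mulVec_left u)).measurable
  have := Measure.isProbabilityMeasure_map (μ := gaussMat p q) hm.aemeasurable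
  apply Measure.ext_of_charFun
  ext t
  rw [charFun_smul_stdGaussian _ (nsq_nonneg u), charFun_apply,
    integral_map hm.aemeasurable (by fun_prop), mul_comm (nsq _), ← integral_cexp_bilin_gaussMat]
  refine integral_congr_ae (Filter.Eventually.of_forall fun Y => ?_)
  simp only [PiLp.inner_apply, Matrix.mulVec, dotProduct, Matrix.of_apply, Matrix.transpose_apply]
  congr 3
  rw [Finset.sum_comm]
  refine Finset.sum_congr rfl fun a _ => ?_
  simp only [RCLike.inner_apply, conj_trivial, Finset.mul_sum]
  exact Finset.sum_congr rfl fun b _ => by ring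

/-- The squared norm as an extended nonnegative real, raised to the power `k`. -/
noncomputable def normPow (k : ℕ) (p : ℕ) (v : Fin p → ℝ) : ENNReal :=
  ENNReal.ofReal (nsq v) ^ k

theorem continuous_nsq {p : ℕ} : Continuous (nsq (p := p)) := by
  unfold nsq; fun_prop

theorem measurable_normPow (k p : ℕ) : Measurable (normPow k p) :=
  (continuous_nsq.measurable.ennreal_ofReal).pow_const k

theorem measurable_normPow_inv (k p : ℕ) : Measurable fun v => (normPow k p v)⁻¹ :=
  (measurable_normPow k p).inv

theorem measurable_normPow_ofLp (k p : ℕ) :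
    Measurable fun x : EuclideanSpace ℝ (Fin p) => normPow k p x.ofLp :=
  (measurable_normPow k p).comp (PiLp.continuous_ofLp 2 _).measurable

theorem measurable_normPow_ofLp_inv (k p : ℕ) :
    Measurable fun x : EuclideanSpace ℝ (Fin p) => (normPow k p x.ofLp)⁻¹ :=
  (measurable_normPow_ofLp k p).inv

theorem normPow_smul (k : ℕ) {p : ℕ} (r : ℝ) (hr : 0 ≤ r) (x : EuclideanSpace ℝ (Fin p)) :
    normPow k p (√r • x).ofLp = ENNReal.ofReal r ^ k * ENNReal.ofReal (‖x‖ ^ 2) ^ k := by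
  rw [normPow, nsq_eq_norm_sq, WithLp.toLp_ofLp, norm_smul, Real.norm_eq_abs,
    abs_of_nonneg (Real.sqrt_nonneg r), mul_pow, Real.sq_sqrt hr, ENNReal.ofReal_mul hr, mul_pow]

theorem lintegral_normPow_smul (k : ℕ) {p : ℕ} (hp : 0 < p) (r : ℝ) (hr : 0 ≤ r) :
    ∫⁻ x, normPow k p x.ofLp ∂(stdGaussian (EuclideanSpace ℝ (Fin p))).map (√r • ·) ≤
      ENNReal.ofReal (∏ j ∈ Finset.range k, ((p : ℝ) + 2 * j)) * ENNReal.ofReal r ^ k := by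
  rw [lintegral_map (measurable_normPow_ofLp k p) (by fun_prop)]
  simp_rw [normPow_smul k r hr]
  rw [lintegral_const_mul _ (by fun_prop), mul_comm]
  refine mul_le_mul_left ?_ _
  refine le_trans (le_of_eq ?_) (ENNReal.ofReal_le_ofReal (gaussMoment_two_mul_le p k hp))
  rw [← lintegral_norm_rpow_stdGaussian p hp _ (by positivity)]
  refine lintegral_congr fun x => ?_
  rw [← ENNReal.ofReal_pow (by positivity), Real.rpow_mul (norm_nonneg x), Real.rpow_two,
    Real.rpow_natCast]

theorem lintegral_normPow_inv_smul (k : ℕ) {p : ℕ} (hp : 2 * k < p) (r : ℝ) (hr : 0 ≤ r) :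
    ∫⁻ x, (normPow k p x.ofLp)⁻¹ ∂(stdGaussian (EuclideanSpace ℝ (Fin p))).map (√r • ·) ≤
      ENNReal.ofReal (∏ j ∈ Finset.range k, (1 / ((p : ℝ) - 2 * (j + 1)))) *
        (ENNReal.ofReal r ^ k)⁻¹ := by
  have hp0 : 0 < p := by omega
  have : Nonempty (Fin p) := ⟨⟨0, hp0⟩⟩
  have hpk : (0 : ℝ) < p + -(2 * k) := by
    have : ((2 * k : ℕ) : ℝ) < p := by exact_mod_cast hp
    push_cast at this; linarith
  rw [lintegral_map (measurable_normPow_ofLp_inv k p) (by fun_prop)]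
  have h1 : ∀ x : EuclideanSpace ℝ (Fin p), (normPow k p (√r • x).ofLp)⁻¹ =
      (ENNReal.ofReal r ^ k)⁻¹ * (ENNReal.ofReal (‖x‖ ^ 2) ^ k)⁻¹ := fun x => by
    rw [normPow_smul k r hr, ENNReal.mul_inv]
    · right; finiteness
    · left; finiteness
  simp_rw [h1]
  rw [lintegral_const_mul _ (by fun_prop), mul_comm]
  refine mul_le_mul_left ?_ _
  refine le_trans (le_of_eq ?_) (ENNReal.ofReal_le_ofReal (gaussMoment_neg_two_mul_le p k hp))
  rw [← lintegral_norm_rpow_stdGaussian p hp0 _ hpk]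
  -- At the origin the real power and the extended inverse may disagree, so the origin is discarded
  -- as a null set.
  have hac : stdGaussian (EuclideanSpace ℝ (Fin p)) ≪ volume := by
    rw [stdGaussian_eq_withDensity]; exact withDensity_absolutelyContinuous _ _
  have hne : ∀ᵐ x ∂(stdGaussian (EuclideanSpace ℝ (Fin p))), x ≠ 0 :=
    hac.ae_le (compl_mem_ae_iff.2 (measure_singleton 0))
  refine lintegral_congr_ae (hne.mono fun x hx => ?_)
  have hx0 : 0 < ‖x‖ := norm_pos_iff.2 hx
  simp only
  rw [← ENNReal.ofReal_pow (by positivity), ← ENNReal.ofReal_inv_of_pos (by positivity),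
    Real.rpow_neg (norm_nonneg x), Real.rpow_mul (norm_nonneg x), Real.rpow_two,
    Real.rpow_natCast]

/-- Each factor exceeds `m` by a relative amount of at most `4 k / m`. The `4` is generous, so that
inverse moments obey a bound with the same exponential. -/
theorem prod_add_le (m k : ℕ) (hm : 0 < m) :
    ∏ j ∈ Finset.range k, ((m : ℝ) + 2 * j) ≤ m ^ k * Real.exp (4 * k ^ 2 / m) := by
  have hm' : (0 : ℝ) < m := by exact_mod_cast hm
  have h1 : ∀ j ∈ Finset.range k, (m : ℝ) + 2 * j ≤ m * Real.exp (4 * k / m) := by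
    intro j hj
    have hj : (j : ℝ) ≤ k := by exact_mod_cast (Finset.mem_range.1 hj).le
    have h2 := Real.add_one_le_exp (4 * k / m : ℝ)
    calc (m : ℝ) + 2 * j ≤ m + 4 * k := by
          have : (0 : ℝ) ≤ k := by positivity
          linarith
      _ = m * (4 * k / m + 1) := by field_simp; ring
      _ ≤ _ := by gcongr
  refine (Finset.prod_le_prod (fun j _ => by positivity) h1).trans (le_of_eq ?_)
  rw [Finset.prod_const, Finset.card_range, mul_pow, ← Real.exp_nat_mul]
  congr 2; ring

theorem prod_inv_sub_le (m k : ℕ) (hk : 4 * k ≤ m) (hm : 0 < m) :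
    ∏ j ∈ Finset.range k, (1 / ((m : ℝ) - 2 * (j + 1))) ≤
      ((m : ℝ) ^ k)⁻¹ * Real.exp (4 * k ^ 2 / m) := by
  have hm' : (0 : ℝ) < m := by exact_mod_cast hm
  have hk' : 4 * (k : ℝ) ≤ m := by exact_mod_cast hk
  have h0 : ∀ j ∈ Finset.range k, (m : ℝ) - 2 * k ≤ m - 2 * (j + 1) := by
    intro j hj
    have hj : (j + 1 : ℝ) ≤ k := by exact_mod_cast Finset.mem_range.1 hj
    linarith
  have h00 : (0 : ℝ) < m - 2 * k := by linarith
  have h1 : ∀ j ∈ Finset.range k, 1 / ((m : ℝ) - 2 * (j + 1)) ≤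
      (m : ℝ)⁻¹ * Real.exp (4 * k / m) := by
    intro j hj
    refine (one_div_le_one_div_of_le h00 (h0 j hj)).trans ?_
    have h2 := Real.add_one_le_exp (4 * k / m : ℝ)
    -- With `x = 4 k / m ≤ 1` this says `(1 + x) (1 - x / 2) ≥ 1`.
    calc 1 / ((m : ℝ) - 2 * k) ≤ (m : ℝ)⁻¹ * (4 * k / m + 1) := by
          rw [div_le_iff₀ h00, ← sub_nonneg]
          have : (m : ℝ)⁻¹ * (4 * k / m + 1) * (m - 2 * k) - 1 =
            2 * k * (m - 4 * k) / m ^ 2 := by field_simp; ring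
          rw [this]
          have : 0 ≤ (m : ℝ) - 4 * k := by linarith
          positivity
      _ ≤ _ := by gcongr
  refine (Finset.prod_le_prod (fun j hj => ?_) h1).trans (le_of_eq ?_)
  · have := h0 j hj
    exact one_div_nonneg.2 (by linarith)
  rw [Finset.prod_const, Finset.card_range, mul_pow, ← Real.exp_nat_mul, inv_pow]
  congr 2; ring

theorem lintegral_comp_mulVec_gaussMat {p q : ℕ} (u : Fin q → ℝ) {f : (Fin p → ℝ) → ENNReal}
    (hf : Measurable f) :
    ∫⁻ Y, f ((Matrix.of Y).mulVec u) ∂gaussMat p q =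
      ∫⁻ x, f x.ofLp ∂(stdGaussian (EuclideanSpace ℝ (Fin p))).map (√(nsq u) • ·) := by
  rw [← map_mulVec_gaussMat]
  exact (lintegral_map (f := fun x : EuclideanSpace ℝ (Fin p) => f x.ofLp)
    (hf.comp (PiLp.continuous_ofLp 2 _).measurable)
    ((PiLp.continuous_toLp 2 _).comp (continuous_mulVec_left u)).measurable).symm

theorem lintegral_comp_transpose_mulVec_gaussMat {p q : ℕ} (u : Fin p → ℝ)
    {f : (Fin q → ℝ) → ENNReal} (hf : Measurable f) :
    ∫⁻ Y, f ((Matrix.of Y).transpose.mulVec u) ∂gaussMat p q =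
      ∫⁻ x, f x.ofLp ∂(stdGaussian (EuclideanSpace ℝ (Fin q))).map (√(nsq u) • ·) := by
  rw [← map_transpose_mulVec_gaussMat]
  exact (lintegral_map (f := fun x : EuclideanSpace ℝ (Fin q) => f x.ofLp)
    (hf.comp (PiLp.continuous_ofLp 2 _).measurable)
    ((PiLp.continuous_toLp 2 _).comp (continuous_transpose_mulVec_left u)).measurable).symm

/-! ### Integrating out the layers one by one -/

/-- Fubini in one coordinate, phrased as resampling that coordinate independently. This lets a
single layer be integrated with the others frozen. -/
theorem lintegral_pi_update {ι : Type*} [Fintype ι] [DecidableEq ι] {X : ι → Type*}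
    [∀ i, MeasurableSpace (X i)] (μ : ∀ i, Measure (X i)) [∀ i, IsProbabilityMeasure (μ i)]
    {f : (∀ i, X i) → ENNReal} (hf : Measurable f) (i : ι) :
    ∫⁻ x, f x ∂Measure.pi μ =
      ∫⁻ x, ∫⁻ y, f (Function.update x i y) ∂μ i ∂Measure.pi μ := by
  have hne : Nonempty (∀ i, X i) := ⟨fun i => (μ i).nonempty_of_neZero.some⟩
  obtain ⟨x₀⟩ := hne
  have hmeas : Measurable (∫⋯∫⁻_{i}, f ∂μ) := hf.lmarginal μ
  rw [← lmarginal_singleton f i]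
  rw [lintegral_eq_lmarginal_univ (μ := μ) x₀, lintegral_eq_lmarginal_univ (μ := μ) x₀,
    lmarginal_erase' f hf (Finset.mem_univ i), lmarginal_erase' _ hmeas (Finset.mem_univ i)]
  congr 1
  funext x
  simp only [lmarginal_update_of_mem μ (Finset.mem_singleton_self i), lintegral_const,
    measure_univ, mul_one]
  rw [lmarginal_singleton f i]

theorem continuous_toLayers {L : ℕ} {d : ℕ → ℕ} (k : ℕ) :
    Continuous fun W : Weights L d => toLayers W k := by
  unfold toLayers
  split_ifs with h
  · exact continuous_apply (⟨k, h⟩ : Fin L)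
  · exact continuous_const

theorem continuous_seg {L : ℕ} {d : ℕ → ℕ} {i j : ℕ} (hij : i ≤ j) :
    Continuous fun W : Weights L d => seg (toLayers W) i j := by
  induction j, hij using Nat.le_induction with
  | base => simp_rw [seg_self]; exact continuous_const
  | succ j hj ih =>
    simp_rw [seg_succ _ hj]
    exact (continuous_toLayers j).matrix_mul ih

theorem toLayers_update_self {L : ℕ} {d : ℕ → ℕ} (W : Weights L d) (i : Fin L)
    (Y : Fin (d (i + 1)) → Fin (d i) → ℝ) :
    toLayers (Function.update W i Y) i = Matrix.of Y := by
  rw [toLayers_of_lt _ i.2]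
  exact congrArg Matrix.of (Function.update_self i Y W)

theorem toLayers_update_of_ne {L : ℕ} {d : ℕ → ℕ} (W : Weights L d) (i : Fin L)
    (Y : Fin (d (i + 1)) → Fin (d i) → ℝ) {k : ℕ} (hk : k ≠ i) :
    toLayers (Function.update W i Y) k = toLayers W k := by
  unfold toLayers
  split_ifs with h
  · rw [Function.update_of_ne]
    exact fun h' => hk (congrArg Fin.val h')
  · rfl

/-- The last layer is independent of the vector produced by the earlier ones. Integrating it out
costs `c j` and leaves a shorter product. -/
theorem lintegral_seg_mulVec_le {L : ℕ} {d : ℕ → ℕ} (Ψ : ∀ p : ℕ, (Fin p → ℝ) → ENNReal)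
    (hΨ : ∀ p, Measurable (Ψ p)) (c : ℕ → ENNReal) {i j : ℕ} (hij : i ≤ j) (hj : j ≤ L)
    (hc : ∀ k, i ≤ k → k < j → ∀ u : Fin (d k) → ℝ,
      ∫⁻ Y, Ψ _ ((Matrix.of Y).mulVec u) ∂gaussMat (d (k + 1)) (d k) ≤ c k * Ψ _ u)
    (v : Fin (d i) → ℝ) :
    ∫⁻ W, Ψ _ ((seg (toLayers W) i j).mulVec v) ∂initLaw L d ≤
      (∏ k ∈ Finset.Ico i j, c k) * Ψ _ v := by
  induction j, hij using Nat.le_induction with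
  | base => simp [seg_self]
  | succ j hij ih =>
    have hm : Measurable fun W : Weights L d => Ψ _ ((seg (toLayers W) i (j + 1)).mulVec v) :=
      (hΨ _).comp ((continuous_seg (by omega)).matrix_mulVec continuous_const).measurable
    have hm' : Measurable fun W : Weights L d => Ψ _ ((seg (toLayers W) i j).mulVec v) :=
      (hΨ _).comp ((continuous_seg hij).matrix_mulVec continuous_const).measurable
    rw [initLaw, lintegral_pi_update _ hm (⟨j, hj⟩ : Fin L)]
    have h1 : ∀ (W : Weights L d) (Y : Fin (d (j + 1)) → Fin (d j) → ℝ),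
        (seg (toLayers (Function.update W ⟨j, hj⟩ Y)) i (j + 1)).mulVec v =
        (Matrix.of Y).mulVec ((seg (toLayers W) i j).mulVec v) := fun W Y => by
      rw [seg_succ _ hij, seg_congr hij fun k _ hk => toLayers_update_of_ne W ⟨j, hj⟩ Y hk.ne,
        toLayers_update_self W ⟨j, hj⟩ Y, Matrix.mulVec_mulVec]
    simp_rw [h1]
    rw [Finset.prod_Ico_succ_top hij, mul_comm _ (c j), mul_assoc]
    refine (lintegral_mono fun W => hc j hij (by omega) _).trans ?_
    rw [lintegral_const_mul _ hm']
    exact mul_le_mul_right (ih (by omega) fun k h1 h2 => hc k h1 (by omega)) _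

/-- For transposes the vector enters at the output end, so the layers are peeled off from the input
side. -/
theorem lintegral_seg_transpose_mulVec_le {L : ℕ} {d : ℕ → ℕ}
    (Ψ : ∀ p : ℕ, (Fin p → ℝ) → ENNReal)
    (hΨ : ∀ p, Measurable (Ψ p)) (c : ℕ → ENNReal) {i j : ℕ} (hij : i ≤ j) (hj : j ≤ L)
    (hc : ∀ k, i ≤ k → k < j → ∀ u : Fin (d (k + 1)) → ℝ,
      ∫⁻ Y, Ψ _ ((Matrix.of Y).transpose.mulVec u) ∂gaussMat (d (k + 1)) (d k) ≤ c k * Ψ _ u)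
    (v : Fin (d j) → ℝ) :
    ∫⁻ W, Ψ _ ((seg (toLayers W) i j).transpose.mulVec v) ∂initLaw L d ≤
      (∏ k ∈ Finset.Ico i j, c k) * Ψ _ v := by
  induction hn : j - i generalizing i with
  | zero =>
    obtain rfl : i = j := by omega
    simp [seg_self]
  | succ n ih =>
    have hij' : i < j := by omega
    have hm : ∀ i ≤ j, Measurable fun W : Weights L d =>
        Ψ _ ((seg (toLayers W) i j).transpose.mulVec v) := fun i hi =>
      (hΨ _).comp (((continuous_seg hi).matrix_transpose).matrix_mulVec
        continuous_const).measurable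
    rw [initLaw, lintegral_pi_update _ (hm i hij) (⟨i, by omega⟩ : Fin L)]
    have h1 : ∀ (W : Weights L d) (Y : Fin (d (i + 1)) → Fin (d i) → ℝ),
        (seg (toLayers (Function.update W ⟨i, by omega⟩ Y)) i j).transpose.mulVec v =
        (Matrix.of Y).transpose.mulVec ((seg (toLayers W) (i + 1) j).transpose.mulVec v) :=
        fun W Y => by
      have h2 : seg (toLayers (Function.update W (⟨i, by omega⟩ : Fin L) Y)) (i + 1) j =
          seg (toLayers W) (i + 1) j := seg_congr hij' fun k hk _ =>
        toLayers_update_of_ne W ⟨i, by omega⟩ Y (by simp only; omega)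
      rw [seg_cons _ hij', h2, toLayers_update_self W ⟨i, by omega⟩ Y, Matrix.transpose_mul, Matrix.mulVec_mulVec]
    simp_rw [h1]
    rw [Finset.prod_eq_prod_Ico_succ_bot hij', mul_assoc]
    refine (lintegral_mono fun W => hc i le_rfl hij' _).trans ?_
    rw [lintegral_const_mul _ (hm (i + 1) hij')]
    exact mul_le_mul_right (ih hij' (fun k h1 h2 => hc k (by omega) h2) (by omega)) _

/-! ### From fixed vectors to subspaces -/

/-- A `1 / 2`-separated subset of the unit ball of maximal cardinality is a net, since a point far
from it could be added. Doubling all points turns the cardinality bound into one for unit-separated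
points in the ball of radius two. -/
theorem exists_half_net (E : Type*) [NormedAddCommGroup E] [NormedSpace ℝ E]
    [FiniteDimensional ℝ E] :
    ∃ N : Finset E, N.card ≤ 5 ^ Module.finrank ℝ E ∧ (∀ c ∈ N, ‖c‖ ≤ 1) ∧
      ∀ x : E, ‖x‖ ≤ 1 → ∃ c ∈ N, ‖x - c‖ ≤ 1 / 2 := by
  classical
  let P : Finset E → Prop := fun s => (∀ c ∈ s, ‖c‖ ≤ 1) ∧
    ∀ c ∈ s, ∀ c' ∈ s, c ≠ c' → 1 / 2 ≤ ‖c - c'‖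
  have hcard : ∀ s, P s → s.card ≤ 5 ^ Module.finrank ℝ E := by
    intro s hs
    have hinj : Function.Injective fun x : E => (2 : ℝ) • x := smul_right_injective E two_ne_zero
    rw [← Finset.card_image_of_injective s hinj]
    refine Besicovitch.card_le_of_separated _ (fun c hc => ?_) fun c hc c' hc' hne => ?_
    · obtain ⟨x, hx, rfl⟩ := Finset.mem_image.1 hc
      have := hs.1 x hx
      rw [norm_smul, Real.norm_two]; linarith
    · obtain ⟨x, hx, rfl⟩ := Finset.mem_image.1 hc
      obtain ⟨y, hy, rfl⟩ := Finset.mem_image.1 hc'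
      have := hs.2 x hx y hy fun h => hne (by rw [h])
      rw [← smul_sub, norm_smul, Real.norm_two]; linarith
  have hne : {k | ∃ s, P s ∧ s.card = k}.Nonempty := ⟨0, ∅, by simp [P], rfl⟩
  have hbdd : BddAbove {k | ∃ s, P s ∧ s.card = k} :=
    ⟨_, by rintro k ⟨s, hs, rfl⟩; exact hcard s hs⟩
  obtain ⟨N, hN, hNcard⟩ := Nat.sSup_mem hne hbdd
  refine ⟨N, hcard N hN, hN.1, fun x hx => ?_⟩
  by_contra! hfar
  have hxN : x ∉ N := fun h => by
    have := hfar x h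
    rw [sub_self, norm_zero] at this; norm_num at this
  have hP : P (insert x N) := by
    refine ⟨fun c hc => ?_, fun c hc c' hc' hne => ?_⟩
    · rcases Finset.mem_insert.1 hc with rfl | h
      · exact hx
      · exact hN.1 c h
    · rcases Finset.mem_insert.1 hc with rfl | h <;> rcases Finset.mem_insert.1 hc' with rfl | h'
      · exact absurd rfl hne
      · exact (hfar c' h').le
      · rw [norm_sub_rev]; exact (hfar c h).le
      · exact hN.2 c h c' h' hne
  have := le_csSup hbdd ⟨_, hP, rfl⟩
  rw [Finset.card_insert_of_notMem hxN, ← hNcard] at this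
  omega

/-- Approximating a unit vector by the net gives `‖g‖ ≤ a + ‖g‖ / 2`, hence `‖g‖ ≤ 2 a`. -/
theorem abs_le_of_half_net {E : Type*} [NormedAddCommGroup E] [NormedSpace ℝ E]
    [FiniteDimensional ℝ E] {N : Finset E}
    (hN : ∀ x : E, ‖x‖ ≤ 1 → ∃ c ∈ N, ‖x - c‖ ≤ 1 / 2) (f : E →ₗ[ℝ] ℝ) {a : ℝ} (ha : 0 ≤ a)
    (h : ∀ c ∈ N, |f c| ≤ a) (x : E) : |f x| ≤ 2 * a * ‖x‖ := by
  set g := LinearMap.toContinuousLinearMap f with hg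
  have hgf : ∀ y, g y = f y := fun y => rfl
  have h1 : ‖g‖ ≤ a + ‖g‖ / 2 := by
    refine ContinuousLinearMap.opNorm_le_of_unit_norm (by positivity) fun y hy => ?_
    obtain ⟨c, hc, hyc⟩ := hN y hy.le
    have h2 : g y = g c + g (y - c) := by rw [map_sub]; ring
    rw [h2]
    refine (norm_add_le _ _).trans (add_le_add (h c hc) ?_)
    refine (g.le_opNorm _).trans ?_
    have := mul_le_mul_of_nonneg_left hyc (norm_nonneg g)
    linarith
  have h2 := g.le_opNorm x
  rw [Real.norm_eq_abs, hgf] at h2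
  exact h2.trans (mul_le_mul_of_nonneg_right (by linarith) (norm_nonneg x))

/-- The defect `⟨T x, T y⟩ - M ⟨x, y⟩` is a symmetric bilinear form. Polarization bounds it by `ε M`
on pairs from the net, and passing from the net to all vectors costs a factor two in each argument.
-/
theorem near_isometry_of_half_net {E G : Type*} [NormedAddCommGroup E] [InnerProductSpace ℝ E]
    [FiniteDimensional ℝ E] [NormedAddCommGroup G] [InnerProductSpace ℝ G] {N : Finset E}
    (hN1 : ∀ c ∈ N, ‖c‖ ≤ 1) (hN : ∀ x : E, ‖x‖ ≤ 1 → ∃ c ∈ N, ‖x - c‖ ≤ 1 / 2)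
    (T : E →ₗ[ℝ] G) {M ε : ℝ} (hM : 0 ≤ M) (hε : 0 ≤ ε)
    (h : ∀ c ∈ N, ∀ c' ∈ N, |‖T (c + c')‖ ^ 2 - M * ‖c + c'‖ ^ 2| ≤ ε * M * ‖c + c'‖ ^ 2 ∧
      |‖T (c - c')‖ ^ 2 - M * ‖c - c'‖ ^ 2| ≤ ε * M * ‖c - c'‖ ^ 2) (x : E) :
    |‖T x‖ ^ 2 - M * ‖x‖ ^ 2| ≤ 4 * ε * M * ‖x‖ ^ 2 := by
  let B : E → E →ₗ[ℝ] ℝ := fun x =>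
    ((innerₛₗ ℝ (T x)).comp T) - M • innerₛₗ ℝ x
  have hB : ∀ x y, B x y = inner ℝ (T x) (T y) - M * inner ℝ x y := fun x y => rfl
  have hBsymm : ∀ x y, B x y = B y x := fun x y => by
    rw [hB, hB, real_inner_comm, real_inner_comm y x]
  have h1 : ∀ c ∈ N, ∀ c' ∈ N, |B c c'| ≤ ε * M := by
    intro c hc c' hc'
    obtain ⟨ha, hb⟩ := h c hc c' hc'
    have h2 : 4 * B c c' = (‖T (c + c')‖ ^ 2 - M * ‖c + c'‖ ^ 2) -
        (‖T (c - c')‖ ^ 2 - M * ‖c - c'‖ ^ 2) := by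
      rw [hB, map_add, map_sub, norm_add_sq_real, norm_sub_sq_real, norm_add_sq_real,
        norm_sub_sq_real]
      ring
    have h3 : ‖c + c'‖ ^ 2 + ‖c - c'‖ ^ 2 ≤ 4 := by
      have h4 := pow_le_one₀ (n := 2) (norm_nonneg c) (hN1 c hc)
      have h5 := pow_le_one₀ (n := 2) (norm_nonneg c') (hN1 c' hc')
      rw [norm_add_sq_real, norm_sub_sq_real]; linarith
    have h4 : ε * M * ‖c + c'‖ ^ 2 + ε * M * ‖c - c'‖ ^ 2 ≤ ε * M * 4 := by
      rw [← mul_add]; exact mul_le_mul_of_nonneg_left h3 (by positivity)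
    rw [abs_le] at ha hb ⊢
    constructor <;> linarith [ha.1, ha.2, hb.1, hb.2]
  have h2 : ∀ c ∈ N, |B x c| ≤ 2 * (ε * M) * ‖x‖ := fun c hc => by
    rw [hBsymm]
    exact abs_le_of_half_net hN (B c) (by positivity) (h1 c hc) x
  have h3 := abs_le_of_half_net hN (B x) (by positivity) h2 x
  rw [hB, real_inner_self_eq_norm_sq, real_inner_self_eq_norm_sq] at h3
  exact h3.trans (le_of_eq (by ring))

/-- If a random matrix nearly preserves the norm of each fixed vector with probability `1 - τ`, it
is nearly isometric on a subspace of dimension `s` with probability `1 - 2 * 25 ^ s * τ`. -/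
theorem measure_not_near_isometry_le {Ω : Type*} [MeasurableSpace Ω] (μ : Measure Ω) {p q : ℕ}
    (A : Ω → Matrix (Fin p) (Fin q) ℝ) {M ε : ℝ} (hM : 0 ≤ M) (hε : 0 ≤ ε) (τ : ENNReal)
    (h : ∀ v : Fin q → ℝ, μ {ω | ¬ |nsq ((A ω).mulVec v) - M * nsq v| ≤ ε * M * nsq v} ≤ τ)
    (S : Submodule ℝ (EuclideanSpace ℝ (Fin q))) :
    μ {ω | ¬ ∀ v : Fin q → ℝ, WithLp.toLp 2 v ∈ S →
      |nsq ((A ω).mulVec v) - M * nsq v| ≤ 4 * ε * M * nsq v} ≤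
      2 * 25 ^ Module.finrank ℝ S * τ := by
  obtain ⟨N, hcard, hN1, hN⟩ := exists_half_net S
  set bad : (Fin q → ℝ) → Set Ω := fun v =>
    {ω | ¬ |nsq ((A ω).mulVec v) - M * nsq v| ≤ ε * M * nsq v} with hbad
  have hsub : {ω | ¬ ∀ v : Fin q → ℝ, WithLp.toLp 2 v ∈ S →
      |nsq ((A ω).mulVec v) - M * nsq v| ≤ 4 * ε * M * nsq v} ⊆
      ⋃ x ∈ N ×ˢ N, (bad ((x.1 : EuclideanSpace ℝ (Fin q)) + x.2).ofLp ∪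
        bad ((x.1 : EuclideanSpace ℝ (Fin q)) - x.2).ofLp) := by
    intro ω hω
    by_contra hcon
    refine hω fun v hv => ?_
    simp only [Set.mem_iUnion, not_exists, Set.mem_union, not_or, hbad, Set.mem_ofPred_eq,
      not_not] at hcon
    have key := near_isometry_of_half_net hN1 hN
      ((Matrix.toEuclideanLin (A ω)).comp S.subtype) hM hε (fun c hc c' hc' => by
        have := hcon (c, c') (Finset.mem_product.2 ⟨hc, hc'⟩)
        simp only [nsq_eq_norm_sq] at this
        exact this) ⟨WithLp.toLp 2 v, hv⟩
    simp only [nsq_eq_norm_sq]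
    exact key
  refine (measure_mono hsub).trans ((measure_biUnion_finset_le _ _).trans ?_)
  have h2 : ∀ x ∈ N ×ˢ N, μ (bad ((x.1 : EuclideanSpace ℝ (Fin q)) + x.2).ofLp ∪
        bad ((x.1 : EuclideanSpace ℝ (Fin q)) - x.2).ofLp) ≤ 2 * τ := fun x _ => by
    rw [two_mul]
    exact (measure_union_le _ _).trans (add_le_add (h _) (h _))
  refine (Finset.sum_le_card_nsmul _ _ _ h2).trans ?_
  rw [Finset.card_product, nsmul_eq_mul, mul_comm 2 (25 ^ _), mul_assoc]
  refine mul_le_mul_left ?_ _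
  have h3 : N.card * N.card ≤ 25 ^ Module.finrank ℝ S := by
    calc N.card * N.card ≤ 5 ^ Module.finrank ℝ S * 5 ^ Module.finrank ℝ S :=
          Nat.mul_le_mul hcard hcard
      _ = 25 ^ Module.finrank ℝ S := by rw [← mul_pow]; norm_num
  exact_mod_cast h3

/-! ### Concentration for products of Gaussian layers -/

theorem exp_half_le_one_add {ε : ℝ} (h0 : 0 ≤ ε) (h1 : ε ≤ 1) : Real.exp (ε / 2) ≤ 1 + ε := by
  refine (Real.exp_bound_div_one_sub_of_interval (by linarith) (by linarith)).trans ?_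
  rw [div_le_iff₀ (by linarith)]; nlinarith

/-- Markov's inequality for the `k`-th power bounds the upper tail and for its inverse the lower
tail, with losses `(1 + ε) ^ (-k)` and `(1 - ε) ^ k`, both at most `exp (-k ε / 2)`. -/
theorem measure_deviation_le {Ω : Type*} [MeasurableSpace Ω] (μ : Measure Ω) {p : ℕ}
    {w : Ω → Fin p → ℝ} (hw : Measurable w) {k : ℕ} {a K ε : ℝ} (ha : 0 < a) (hK : 0 ≤ K)
    (hε0 : 0 ≤ ε) (hε : ε ≤ 1 / 2)
    (hpos : ∫⁻ ω, normPow k p (w ω) ∂μ ≤ ENNReal.ofReal (K * a ^ k))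
    (hneg : ∫⁻ ω, (normPow k p (w ω))⁻¹ ∂μ ≤ ENNReal.ofReal (K * (a ^ k)⁻¹)) :
    μ {ω | ¬ |nsq (w ω) - a| ≤ ε * a} ≤ ENNReal.ofReal (2 * K * Real.exp (-(k * ε / 2))) := by
  have hm := (measurable_normPow k p).comp hw
  have h1ε : 0 < 1 - ε := by linarith
  have hup : μ {ω | (1 + ε) * a ≤ nsq (w ω)} ≤
      ENNReal.ofReal (K * Real.exp (-(k * ε / 2))) := by
    have h1 : {ω | (1 + ε) * a ≤ nsq (w ω)} ⊆
        {ω | ENNReal.ofReal (((1 + ε) * a) ^ k) ≤ normPow k p (w ω)} := fun ω hω => by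
      have hω : (1 + ε) * a ≤ nsq (w ω) := hω
      simp only [Set.mem_ofPred_eq, normPow]
      rw [← ENNReal.ofReal_pow (nsq_nonneg _)]
      exact ENNReal.ofReal_le_ofReal (pow_le_pow_left₀ (by positivity) hω k)
    have h0 : 0 < ((1 + ε) * a) ^ k := by positivity
    refine (measure_mono h1).trans ((meas_ge_le_lintegral_div hm.aemeasurable
      (by simpa using h0) ENNReal.ofReal_ne_top).trans ?_)
    refine (ENNReal.div_le_div_right hpos _).trans ?_
    rw [← ENNReal.ofReal_div_of_pos h0]
    refine ENNReal.ofReal_le_ofReal ?_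
    rw [div_le_iff₀ h0, mul_pow, mul_assoc, ← mul_assoc (Real.exp _)]
    refine mul_le_mul_of_nonneg_left ?_ hK
    refine le_mul_of_one_le_left (by positivity) ?_
    rw [Real.exp_neg, ← div_eq_inv_mul, one_le_div (Real.exp_pos _), mul_div_assoc,
      Real.exp_nat_mul]
    exact pow_le_pow_left₀ (Real.exp_pos _).le (exp_half_le_one_add hε0 (by linarith)) k
  have hlow : μ {ω | nsq (w ω) ≤ (1 - ε) * a} ≤
      ENNReal.ofReal (K * Real.exp (-(k * ε / 2))) := by
    have h0 : 0 < ((1 - ε) * a) ^ k := by positivity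
    have h1 : {ω | nsq (w ω) ≤ (1 - ε) * a} ⊆
        {ω | ENNReal.ofReal ((((1 - ε) * a) ^ k)⁻¹) ≤ (normPow k p (w ω))⁻¹} := fun ω hω => by
      have hω : nsq (w ω) ≤ (1 - ε) * a := hω
      simp only [Set.mem_ofPred_eq, normPow]
      rw [ENNReal.ofReal_inv_of_pos h0, ENNReal.inv_le_inv, ← ENNReal.ofReal_pow (nsq_nonneg _)]
      exact ENNReal.ofReal_le_ofReal (pow_le_pow_left₀ (nsq_nonneg _) hω k)
    refine (measure_mono h1).trans ((meas_ge_le_lintegral_div hm.inv.aemeasurable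
      (by simpa using h0) ENNReal.ofReal_ne_top).trans ?_)
    refine (ENNReal.div_le_div_right hneg _).trans ?_
    rw [← ENNReal.ofReal_div_of_pos (inv_pos.2 h0)]
    refine ENNReal.ofReal_le_ofReal ?_
    have h2 : K * (a ^ k)⁻¹ / (((1 - ε) * a) ^ k)⁻¹ = K * (1 - ε) ^ k := by
      rw [mul_pow]; field_simp
    rw [h2]
    refine mul_le_mul_of_nonneg_left ?_ hK
    rw [mul_div_assoc, ← mul_neg, Real.exp_nat_mul]
    refine pow_le_pow_left₀ h1ε.le ?_ k
    have := Real.add_one_le_exp (-(ε / 2))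
    linarith
  have hsub : {ω | ¬ |nsq (w ω) - a| ≤ ε * a} ⊆
      {ω | (1 + ε) * a ≤ nsq (w ω)} ∪ {ω | nsq (w ω) ≤ (1 - ε) * a} := by
    intro ω hω
    by_contra hcon
    simp only [Set.mem_union, Set.mem_ofPred_eq, not_or, not_le] at hcon
    exact hω (abs_le.2 ⟨by linarith, by linarith⟩)
  refine (measure_mono hsub).trans ((measure_union_le _ _).trans ((add_le_add hup hlow).trans ?_))
  rw [← ENNReal.ofReal_add (by positivity) (by positivity)]
  exact ENNReal.ofReal_le_ofReal (by linarith)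

theorem nsq_eq_zero_iff {p : ℕ} (v : Fin p → ℝ) : nsq v = 0 ↔ v = 0 := by
  rw [nsq_eq_norm_sq, sq_eq_zero_iff, norm_eq_zero, WithLp.toLp_eq_zero]

theorem prod_const_bound {i j L : ℕ} (hj : j ≤ L) {b e : ℝ} (hb : 0 ≤ b)
    (he : 0 ≤ e) : ∏ _k ∈ Finset.Ico i j, ENNReal.ofReal (b * Real.exp e) ≤
      ENNReal.ofReal (Real.exp (L * e) * b ^ (j - i)) := by
  rw [Finset.prod_const, Nat.card_Ico, ← ENNReal.ofReal_pow (by positivity), mul_pow,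
    ← Real.exp_nat_mul, mul_comm]
  refine ENNReal.ofReal_le_ofReal (mul_le_mul_of_nonneg_right (Real.exp_le_exp.2 ?_)
    (by positivity))
  exact mul_le_mul_of_nonneg_right (by exact_mod_cast (Nat.sub_le _ _).trans hj) he

theorem lintegral_normPow_mulVec_gaussMat_le (k : ℕ) {p q : ℕ} (hp : 0 < p) (u : Fin q → ℝ) :
    ∫⁻ Y, normPow k p ((Matrix.of Y).mulVec u) ∂gaussMat p q ≤
      ENNReal.ofReal (∏ j ∈ Finset.range k, ((p : ℝ) + 2 * j)) * normPow k q u := by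
  rw [lintegral_comp_mulVec_gaussMat u (measurable_normPow k p)]
  exact lintegral_normPow_smul k hp _ (nsq_nonneg u)

theorem measure_seg_deviation_le {L m : ℕ} {d : ℕ → ℕ} (hm : 0 < m) {i j : ℕ} (hij : i ≤ j)
    (hj : j ≤ L) (hd : ∀ k, i ≤ k → k < j → d (k + 1) = m) {k : ℕ} (hk : 4 * k ≤ m) {ε : ℝ}
    (hε0 : 0 ≤ ε) (hε : ε ≤ 1 / 2) (v : Fin (d i) → ℝ) :
    initLaw L d {W | ¬ |nsq ((seg (toLayers W) i j).mulVec v) - m ^ (j - i) * nsq v| ≤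
      ε * m ^ (j - i) * nsq v} ≤
      ENNReal.ofReal (2 * Real.exp (L * (4 * k ^ 2 / m)) * Real.exp (-(k * ε / 2))) := by
  have hm' : (0 : ℝ) < m := by exact_mod_cast hm
  -- The zero vector is treated separately: the moment argument needs a positive reference value `m
  -- ^ (j - i) * nsq v`.
  by_cases hv : nsq v = 0
  · have : v = 0 := (nsq_eq_zero_iff v).1 hv
    subst this
    simp [nsq]
  have hv0 : 0 < nsq v := (nsq_nonneg v).lt_of_ne' hv
  simp only [mul_assoc ε]
  refine measure_deviation_le _
    ((continuous_seg hij).matrix_mulVec continuous_const).measurable (by positivity)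
    (by positivity) hε0 hε ?_ ?_
  · refine (lintegral_seg_mulVec_le (normPow k) (measurable_normPow k)
      (fun _ => ENNReal.ofReal (m ^ k * Real.exp (4 * k ^ 2 / m))) hij hj (fun l h1 h2 u => ?_)
      v).trans ?_
    · rw [← hd l h1 h2]
      refine (lintegral_normPow_mulVec_gaussMat_le k (by rw [hd l h1 h2]; exact hm) u).trans ?_
      refine mul_le_mul_left (ENNReal.ofReal_le_ofReal ?_) _
      exact prod_add_le _ k (by rw [hd l h1 h2]; exact hm)
    · refine (mul_le_mul_left (prod_const_bound hj (by positivity) (by positivity)) _).trans ?_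
      rw [normPow, ← ENNReal.ofReal_pow hv0.le, ← ENNReal.ofReal_mul (by positivity)]
      refine ENNReal.ofReal_le_ofReal (le_of_eq ?_)
      ring
  · refine (lintegral_seg_mulVec_le (fun p v => (normPow k p v)⁻¹)
      (fun p => measurable_normPow_inv k p)
      (fun _ => ENNReal.ofReal ((m ^ k : ℝ)⁻¹ * Real.exp (4 * k ^ 2 / m))) hij hj
      (fun l h1 h2 u => ?_) v).trans ?_
    · rw [← hd l h1 h2, lintegral_comp_mulVec_gaussMat u (measurable_normPow_inv k _)]
      refine (lintegral_normPow_inv_smul k (by rw [hd l h1 h2]; omega) _ (nsq_nonneg u)).trans ?_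
      refine mul_le_mul_left (ENNReal.ofReal_le_ofReal ?_) _
      exact prod_inv_sub_le _ k (by rw [hd l h1 h2]; exact hk) (by rw [hd l h1 h2]; exact hm)
    · refine (mul_le_mul_left (prod_const_bound hj (by positivity) (by positivity)) _).trans ?_
      rw [normPow, ← ENNReal.ofReal_pow hv0.le, ← ENNReal.ofReal_inv_of_pos (by positivity),
        ← ENNReal.ofReal_mul (by positivity)]
      refine ENNReal.ofReal_le_ofReal (le_of_eq ?_)
      rw [mul_pow, mul_inv, inv_pow, ← pow_mul, ← pow_mul, mul_comm k]
      ring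

/-- Transposed layers take values in their input dimension. The output layer therefore also
contributes moments in dimension `m`, however small `d L` is. -/
theorem measure_seg_transpose_deviation_le {L m : ℕ} {d : ℕ → ℕ} (hm : 0 < m) {i j : ℕ}
    (hij : i ≤ j) (hj : j ≤ L) (hd : ∀ k, i ≤ k → k < j → d k = m) {k : ℕ} (hk : 4 * k ≤ m)
    {ε : ℝ} (hε0 : 0 ≤ ε) (hε : ε ≤ 1 / 2) (v : Fin (d j) → ℝ) :
    initLaw L d {W | ¬ |nsq ((seg (toLayers W) i j).transpose.mulVec v) - m ^ (j - i) * nsq v| ≤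
      ε * m ^ (j - i) * nsq v} ≤
      ENNReal.ofReal (2 * Real.exp (L * (4 * k ^ 2 / m)) * Real.exp (-(k * ε / 2))) := by
  have hm' : (0 : ℝ) < m := by exact_mod_cast hm
  by_cases hv : nsq v = 0
  · have : v = 0 := (nsq_eq_zero_iff v).1 hv
    subst this
    simp [nsq]
  have hv0 : 0 < nsq v := (nsq_nonneg v).lt_of_ne' hv
  simp only [mul_assoc ε]
  refine measure_deviation_le _
    ((continuous_seg hij).matrix_transpose.matrix_mulVec continuous_const).measurable
    (by positivity) (by positivity) hε0 hε ?_ ?_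
  · refine (lintegral_seg_transpose_mulVec_le (normPow k) (measurable_normPow k)
      (fun _ => ENNReal.ofReal (m ^ k * Real.exp (4 * k ^ 2 / m))) hij hj (fun l h1 h2 u => ?_)
      v).trans ?_
    · rw [← hd l h1 h2, lintegral_comp_transpose_mulVec_gaussMat u (measurable_normPow k _)]
      refine (lintegral_normPow_smul k (by rw [hd l h1 h2]; exact hm) _ (nsq_nonneg u)).trans ?_
      refine mul_le_mul_left (ENNReal.ofReal_le_ofReal ?_) _
      exact prod_add_le _ k (by rw [hd l h1 h2]; exact hm)
    · refine (mul_le_mul_left (prod_const_bound hj (by positivity) (by positivity)) _).trans ?_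
      rw [normPow, ← ENNReal.ofReal_pow hv0.le, ← ENNReal.ofReal_mul (by positivity)]
      refine ENNReal.ofReal_le_ofReal (le_of_eq ?_)
      ring
  · refine (lintegral_seg_transpose_mulVec_le (fun p v => (normPow k p v)⁻¹)
      (fun p => measurable_normPow_inv k p)
      (fun _ => ENNReal.ofReal ((m ^ k : ℝ)⁻¹ * Real.exp (4 * k ^ 2 / m))) hij hj
      (fun l h1 h2 u => ?_) v).trans ?_
    · rw [← hd l h1 h2, lintegral_comp_transpose_mulVec_gaussMat u (measurable_normPow_inv k _)]
      refine (lintegral_normPow_inv_smul k (by rw [hd l h1 h2]; omega) _ (nsq_nonneg u)).trans ?_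
      refine mul_le_mul_left (ENNReal.ofReal_le_ofReal ?_) _
      exact prod_inv_sub_le _ k (by rw [hd l h1 h2]; exact hk) (by rw [hd l h1 h2]; exact hm)
    · refine (mul_le_mul_left (prod_const_bound hj (by positivity) (by positivity)) _).trans ?_
      rw [normPow, ← ENNReal.ofReal_pow hv0.le, ← ENNReal.ofReal_inv_of_pos (by positivity),
        ← ENNReal.ofReal_mul (by positivity)]
      refine ENNReal.ofReal_le_ofReal (le_of_eq ?_)
      rw [mul_pow, mul_inv, inv_pow, ← pow_mul, ← pow_mul, mul_comm k]
      ring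

/-! ### Random initializations are well-conditioned -/

/-- The exponent `m / (819200 L)` governing the failure probabilities at initialization. -/
noncomputable def initRate (L m : ℕ) : ℝ := m / (819200 * L)

/-- The order `k = ⌊m / (1280 L)⌋` makes the moment growth `4 L k² / m` at most `k / 320`, half of
the gain `k / 160` from Markov. Rounding down loses another factor two, and `1280 · 640 = 819200`.
-/
theorem exists_moment_order {L m : ℕ} (hL : 1 ≤ L) (h : 1 ≤ initRate L m) :
    ∃ k : ℕ, 4 * k ≤ m ∧ Real.exp (L * (4 * k ^ 2 / m)) * Real.exp (-(k * (1 / 80) / 2)) ≤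
      Real.exp (-initRate L m) := by
  have hL' : (1 : ℝ) ≤ L := by exact_mod_cast hL
  unfold initRate at *
  rw [le_div_iff₀ (by positivity)] at h
  have hm : (0 : ℝ) < m := by nlinarith
  set y : ℝ := m / (1280 * L) with hy
  have hy1 : 1 ≤ y := by rw [hy, le_div_iff₀ (by positivity)]; nlinarith
  set k := ⌊y⌋₊ with hk
  have hky : (k : ℝ) ≤ y := Nat.floor_le (by linarith)
  have hky' : y / 2 ≤ k := by
    have h1 := Nat.lt_floor_add_one y
    have h2 : (1 : ℝ) ≤ k := by exact_mod_cast (Nat.one_le_floor_iff y).2 hy1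
    linarith
  refine ⟨k, ?_, ?_⟩
  · have : 4 * (k : ℝ) ≤ m := by
      have h1 : y ≤ m / 1280 := by
        rw [hy]; exact div_le_div_of_nonneg_left hm.le (by norm_num) (by linarith)
      linarith
    exact_mod_cast this
  · rw [← Real.exp_add, Real.exp_le_exp]
    have h1 : (L : ℝ) * (4 * k ^ 2 / m) ≤ k / 320 := by
      rw [mul_div_assoc', div_le_iff₀ hm]
      have h2 : (k : ℝ) * (1280 * L) ≤ m := by
        rwa [hy, le_div_iff₀ (by positivity)] at hky
      have h3 : (0 : ℝ) ≤ k := Nat.cast_nonneg k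
      nlinarith
    have h2 : (m : ℝ) / (819200 * L) = y / 640 := by rw [hy]; field_simp; norm_num
    rw [h2]; linarith

/-- The net factor satisfies `25 ^ s ≤ exp (4 s) ≤ exp (b / 2)`, so a dimension of at most `b / 8`
consumes half of the exponent. -/
theorem four_exp_bound {s : ℕ} {b : ℝ} (h : 8 * (s : ℝ) ≤ b) :
    2 * 25 ^ s * (2 * Real.exp (-b)) ≤ 4 * Real.exp (-b / 2) := by
  have h1 : (25 : ℝ) ≤ Real.exp 4 := by
    have h2 : Real.exp 4 = Real.exp 1 ^ 4 := by rw [← Real.exp_nat_mul]; norm_num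
    have h3 := Real.exp_one_gt_d9
    rw [h2]
    calc (25 : ℝ) ≤ 2.7 ^ 4 := by norm_num
      _ ≤ Real.exp 1 ^ 4 := pow_le_pow_left₀ (by norm_num) (by linarith) 4
  have h2 : (25 : ℝ) ^ s ≤ Real.exp (b / 2) := by
    refine (pow_le_pow_left₀ (by norm_num) h1 s).trans ?_
    rw [← Real.exp_nat_mul, Real.exp_le_exp]; linarith
  have h3 : Real.exp (-b / 2) = Real.exp (b / 2) * Real.exp (-b) := by
    rw [← Real.exp_add]; congr 1; ring
  rw [h3]
  have := mul_le_mul_of_nonneg_right h2 (Real.exp_pos (-b)).le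
  linarith

theorem ofReal_subspace_bound {s : ℕ} {b t : ℝ} (h : 8 * (s : ℝ) ≤ b) (ht : t ≤ Real.exp (-b)) :
    2 * (25 : ENNReal) ^ s * ENNReal.ofReal (2 * t) ≤ ENNReal.ofReal (4 * Real.exp (-b / 2)) := by
  have h1 : (2 : ENNReal) * 25 ^ s = ENNReal.ofReal (2 * 25 ^ s) := by
    rw [ENNReal.ofReal_mul (by norm_num), ENNReal.ofReal_pow (by norm_num)]; norm_num
  rw [h1, ← ENNReal.ofReal_mul (by positivity)]
  refine ENNReal.ofReal_le_ofReal (le_trans ?_ (four_exp_bound h))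
  gcongr

/-- Matrices acting nearly isometrically, up to the factor `√M`, on a subspace. -/
def NearIsometryOn {p q : ℕ} (M : ℝ) (S : Submodule ℝ (EuclideanSpace ℝ (Fin q)))
    (A : Matrix (Fin p) (Fin q) ℝ) : Prop :=
  ∀ v : Fin q → ℝ, WithLp.toLp 2 v ∈ S →
    |nsq (A.mulVec v) - M * nsq v| ≤ 4 * (1 / 80) * M * nsq v

theorem measure_seg_not_nearIsometryOn_le {L m : ℕ} {d : ℕ → ℕ} (hL : 1 ≤ L) (hm : 0 < m)
    (hrate : 1 ≤ initRate L m) {i j : ℕ} (hij : i ≤ j) (hj : j ≤ L)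
    (hd : ∀ k, i ≤ k → k < j → d (k + 1) = m) (S : Submodule ℝ (EuclideanSpace ℝ (Fin (d i))))
    (hS : 8 * (Module.finrank ℝ S : ℝ) ≤ initRate L m) :
    initLaw L d {W | ¬ NearIsometryOn ((m : ℝ) ^ (j - i)) S (seg (toLayers W) i j)} ≤
      ENNReal.ofReal (4 * Real.exp (-initRate L m / 2)) := by
  obtain ⟨k, hk, hexp⟩ := exists_moment_order hL hrate
  refine (measure_not_near_isometry_le (initLaw L d) (fun W => seg (toLayers W) i j)
    (M := (m : ℝ) ^ (j - i)) (ε := 1 / 80) (by positivity) (by norm_num) _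
    (measure_seg_deviation_le hm hij hj hd hk (by norm_num) (by norm_num)) S).trans ?_
  rw [mul_assoc 2 (Real.exp _)]
  exact ofReal_subspace_bound hS hexp

theorem measure_seg_transpose_not_nearIsometryOn_le {L m : ℕ} {d : ℕ → ℕ} (hL : 1 ≤ L)
    (hm : 0 < m) (hrate : 1 ≤ initRate L m) {i j : ℕ} (hij : i ≤ j) (hj : j ≤ L)
    (hd : ∀ k, i ≤ k → k < j → d k = m) (S : Submodule ℝ (EuclideanSpace ℝ (Fin (d j))))
    (hS : 8 * (Module.finrank ℝ S : ℝ) ≤ initRate L m) :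
    initLaw L d {W | ¬ NearIsometryOn ((m : ℝ) ^ (j - i)) S (seg (toLayers W) i j).transpose} ≤
      ENNReal.ofReal (4 * Real.exp (-initRate L m / 2)) := by
  obtain ⟨k, hk, hexp⟩ := exists_moment_order hL hrate
  refine (measure_not_near_isometry_le (initLaw L d) (fun W => (seg (toLayers W) i j).transpose)
    (M := (m : ℝ) ^ (j - i)) (ε := 1 / 80) (by positivity) (by norm_num) _
    (measure_seg_transpose_deviation_le hm hij hj hd hk (by norm_num) (by norm_num)) S).trans ?_
  rw [mul_assoc 2 (Real.exp _)]
  exact ofReal_subspace_bound hS hexp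

theorem frobNorm_mul_le_of_nsq_col {p q s : ℕ} (A : Matrix (Fin p) (Fin q) ℝ)
    (Z : Matrix (Fin q) (Fin s) ℝ) {c : ℝ} (hc : 0 ≤ c)
    (h : ∀ j, nsq (A.mulVec fun i => Z i j) ≤ c ^ 2 * nsq fun i => Z i j) :
    frobNorm (A * Z) ≤ c * frobNorm Z := by
  refine le_of_sq_le_sq ?_ (mul_nonneg hc (frobNorm_nonneg _))
  rw [mul_pow, frobNorm_sq_eq_sum_nsq, frobNorm_sq_eq_sum_nsq, Finset.mul_sum]
  exact Finset.sum_le_sum fun j _ => by rw [mul_col]; exact h j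

theorem le_frobNorm_mul_of_nsq_col {p q s : ℕ} (A : Matrix (Fin p) (Fin q) ℝ)
    (Z : Matrix (Fin q) (Fin s) ℝ) {c : ℝ}
    (h : ∀ j, (c ^ 2 * nsq fun i => Z i j) ≤ nsq (A.mulVec fun i => Z i j)) :
    c * frobNorm Z ≤ frobNorm (A * Z) := by
  refine le_of_sq_le_sq ?_ (frobNorm_nonneg _)
  rw [mul_pow, frobNorm_sq_eq_sum_nsq, frobNorm_sq_eq_sum_nsq, Finset.mul_sum]
  exact Finset.sum_le_sum fun j _ => by rw [mul_col]; exact h j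

theorem NearIsometryOn.frobNorm_bounds {p q s k : ℕ} {m : ℝ} (hm : 0 ≤ m)
    {S : Submodule ℝ (EuclideanSpace ℝ (Fin q))} {A : Matrix (Fin p) (Fin q) ℝ}
    (hA : NearIsometryOn (m ^ k) S A) (Z : Matrix (Fin q) (Fin s) ℝ)
    (hZ : ∀ j, (WithLp.toLp 2 fun i => Z i j) ∈ S) :
    (1 - 1 / 20) * √m ^ k * frobNorm Z ≤ frobNorm (A * Z) ∧
      frobNorm (A * Z) ≤ (1 + 1 / 20) * √m ^ k * frobNorm Z := by
  have hsq : (√m ^ k) ^ 2 = m ^ k := by rw [← pow_mul, mul_comm, pow_mul, Real.sq_sqrt hm]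
  have hmk : 0 ≤ m ^ k := pow_nonneg hm k
  constructor
  · refine le_frobNorm_mul_of_nsq_col A Z fun j => ?_
    rw [mul_pow, hsq]
    have h := (abs_le.1 (hA _ (hZ j))).1
    have h0 := mul_nonneg hmk (nsq_nonneg fun i => Z i j)
    linarith
  · refine frobNorm_mul_le_of_nsq_col A Z (by positivity) fun j => ?_
    rw [mul_pow, hsq]
    have h := (abs_le.1 (hA _ (hZ j))).2
    have h0 := mul_nonneg hmk (nsq_nonneg fun i => Z i j)
    linarith

/-! ### Blocks of coordinates -/

/-- The vectors supported on the `c`-th block of `s` consecutive coordinates. -/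
def blockSpace (q s c : ℕ) : Submodule ℝ (EuclideanSpace ℝ (Fin q)) :=
  Submodule.span ℝ (((Finset.univ.filter fun b : Fin q => (b : ℕ) / s = c).image
    fun b => EuclideanSpace.single b (1 : ℝ) : Finset (EuclideanSpace ℝ (Fin q))) : Set _)

theorem finrank_blockSpace_le (q s c : ℕ) (hs : 0 < s) :
    Module.finrank ℝ (blockSpace q s c) ≤ s := by
  refine (finrank_span_finset_le_card _).trans (Finset.card_image_le.trans ?_)
  have h : ((Finset.univ.filter fun b : Fin q => (b : ℕ) / s = c).image Fin.val) ⊆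
      Finset.Ico (c * s) (c * s + s) := by
    intro x hx
    obtain ⟨b, hb, rfl⟩ := Finset.mem_image.1 hx
    have hb := (Finset.mem_filter.1 hb).2
    rw [Finset.mem_Ico]
    rw [Nat.div_eq_iff hs] at hb
    omega
  have := Finset.card_le_card h
  rwa [Finset.card_image_of_injective _ Fin.val_injective, Nat.card_Ico,
    Nat.add_sub_cancel_left] at this

/-- The restriction of a vector to a block of coordinates. -/
def blockPart {q : ℕ} (s c : ℕ) (v : Fin q → ℝ) : Fin q → ℝ :=
  fun b => if (b : ℕ) / s = c then v b else 0

theorem blockPart_mem {q : ℕ} (s c : ℕ) (v : Fin q → ℝ) :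
    (WithLp.toLp 2 (blockPart s c v)) ∈ blockSpace q s c := by
  have h : (WithLp.toLp 2 (blockPart s c v) : EuclideanSpace ℝ (Fin q)) =
      ∑ b ∈ Finset.univ.filter fun b : Fin q => (b : ℕ) / s = c,
        v b • EuclideanSpace.single b (1 : ℝ) := by
    ext a
    simp [blockPart, Finset.sum_apply, Pi.single_apply, Finset.sum_ite_eq, Finset.mem_filter]
  rw [h]
  refine Submodule.sum_mem _ fun b hb => Submodule.smul_mem _ _ (Submodule.subset_span ?_)
  exact Finset.mem_coe.2 (Finset.mem_image_of_mem _ hb)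

theorem sum_blockPart {q : ℕ} (s : ℕ) (v : Fin q → ℝ) :
    ∑ c ∈ Finset.range (q / s + 1), blockPart s c v = v := by
  ext b
  rw [Finset.sum_apply]
  simp only [blockPart]
  rw [Finset.sum_ite_eq, if_pos]
  exact Finset.mem_range.2 (Nat.lt_succ_of_le (Nat.div_le_div_right b.2.le))

theorem sum_nsq_blockPart {q : ℕ} (s : ℕ) (v : Fin q → ℝ) :
    ∑ c ∈ Finset.range (q / s + 1), nsq (blockPart s c v) = nsq v := by
  unfold nsq
  rw [Finset.sum_comm]
  refine Finset.sum_congr rfl fun b _ => ?_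
  simp only [blockPart, ite_pow, ne_eq, OfNat.ofNat_ne_zero, not_false_eq_true, zero_pow]
  rw [Finset.sum_ite_eq, if_pos]
  exact Finset.mem_range.2 (Nat.lt_succ_of_le (Nat.div_le_div_right b.2.le))

theorem nsq_sum_le {p : ℕ} {ι : Type*} (s : Finset ι) (f : ι → Fin p → ℝ) :
    nsq (∑ c ∈ s, f c) ≤ s.card * ∑ c ∈ s, nsq (f c) := by
  unfold nsq
  rw [Finset.sum_comm, Finset.mul_sum]
  refine Finset.sum_le_sum fun i _ => ?_
  rw [Finset.sum_apply]
  exact sq_sum_le_card_mul_sum_sq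

/-- Near-isometry on each block of coordinates controls the norm of the whole matrix. -/
theorem specNorm_le_of_blocks {p q s k : ℕ} {m N : ℝ} (hm : 0 ≤ m)
    {A : Matrix (Fin p) (Fin q) ℝ} (hN0 : 0 ≤ N) (hN : 21 / 20 * ((q / s + 1 : ℕ) : ℝ) ≤ N ^ 2)
    (h : ∀ c < q / s + 1, NearIsometryOn (m ^ k) (blockSpace q s c) A) :
    specNorm A ≤ N * √m ^ k := by
  have hsq : (√m ^ k) ^ 2 = m ^ k := by rw [← pow_mul, mul_comm, pow_mul, Real.sq_sqrt hm]
  have hmk : 0 ≤ m ^ k := pow_nonneg hm k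
  refine specNorm_le_of_nsq A _ (by positivity) fun v => ?_
  rw [mul_pow, hsq]
  have h1 : A.mulVec v = ∑ c ∈ Finset.range (q / s + 1), A.mulVec (blockPart s c v) := by
    rw [← Matrix.mulVec_sum, sum_blockPart]
  rw [h1]
  refine (nsq_sum_le _ _).trans ?_
  rw [Finset.card_range]
  have h2 : ∑ c ∈ Finset.range (q / s + 1), nsq (A.mulVec (blockPart s c v)) ≤
      21 / 20 * m ^ k * nsq v := by
    rw [← sum_nsq_blockPart s v, Finset.mul_sum]
    refine Finset.sum_le_sum fun c hc => ?_
    have h3 := (abs_le.1 (h c (Finset.mem_range.1 hc) _ (blockPart_mem s c v))).2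
    linarith
  calc ((q / s + 1 : ℕ) : ℝ) * ∑ c ∈ Finset.range (q / s + 1), nsq (A.mulVec (blockPart s c v))
      ≤ ((q / s + 1 : ℕ) : ℝ) * (21 / 20 * m ^ k * nsq v) := by gcongr
    _ = (21 / 20 * ((q / s + 1 : ℕ) : ℝ)) * (m ^ k * nsq v) := by ring
    _ ≤ N ^ 2 * (m ^ k * nsq v) :=
        mul_le_mul_of_nonneg_right hN (mul_nonneg hmk (nsq_nonneg v))
    _ = N ^ 2 * m ^ k * nsq v := by ring

/-- The column space of a matrix as a subspace of Euclidean space. -/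
noncomputable def colSpace {p n : ℕ} (X : Matrix (Fin p) (Fin n) ℝ) :
    Submodule ℝ (EuclideanSpace ℝ (Fin p)) :=
  (LinearMap.range X.mulVecLin).map (WithLp.linearEquiv 2 ℝ (Fin p → ℝ)).symm.toLinearMap

theorem finrank_colSpace_le {p n : ℕ} (X : Matrix (Fin p) (Fin n) ℝ) :
    Module.finrank ℝ (colSpace X) ≤ X.rank := Submodule.finrank_map_le _ _

theorem mem_colSpace {p n : ℕ} (X : Matrix (Fin p) (Fin n) ℝ) (e : Fin n → ℝ) :
    WithLp.toLp 2 (X.mulVec e) ∈ colSpace X :=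
  Submodule.mem_map_of_mem (LinearMap.mem_range_self X.mulVecLin e)

/-- The block length is the largest dimension the net argument allows. Rounding down at most halves
it, so there are at most about `2 · 8 · 819200 L` blocks, plus one for the remainder. -/
theorem block_count_le {L m : ℕ} (hL : 1 ≤ L) (hrate : 8 ≤ initRate L m) :
    0 < ⌊initRate L m / 8⌋₊ ∧ 8 * ((⌊initRate L m / 8⌋₊ : ℕ) : ℝ) ≤ initRate L m ∧
      ((m / ⌊initRate L m / 8⌋₊ + 1 : ℕ) : ℝ) ≤ 13107201 * L := by
  have hL' : (1 : ℝ) ≤ L := by exact_mod_cast hL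
  set y := initRate L m / 8 with hy
  have hy1 : 1 ≤ y := by linarith
  have h0 : 0 < ⌊y⌋₊ := Nat.floor_pos.2 hy1
  have h0' : (1 : ℝ) ≤ ⌊y⌋₊ := by exact_mod_cast h0
  have h1 : (⌊y⌋₊ : ℝ) ≤ y := Nat.floor_le (by linarith)
  have h2 := Nat.lt_floor_add_one y
  refine ⟨h0, by linarith, ?_⟩
  have h3 : ((m / ⌊y⌋₊ : ℕ) : ℝ) ≤ m / (⌊y⌋₊ : ℝ) := Nat.cast_div_le
  have hm : (m : ℝ) = 8 * y * (819200 * L) := by rw [hy, initRate]; field_simp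
  have h4 : (m : ℝ) / (⌊y⌋₊ : ℝ) ≤ 13107200 * L := by
    rw [div_le_iff₀ (by linarith), hm]
    nlinarith
  push_cast
  linarith

/-- Three families of near-isometry events suffice: products from the input on the column space of
`X`, transposed products to the output on the whole output space, and interior products on each
coordinate block. Interior products cannot be nearly isometric on all of the width at this
probability, which is why only a norm bound is claimed for them. -/
theorem measure_not_wellConditioned_le {L m n : ℕ} {d : ℕ → ℕ} (hL : 1 ≤ L) (hm : 0 < m)
    (hd : ∀ i, 0 < i → i < L → d i = m) (X : Matrix (Fin (d 0)) (Fin n) ℝ)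
    (hrate : 8 ≤ initRate L m) (hX : 8 * (X.rank : ℝ) ≤ initRate L m)
    (hout : 8 * (d L : ℝ) ≤ initRate L m) :
    initLaw L d {W | ¬ WellConditioned L √m (1 / 20) (6000 * √L) X (toLayers W)} ≤
      ENNReal.ofReal (10 ^ 8 * L ^ 3 * Real.exp (-initRate L m / 2)) := by
  classical
  have hL' : (1 : ℝ) ≤ L := by exact_mod_cast hL
  have hm' : (0 : ℝ) ≤ m := Nat.cast_nonneg m
  obtain ⟨hs0, hs8, hcount⟩ := block_count_le hL hrate
  set s := ⌊initRate L m / 8⌋₊ with hs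
  set τ := ENNReal.ofReal (4 * Real.exp (-initRate L m / 2)) with hτ
  set pairs := (Finset.range L ×ˢ Finset.range L).filter fun x => 1 ≤ x.1 ∧ x.1 ≤ x.2 with hpairs
  set E1 : Set (Weights L d) := ⋃ j ∈ Finset.range L,
    {W | ¬ NearIsometryOn ((m : ℝ) ^ (j - 0)) (colSpace X) (seg (toLayers W) 0 j)} with hE1
  set E2 : Set (Weights L d) := ⋃ i ∈ Finset.Icc 1 L,
    {W | ¬ NearIsometryOn ((m : ℝ) ^ (L - i)) ⊤ (seg (toLayers W) i L).transpose} with hE2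
  set E3 : Set (Weights L d) := ⋃ x ∈ pairs ×ˢ Finset.range (m / s + 1),
    {W | ¬ NearIsometryOn ((m : ℝ) ^ (x.1.2 - x.1.1)) (blockSpace (d x.1.1) s x.2)
      (seg (toLayers W) x.1.1 x.1.2)} with hE3
  have h1 : initLaw L d E1 ≤ L * τ := by
    refine (measure_biUnion_finset_le _ _).trans ((Finset.sum_le_card_nsmul _ _ τ
      fun j hj => ?_).trans_eq (by rw [Finset.card_range, nsmul_eq_mul]))
    have hj := Finset.mem_range.1 hj
    refine measure_seg_not_nearIsometryOn_le hL hm (by linarith) (Nat.zero_le j) hj.le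
      (fun k _ hk => hd _ (Nat.succ_pos k) (by omega)) _ (le_trans ?_ hX)
    have := finrank_colSpace_le X
    have : (Module.finrank ℝ (colSpace X) : ℝ) ≤ X.rank := by exact_mod_cast this
    linarith
  have h2 : initLaw L d E2 ≤ L * τ := by
    refine (measure_biUnion_finset_le _ _).trans ((Finset.sum_le_card_nsmul _ _ τ
      fun i hi => ?_).trans_eq (by rw [Nat.card_Icc, nsmul_eq_mul, Nat.add_sub_cancel]))
    have hi := Finset.mem_Icc.1 hi
    refine measure_seg_transpose_not_nearIsometryOn_le hL hm (by linarith) hi.2 le_rfl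
      (fun k h1 h2 => hd _ (by omega) h2) _ (le_trans (le_of_eq ?_) hout)
    rw [finrank_top, finrank_euclideanSpace_fin]
  have h3 : initLaw L d E3 ≤ ((L ^ 2 * (m / s + 1) : ℕ) : ENNReal) * τ := by
    refine (measure_biUnion_finset_le _ _).trans ((Finset.sum_le_card_nsmul _ _ τ
      fun x hx => ?_).trans ?_)
    · obtain ⟨hx1, -⟩ := Finset.mem_product.1 hx
      obtain ⟨hx2, h1i, hij⟩ := Finset.mem_filter.1 hx1
      obtain ⟨hi, hj⟩ := Finset.mem_product.1 hx2
      have hj := Finset.mem_range.1 hj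
      refine measure_seg_not_nearIsometryOn_le hL hm (by linarith) hij hj.le
        (fun k _ hk => hd _ (Nat.succ_pos k) (by omega)) _ (le_trans ?_ hs8)
      have := finrank_blockSpace_le (d x.1.1) s x.2 hs0
      have : (Module.finrank ℝ (blockSpace (d x.1.1) s x.2) : ℝ) ≤ s := by exact_mod_cast this
      linarith
    · rw [nsmul_eq_mul]
      refine mul_le_mul_left ?_ _
      rw [Finset.card_product, Finset.card_range]
      have : pairs.card ≤ L ^ 2 := by
        refine (Finset.card_filter_le _ _).trans (le_of_eq ?_)
        rw [Finset.card_product, Finset.card_range, sq]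
      exact_mod_cast Nat.mul_le_mul_right _ this
  have hsub : {W : Weights L d | ¬ WellConditioned L √m (1 / 20) (6000 * √L) X (toLayers W)} ⊆
      E1 ∪ E2 ∪ E3 := by
    intro W hW
    by_contra hcon
    simp only [Set.mem_union, not_or] at hcon
    obtain ⟨⟨hc1, hc2⟩, hc3⟩ := hcon
    simp only [hE1, hE2, hE3, Set.mem_iUnion, not_exists, Set.mem_ofPred_eq, not_not] at hc1 hc2 hc3
    have hbot : ∀ j < L, ∀ q, ∀ Z : Matrix (Fin n) (Fin q) ℝ, _ := fun j hj q Z =>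
      (hc1 j (Finset.mem_range.2 hj)).frobNorm_bounds hm' (X * Z) fun l => by
        rw [mul_col]; exact mem_colSpace X _
    have htop : ∀ i, 1 ≤ i → i ≤ L → ∀ q, ∀ Z : Matrix (Fin (d L)) (Fin q) ℝ, _ :=
      fun i h1 h2 q Z => (hc2 i (Finset.mem_Icc.2 ⟨h1, h2⟩)).frobNorm_bounds hm' Z
        fun l => Submodule.mem_top
    refine hW ⟨fun j hj q Z => (hbot j hj q Z).1, fun j hj q Z => (hbot j hj q Z).2,
      fun i h1 h2 q Z => (htop i h1 h2 q Z).1, fun i h1 h2 => ?_, fun i j h1 h2 h3 => ?_⟩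
    · rw [← specNorm_transpose]
      exact specNorm_le_of_frobNorm _ _ (by positivity) fun Z => (htop i h1 h2 1 Z).2
    · refine specNorm_le_of_blocks (s := s) hm' (by positivity) ?_ fun c hc => ?_
      -- The constant comes from `21 / 20 · 13107201 ≤ 6000²`.
      · rw [hd i (by omega) (by omega), mul_pow, Real.sq_sqrt (by linarith)]
        linarith
      · rw [hd i (by omega) (by omega)] at hc
        exact hc3 ((i, j), c) (Finset.mem_product.2 ⟨Finset.mem_filter.2 ⟨Finset.mem_product.2
          ⟨Finset.mem_range.2 (by simp only; omega), Finset.mem_range.2 h3⟩, h1, h2⟩,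
          Finset.mem_range.2 hc⟩)
  refine (measure_mono hsub).trans ((measure_union_le _ _).trans
    ((add_le_add ((measure_union_le _ _).trans (add_le_add h1 h2)) h3).trans ?_))
  rw [← add_mul, ← add_mul]
  have hnat : ((L : ENNReal) + L + ((L ^ 2 * (m / s + 1) : ℕ) : ENNReal)) =
      ENNReal.ofReal (((L + L + L ^ 2 * (m / s + 1) : ℕ) : ℝ)) := by
    rw [ENNReal.ofReal_natCast]; push_cast; ring
  rw [hnat, hτ, ← ENNReal.ofReal_mul (by positivity)]
  refine ENNReal.ofReal_le_ofReal ?_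
  have h5 : ((L + L + L ^ 2 * (m / s + 1) : ℕ) : ℝ) ≤ 2 * 10 ^ 7 * L ^ 3 := by
    rw [Nat.cast_add, Nat.cast_add, Nat.cast_mul, Nat.cast_pow]
    have h6 : (L : ℝ) ^ 2 * ((m / s + 1 : ℕ) : ℝ) ≤ L ^ 2 * (13107201 * L) := by gcongr
    have h7 : (L : ℝ) ≤ L ^ 3 := le_self_pow₀ hL' (by norm_num)
    nlinarith
  calc ((L + L + L ^ 2 * (m / s + 1) : ℕ) : ℝ) * (4 * Real.exp (-initRate L m / 2))
      ≤ 2 * 10 ^ 7 * L ^ 3 * (4 * Real.exp (-initRate L m / 2)) :=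
        mul_le_mul_of_nonneg_right h5 (by positivity)
    _ = 8 * 10 ^ 7 * (L ^ 3 * Real.exp (-initRate L m / 2)) := by ring
    _ ≤ 10 ^ 8 * (L ^ 3 * Real.exp (-initRate L m / 2)) :=
        mul_le_mul_of_nonneg_right (by norm_num) (by positivity)
    _ = _ := by ring

/-! ### The output of a random network -/

/-- The output layer has only `d L` rows, so its moment factor is kept as `(d L + 2 k) ^ k`. The
hidden layers together cost `exp (4 L k² / m) ≤ exp k`. -/
theorem lintegral_seg_output_le {L m : ℕ} {d : ℕ → ℕ} (hL : 1 ≤ L) (hm : 0 < m)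
    (hout : 0 < d L) (hd : ∀ i, 0 < i → i < L → d i = m) {k : ℕ} (hk : 4 * L * k ≤ m)
    (v : Fin (d 0) → ℝ) :
    ∫⁻ W, normPow k _ ((seg (toLayers W) 0 L).mulVec v) ∂initLaw L d ≤
      ENNReal.ofReal ((m ^ (L - 1) * Real.exp 1 * (d L + 2 * k)) ^ k * nsq v ^ k) := by
  have hm' : (0 : ℝ) < m := by exact_mod_cast hm
  obtain ⟨L, rfl⟩ : ∃ l, L = l + 1 := ⟨L - 1, by omega⟩
  set c : ℕ → ENNReal := fun l => if l < L then ENNReal.ofReal (m ^ k * Real.exp (4 * k ^ 2 / m))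
    else ENNReal.ofReal ((d (L + 1) + 2 * k) ^ k) with hc
  refine (lintegral_seg_mulVec_le (normPow k) (measurable_normPow k) c (Nat.zero_le _) le_rfl
    (fun l _ hl u => ?_) v).trans ?_
  · by_cases hlL : l < L
    · have hdl : d (l + 1) = m := hd _ (Nat.succ_pos l) (by omega)
      refine (lintegral_normPow_mulVec_gaussMat_le k (by rw [hdl]; exact hm) u).trans ?_
      refine mul_le_mul_left ?_ _
      rw [hc]; simp only [hlL, if_true]
      rw [hdl]
      exact ENNReal.ofReal_le_ofReal (prod_add_le _ k hm)
    · obtain rfl : l = L := by omega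
      refine (lintegral_normPow_mulVec_gaussMat_le k hout u).trans ?_
      refine mul_le_mul_left ?_ _
      rw [hc]; simp only [lt_irrefl, if_false]
      refine ENNReal.ofReal_le_ofReal ?_
      have h : ∏ j ∈ Finset.range k, ((d (l + 1) : ℝ) + 2 * j) ≤
          ∏ _j ∈ Finset.range k, ((d (l + 1) : ℝ) + 2 * k) := by
        refine Finset.prod_le_prod (fun j _ => by positivity) fun j hj => ?_
        have : (j : ℝ) ≤ k := by exact_mod_cast (Finset.mem_range.1 hj).le
        linarith
      rwa [Finset.prod_const, Finset.card_range] at h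
  · rw [Finset.prod_Ico_succ_top (Nat.zero_le L)]
    have h1 : ∏ l ∈ Finset.Ico 0 L, c l =
        ∏ _l ∈ Finset.Ico 0 L, ENNReal.ofReal (m ^ k * Real.exp (4 * k ^ 2 / m)) :=
      Finset.prod_congr rfl fun l hl => by rw [hc]; simp only [(Finset.mem_Ico.1 hl).2, if_true]
    have h2 : c L = ENNReal.ofReal ((d (L + 1) + 2 * k) ^ k) := by
      rw [hc]; simp only [lt_irrefl, if_false]
    rw [h1, h2]
    refine (mul_le_mul_left (mul_le_mul_left (prod_const_bound (le_refl L) (by positivity)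
      (by positivity)) _) _).trans ?_
    rw [normPow, ← ENNReal.ofReal_pow (nsq_nonneg v), ← ENNReal.ofReal_mul (by positivity),
      ← ENNReal.ofReal_mul (by positivity)]
    refine ENNReal.ofReal_le_ofReal (mul_le_mul_of_nonneg_right ?_ (pow_nonneg (nsq_nonneg v) k))
    rw [mul_pow, mul_pow, Nat.add_sub_cancel]
    refine mul_le_mul_of_nonneg_right ?_ (by positivity)
    rw [Nat.sub_zero, mul_comm, ← pow_mul, ← pow_mul, mul_comm k L, ← Real.exp_nat_mul]
    refine mul_le_mul_of_nonneg_left (Real.exp_le_exp.2 ?_) (by positivity)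
    rw [mul_div_assoc', div_le_iff₀ hm', mul_one]
    have h3 : 4 * ((L : ℝ) + 1) * k ≤ m := by exact_mod_cast hk
    have h4 : (0 : ℝ) ≤ k := Nat.cast_nonneg k
    nlinarith

/-- Convexity: the `k`-th power of a squared Frobenius norm in terms of the columns. -/
theorem frobNorm_sq_pow_le {p q n k : ℕ} (A : Matrix (Fin p) (Fin q) ℝ)
    (X : Matrix (Fin q) (Fin n) ℝ) (hX : 0 < frobNorm X ^ 2) :
    (frobNorm (A * X) ^ 2) ^ k ≤ ∑ j, (nsq (fun i => X i j) / frobNorm X ^ 2 *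
      (frobNorm X ^ 2 / nsq (fun i => X i j)) ^ k) * nsq (A.mulVec fun i => X i j) ^ k := by
  set T := frobNorm X ^ 2 with hT
  -- Jensen with each column weighted by its share of `‖X‖_F²`. Zero columns have weight zero, and
  -- division by zero is harmless there.
  have hjensen := Real.pow_arith_mean_le_arith_mean_pow Finset.univ
    (fun j => nsq (fun i => X i j) / T)
    (fun j => T / nsq (fun i => X i j) * nsq (A.mulVec fun i => X i j))
    (fun j _ => div_nonneg (nsq_nonneg _) hX.le)
    (by rw [← Finset.sum_div, ← frobNorm_sq_eq_sum_nsq, div_self hX.ne'])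
    (fun j _ => mul_nonneg (div_nonneg hX.le (nsq_nonneg _)) (nsq_nonneg _)) k
  have h1 : frobNorm (A * X) ^ 2 = ∑ j, nsq (fun i => X i j) / T *
      (T / nsq (fun i => X i j) * nsq (A.mulVec fun i => X i j)) := by
    rw [frobNorm_sq_eq_sum_nsq]
    refine Finset.sum_congr rfl fun j _ => ?_
    rw [mul_col]
    by_cases h : nsq (fun i => X i j) = 0
    · rw [(nsq_eq_zero_iff _).1 h, Matrix.mulVec_zero, (nsq_eq_zero_iff _).2 rfl]; simp
    · field_simp
  rw [h1]
  refine hjensen.trans (le_of_eq (Finset.sum_congr rfl fun j _ => ?_))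
  rw [mul_pow]; ring

/-- Markov for the `k`-th power at `e` times the moment bound gives `exp (-k)`. Convexity in the
columns avoids a union bound over the `n` data points. -/
theorem measure_output_ge_le {L m n : ℕ} {d : ℕ → ℕ} (hL : 1 ≤ L) (hm : 0 < m)
    (hout : 0 < d L) (hd : ∀ i, 0 < i → i < L → d i = m) {k : ℕ} (hk0 : 0 < k)
    (hk : 4 * L * k ≤ m)
    (X : Matrix (Fin (d 0)) (Fin n) ℝ) (hX : 0 < frobNorm X ^ 2) :
    initLaw L d {W | Real.exp 1 * (m ^ (L - 1) * Real.exp 1 * (d L + 2 * k)) * frobNorm X ^ 2 ≤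
      frobNorm (seg (toLayers W) 0 L * X) ^ 2} ≤ ENNReal.ofReal (Real.exp (-k)) := by
  have hm' : (0 : ℝ) < m := by exact_mod_cast hm
  have hd' : (0 : ℝ) < d L := by exact_mod_cast hout
  set D : ℝ := m ^ (L - 1) * Real.exp 1 * (d L + 2 * k) with hD
  have hD0 : 0 < D := by positivity
  set T := frobNorm X ^ 2 with hT
  set a : Fin n → ℝ := fun j => nsq (fun i => X i j) / T * (T / nsq (fun i => X i j)) ^ k with ha
  have ha0 : ∀ j, 0 ≤ a j := fun j =>
    mul_nonneg (div_nonneg (nsq_nonneg _) hX.le) (pow_nonneg (div_nonneg hX.le (nsq_nonneg _)) k)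
  have hmeas : ∀ j, Measurable fun W : Weights L d =>
      normPow k _ ((seg (toLayers W) 0 L).mulVec fun i => X i j) := fun j =>
    (measurable_normPow k _).comp
      ((continuous_seg (Nat.zero_le L)).matrix_mulVec continuous_const).measurable
  have hint : ∫⁻ W, ENNReal.ofReal ((frobNorm (seg (toLayers W) 0 L * X) ^ 2) ^ k)
      ∂initLaw L d ≤ ENNReal.ofReal ((D * T) ^ k) := by
    have h1 : ∀ W : Weights L d, ENNReal.ofReal ((frobNorm (seg (toLayers W) 0 L * X) ^ 2) ^ k) ≤
        ∑ j, ENNReal.ofReal (a j) *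
          normPow k _ ((seg (toLayers W) 0 L).mulVec fun i => X i j) := fun W => by
      refine (ENNReal.ofReal_le_ofReal (frobNorm_sq_pow_le _ X hX)).trans (le_of_eq ?_)
      rw [ENNReal.ofReal_sum_of_nonneg fun j _ => mul_nonneg (ha0 j) (pow_nonneg (nsq_nonneg _) k)]
      refine Finset.sum_congr rfl fun j _ => ?_
      rw [ENNReal.ofReal_mul (ha0 j), normPow, ENNReal.ofReal_pow (nsq_nonneg _)]
    refine (lintegral_mono h1).trans ?_
    rw [lintegral_finsetSum _ fun j _ => (hmeas j).const_mul _]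
    have h2 : ∀ j ∈ Finset.univ, ∫⁻ W, ENNReal.ofReal (a j) *
          normPow k _ ((seg (toLayers W) 0 L).mulVec fun i => X i j) ∂initLaw L d ≤
        ENNReal.ofReal (nsq (fun i => X i j) / T * (D * T) ^ k) := fun j _ => by
      rw [lintegral_const_mul _ (hmeas j)]
      refine (mul_le_mul_right (lintegral_seg_output_le hL hm hout hd hk _) _).trans ?_
      rw [← ENNReal.ofReal_mul (ha0 j)]
      refine ENNReal.ofReal_le_ofReal (le_of_eq ?_)
      rw [ha, ← hD]
      by_cases h : nsq (fun i => X i j) = 0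
      · simp [h]
      · simp only [div_pow, mul_pow]; field_simp
    refine (Finset.sum_le_sum h2).trans ?_
    rw [← ENNReal.ofReal_sum_of_nonneg fun j _ =>
      mul_nonneg (div_nonneg (nsq_nonneg _) hX.le) (by positivity)]
    rw [← Finset.sum_mul, ← Finset.sum_div, ← frobNorm_sq_eq_sum_nsq, ← hT, div_self hX.ne',
      one_mul]
  have h0 : 0 < (Real.exp 1 * D * T) ^ k := by positivity
  have hsub : {W : Weights L d | Real.exp 1 * D * T ≤
      frobNorm (seg (toLayers W) 0 L * X) ^ 2} ⊆ {W | ENNReal.ofReal ((Real.exp 1 * D * T) ^ k) ≤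
      ENNReal.ofReal ((frobNorm (seg (toLayers W) 0 L * X) ^ 2) ^ k)} := fun W hW =>
    ENNReal.ofReal_le_ofReal (pow_le_pow_left₀ (by positivity) hW k)
  have hm2 : Measurable fun W : Weights L d =>
      ENNReal.ofReal ((frobNorm (seg (toLayers W) 0 L * X) ^ 2) ^ k) := by
    simp_rw [frobNorm_sq]
    have hcont : Continuous fun W : Weights L d => seg (toLayers W) 0 L * X :=
      (continuous_seg (Nat.zero_le L)).matrix_mul continuous_const
    refine (Continuous.measurable ?_).ennreal_ofReal
    exact (continuous_finsetSum _ fun i _ => continuous_finsetSum _ fun j _ =>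
      (hcont.matrix_elem i j).pow 2).pow k
  refine (measure_mono hsub).trans ((meas_ge_le_lintegral_div hm2.aemeasurable
    (by simpa using h0) ENNReal.ofReal_ne_top).trans ?_)
  refine (ENNReal.div_le_div_right hint _).trans ?_
  rw [← ENNReal.ofReal_div_of_pos h0]
  refine ENNReal.ofReal_le_ofReal (le_of_eq ?_)
  have : (D * T) ^ k ≠ 0 := by positivity
  have hexp : (Real.exp 1 * D * T) ^ k = Real.exp k * (D * T) ^ k := by
    rw [mul_assoc (Real.exp 1), mul_pow (Real.exp 1), ← Real.exp_nat_mul, mul_one]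
  rw [hexp, Real.exp_neg]
  field_simp

/-! ### The main theorem -/

/-- The trace of the Gram matrix is the sum of its `rank X` nonzero eigenvalues, each at most
`‖X‖²`. This is where the factor `r` in the width arises. -/
theorem frobNorm_sq_le_rank_mul {p n : ℕ} (X : Matrix (Fin p) (Fin n) ℝ) :
    frobNorm X ^ 2 ≤ X.rank * specNorm X ^ 2 := by
  have h1 : frobNorm X ^ 2 = ∑ i, (gram_isHermitian X).eigenvalues i := by
    have h := (gram_isHermitian X).trace_eq_sum_eigenvalues
    rw [frobNorm_sq_eq_inner, frobInner_eq_trace, h]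
    rfl
  have h2 : X.rank = (Finset.univ.filter fun i => (gram_isHermitian X).eigenvalues i ≠ 0).card := by
    rw [← Matrix.rank_transpose_mul_self, (gram_isHermitian X).rank_eq_card_non_zero_eigs,
      ← Fintype.card_subtype]
  rw [h1, h2, ← Finset.sum_filter_ne_zero, ← nsmul_eq_mul]
  exact Finset.sum_le_card_nsmul _ _ _ fun i _ => eigenvalues_gram_le X i

/-- Layers whose product is `M`, available as soon as no hidden layer is narrower than the
output. -/
def factorLayers {d : ℕ → ℕ} {q : ℕ} (M : Matrix (Fin q) (Fin (d 0)) ℝ) : Layers d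
  | 0 => Matrix.of fun a b => if h : (a : ℕ) < q then M ⟨a, h⟩ b else 0
  | _ + 1 => Matrix.of fun a b => if (a : ℕ) = b then 1 else 0

theorem seg_factorLayers {d : ℕ → ℕ} {q : ℕ} (M : Matrix (Fin q) (Fin (d 0)) ℝ) (k : ℕ)
    (hk : ∀ i, 0 < i → i ≤ k → q ≤ d i) :
    seg (factorLayers M) 0 (k + 1) =
      Matrix.of fun a : Fin (d (k + 1)) => fun b =>
        if h : (a : ℕ) < q then M ⟨a, h⟩ b else 0 := by
  induction k with
  | zero => rw [seg_succ _ le_rfl, seg_self, Matrix.mul_one]; rfl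
  | succ k ih =>
    rw [seg_succ _ (Nat.zero_le _), ih fun i h1 h2 => hk i h1 (by omega)]
    ext a b
    have hq := hk (k + 1) (Nat.succ_pos k) le_rfl
    rw [Matrix.mul_apply]
    by_cases h : (a : ℕ) < d (k + 1)
    · rw [Finset.sum_eq_single ⟨a, h⟩]
      · simp [factorLayers]
      · intro c _ hc
        have : ¬ (a : ℕ) = c := fun h' => hc (Fin.ext h'.symm)
        simp [factorLayers, this]
      · simp
    · rw [Finset.sum_eq_zero]
      · simp [show ¬ (a : ℕ) < q by omega]
      · intro c _
        have : ¬ (a : ℕ) = c := fun h' => h (h' ▸ c.2)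
        simp [factorLayers, this]

theorem exists_seg_toLayers_eq {L : ℕ} {d : ℕ → ℕ} (hL : 1 ≤ L)
    (hd : ∀ i, 0 < i → i < L → d L ≤ d i) (M : Matrix (Fin (d L)) (Fin (d 0)) ℝ) :
    ∃ W : Weights L d, seg (toLayers W) 0 L = M := by
  refine ⟨fun i a b => factorLayers M i a b, ?_⟩
  rw [seg_congr (B := factorLayers M) (Nat.zero_le L) fun k _ hk => toLayers_of_lt _ hk]
  obtain ⟨l, rfl⟩ : ∃ l, L = l + 1 := ⟨L - 1, by omega⟩
  rw [seg_factorLayers M l fun i h1 h2 => hd i h1 (by omega)]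
  ext a b
  simp

theorem isLeast_range_netLoss {L m n : ℕ} {d : ℕ → ℕ} (hL : 1 ≤ L) (hm : 0 < m)
    (hout : 0 < d L) (hd : ∀ i, 0 < i → i < L → d L ≤ d i)
    (X : Matrix (Fin (d 0)) (Fin n) ℝ) (Y : Matrix (Fin (d L)) (Fin n) ℝ)
    (Φ : Matrix (Fin (d L)) (Fin (d 0)) ℝ) (hΦ : ∀ W, regLoss X Y Φ ≤ regLoss X Y W) :
    IsLeast (Set.range (netLoss (L := L) (d := d) m X Y)) (optLoss X Y) := by
  constructor
  -- Undoing the normalization makes the network compute `Φ` exactly, so the residual vanishes.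
  · obtain ⟨W, hW⟩ := exists_seg_toLayers_eq hL hd ((outScale L m d)⁻¹ • Φ)
    refine ⟨W, sub_eq_zero.1 ?_⟩
    have hc : outScale L m d ≠ 0 := by unfold outScale; positivity
    rw [netLoss_sub_optLoss m X Y Φ hΦ, netResidual, hW, Matrix.smul_mul, smul_inv_smul₀ hc,
      sub_self]
    simp [frobNorm]
  · rintro _ ⟨W, rfl⟩
    have h := netLoss_sub_optLoss m X Y Φ hΦ W
    nlinarith [sq_nonneg (frobNorm (netResidual L (outScale L m d) X Φ (toLayers W)))]

/-- The factor by which the initial loss may exceed `‖X‖_F²`. -/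
noncomputable def lossFactor (l D φ : ℝ) : ℝ := max (max 1 (l / D)) φ

theorem mul_lossFactor_le {l D φ : ℝ} (hD : 1 ≤ D) (hφ : 0 ≤ φ) :
    D * lossFactor l D φ ≤ max (D * (1 + φ)) l := by
  rw [lossFactor, mul_max_of_nonneg _ _ (by linarith), mul_max_of_nonneg _ _ (by linarith),
    mul_div_cancel₀ _ (by linarith)]
  refine max_le (max_le ?_ (le_max_right _ _)) ?_
  · exact le_max_of_le_left (by nlinarith)
  · exact le_max_of_le_left (by nlinarith)

/-- After normalization the random output contributes `e² (1 + 2 k / D) ≤ 8 · 7` times the loss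
factor and `Φ X` contributes it once more; `57` is rounded to `60`. -/
theorem initial_loss_le {L m n k : ℕ} {d : ℕ → ℕ} (hm : 0 < m) (hout : 0 < d L)
    (X : Matrix (Fin (d 0)) (Fin n) ℝ) (Φ : Matrix (Fin (d L)) (Fin (d 0)) ℝ) (A : Layers d)
    {l : ℝ} (hk : (k : ℝ) ≤ l + 2)
    (hA : frobNorm (seg A 0 L * X) ^ 2 ≤
      Real.exp 1 * (m ^ (L - 1) * Real.exp 1 * (d L + 2 * k)) * frobNorm X ^ 2) :
    1 / 2 * frobNorm (netResidual L (outScale L m d) X Φ A) ^ 2 ≤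
      60 * lossFactor l (d L) (specNorm Φ ^ 2) * frobNorm X ^ 2 := by
  have hm' : (0 : ℝ) < m := by exact_mod_cast hm
  have hD : (1 : ℝ) ≤ d L := by exact_mod_cast hout
  set D : ℝ := ((d L : ℕ) : ℝ) with hDdef
  set T := frobNorm X ^ 2 with hT
  have hT0 : 0 ≤ T := sq_nonneg _
  set S := frobNorm (seg A 0 L * X) with hS
  have hc : outScale L m d ^ 2 = 1 / (m ^ (L - 1) * D) := by
    rw [outScale, div_pow, one_pow, Real.sq_sqrt (by positivity)]
  have hc0 : 0 ≤ outScale L m d := by unfold outScale; positivity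
  have h1 : frobNorm (netResidual L (outScale L m d) X Φ A) ≤
      outScale L m d * S + specNorm Φ * frobNorm X := by
    rw [netResidual, sub_eq_add_neg]
    refine (frobNorm_add_le _ _).trans (add_le_add ?_ ?_)
    · rw [frobNorm_smul, abs_of_nonneg hc0]
    · rw [frobNorm_neg]; exact frobNorm_mul_le _ _
  have h2 : 1 / 2 * frobNorm (netResidual L (outScale L m d) X Φ A) ^ 2 ≤
      outScale L m d ^ 2 * S ^ 2 + specNorm Φ ^ 2 * T := by
    have h3 := pow_le_pow_left₀ (frobNorm_nonneg _) h1 2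
    nlinarith [sq_nonneg (outScale L m d * S - specNorm Φ * frobNorm X)]
  have h3 : outScale L m d ^ 2 * S ^ 2 ≤ Real.exp 1 ^ 2 * ((D + 2 * k) / D) * T := by
    calc outScale L m d ^ 2 * S ^ 2 ≤ 1 / (m ^ (L - 1) * D) *
          (Real.exp 1 * (m ^ (L - 1) * Real.exp 1 * (D + 2 * k)) * T) := by
          rw [hc]; exact mul_le_mul_of_nonneg_left hA (by positivity)
      _ = _ := by field_simp
  have he : Real.exp 1 ^ 2 ≤ 8 := by
    have := Real.exp_one_lt_d9
    have h0 := Real.exp_pos 1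
    nlinarith
  have h4 : (D + 2 * k) / D ≤ 5 + 2 * (l / D) := by
    have h5 : (D + 2 * k) / D = 1 + 2 * (k / D) := by field_simp
    have h6 : (k : ℝ) / D ≤ l / D + 2 := by
      calc (k : ℝ) / D ≤ (l + 2) / D := by gcongr
        _ = l / D + 2 / D := add_div _ _ _
        _ ≤ l / D + 2 := by
          have : 2 / D ≤ 2 := div_le_self (by norm_num) hD
          linarith
    linarith
  set F := lossFactor l D (specNorm Φ ^ 2) with hF
  have hF1 : 1 ≤ F := (le_max_left _ _).trans (le_max_left _ _)
  have hF2 : l / D ≤ F := (le_max_right _ _).trans (le_max_left _ _)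
  have hF3 : specNorm Φ ^ 2 ≤ F := le_max_right _ _
  have h7 : Real.exp 1 ^ 2 * ((D + 2 * k) / D) ≤ 8 * (7 * F) := by
    refine mul_le_mul he (by linarith) (by positivity) (by norm_num)
  calc _ ≤ _ := h2
    _ ≤ 8 * (7 * F) * T + F * T := add_le_add (h3.trans (mul_le_mul_of_nonneg_right h7 hT0))
        (mul_le_mul_of_nonneg_right hF3 hT0)
    _ ≤ 60 * F * T := by nlinarith [mul_nonneg (zero_le_one.trans hF1) hT0]

/-- The width needed for the initial residual to stay within the basin of linear convergence. -/
theorem residual_smallness {L m r s lam E φ l D κ : ℝ} (hL : 0 < L) (hm : 0 ≤ m) (hr : 0 ≤ r)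
    (hlam : 0 < lam) (hκ : 1 ≤ κ) (hsκ : s ^ 2 ≤ lam * κ) (hD : 1 ≤ D)
    (hφ : 0 ≤ φ)
    (hE : 1 / 2 * E ^ 2 ≤ 60 * lossFactor l D φ * (r * s ^ 2))
    (hwidth : 2 * 10 ^ 15 * L * (r * κ ^ 3 * max (D * (1 + φ)) l) ≤ m) :
    500 * (6000 * √L * s * E) ≤ lam * (1 / √D) * √m := by
  set F := lossFactor l D φ with hF
  have hF1 : 1 ≤ F := (le_max_left _ _).trans (le_max_left _ _)
  have hP := mul_lossFactor_le (l := l) hD hφ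
  rw [← hF] at hP
  set P := max (D * (1 + φ)) l with hPdef
  have hD0 : 0 < D := by linarith
  have hP0 : 0 ≤ P := le_trans (by positivity) hP
  have hsD : 0 < √D := Real.sqrt_pos.2 hD0
  have h1 : s ^ 2 * s ^ 2 ≤ lam ^ 2 * κ ^ 2 := by
    rw [← mul_pow lam, ← sq]
    exact pow_le_pow_left₀ (by positivity) hsκ 2
  -- Squaring the claim produces `s⁴ ≤ lam² κ²`; this is relaxed to the `κ ^ 3` of the width
  -- condition.
  have hκ23 : κ ^ 2 ≤ κ ^ 3 := pow_le_pow_right₀ hκ (by norm_num)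
  have key : (3000000 * (√L * s * E * √D)) ^ 2 ≤ (lam * √m) ^ 2 := by
    have e1 : (3000000 * (√L * s * E * √D)) ^ 2 =
        9 * 10 ^ 12 * (L * s ^ 2 * D) * E ^ 2 := by
      rw [mul_pow, mul_pow, mul_pow, mul_pow, Real.sq_sqrt hL.le, Real.sq_sqrt hD0.le]; ring
    rw [e1, mul_pow, Real.sq_sqrt hm]
    calc 9 * 10 ^ 12 * (L * s ^ 2 * D) * E ^ 2
        ≤ 9 * 10 ^ 12 * (L * s ^ 2 * D) * (120 * F * (r * s ^ 2)) :=
          mul_le_mul_of_nonneg_left (by linarith) (by positivity)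
      _ = 108 * 10 ^ 13 * (L * r * (D * F)) * (s ^ 2 * s ^ 2) := by ring
      _ ≤ 108 * 10 ^ 13 * (L * r * P) * (lam ^ 2 * κ ^ 3) := 
          mul_le_mul (by gcongr) (h1.trans (by gcongr)) (by positivity) (by positivity)
      _ ≤ 2 * 10 ^ 15 * (L * r * P) * (lam ^ 2 * κ ^ 3) :=
          mul_le_mul_of_nonneg_right (mul_le_mul_of_nonneg_right (by norm_num) (by positivity))
            (by positivity)
      _ = lam ^ 2 * (2 * 10 ^ 15 * L * (r * κ ^ 3 * P)) := by ring
      _ ≤ lam ^ 2 * m := by gcongr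
  have h2 := le_of_sq_le_sq key (by positivity)
  rw [mul_one_div, div_mul_eq_mul_div, le_div_iff₀ hsD]
  linarith

/-- The terms of the exponent pay in turn for the constant, as `exp 20 ≥ 2 · 10 ^ 8`, for `δ`, and
for the `L ^ 3` events of the union bound. -/
theorem failure_prob_le {L δ R : ℝ} (hL : 1 ≤ L) (hδ : 0 < δ)
    (hR : 20 - Real.log δ + 3 * Real.log L ≤ R / 2) :
    10 ^ 8 * L ^ 3 * Real.exp (-R / 2) ≤ δ / 2 := by
  have h1 : Real.exp (-R / 2) ≤ Real.exp (-20) * δ * (L ^ 3)⁻¹ := by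
    calc Real.exp (-R / 2) ≤ Real.exp (-20 + Real.log δ + -(3 * Real.log L)) :=
          Real.exp_le_exp.2 (by linarith)
      _ = _ := by
        rw [Real.exp_add, Real.exp_add, Real.exp_log hδ, Real.exp_neg (3 * Real.log L)]
        congr 2
        rw [show (3 : ℝ) * Real.log L = ((3 : ℕ) : ℝ) * Real.log L by norm_num,
          Real.exp_nat_mul, Real.exp_log (by linarith)]
  have h2 : Real.exp (-20) ≤ 1 / (2 * 10 ^ 8) := by
    rw [Real.exp_neg, ← one_div]
    refine one_div_le_one_div_of_le (by norm_num) ?_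
    have h3 : Real.exp 20 = Real.exp 1 ^ 20 := by rw [← Real.exp_nat_mul]; norm_num
    rw [h3]
    have h4 : (2.7 : ℝ) ≤ Real.exp 1 := by linarith [Real.exp_one_gt_d9]
    exact le_trans (by norm_num) (pow_le_pow_left₀ (by norm_num) h4 20)
  have hL3 : (0 : ℝ) < L ^ 3 := by positivity
  calc 10 ^ 8 * L ^ 3 * Real.exp (-R / 2)
      ≤ 10 ^ 8 * L ^ 3 * (1 / (2 * 10 ^ 8) * δ * (L ^ 3)⁻¹) := by
        refine mul_le_mul_of_nonneg_left (h1.trans ?_) (by positivity)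
        gcongr
    _ = δ / 2 := by field_simp

theorem ofReal_one_sub_le_of_compl {Ω : Type*} [MeasurableSpace Ω] {P : Measure Ω}
    [IsProbabilityMeasure P] {S B₁ B₂ : Set Ω} {δ : ℝ} (hδ : 0 ≤ δ) (h : Sᶜ ⊆ B₁ ∪ B₂)
    (h1 : P B₁ ≤ ENNReal.ofReal (δ / 2)) (h2 : P B₂ ≤ ENNReal.ofReal (δ / 2)) :
    ENNReal.ofReal (1 - δ) ≤ P S := by
  have h3 : P Sᶜ ≤ ENNReal.ofReal δ := by
    refine (measure_mono h).trans ((measure_union_le _ _).trans ((add_le_add h1 h2).trans_eq ?_))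
    rw [← ENNReal.ofReal_add (by linarith) (by linarith), add_halves]
  -- Subadditivity alone gives this, so measurability of the success event is not required.
  have h4 : 1 ≤ P S + P Sᶜ := by
    rw [← measure_univ (μ := P), ← Set.union_compl_self S]; exact measure_union_le _ _
  rw [ENNReal.ofReal_sub _ hδ, ENNReal.ofReal_one]
  exact tsub_le_iff_right.2 (h4.trans (add_le_add_right h3 _))

/-- Here `μ = √m`, `ρ = √λ_r`, and `c μ ^ (L - 1) = γ = 1 / √(d L)`. The rate `η L γ² ρ² / 4`
becomes the stated one, and the step-size bound is `3 η L γ² ‖X‖² ≤ 1`. -/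
theorem netLoss_gdIter_le {L m n : ℕ} {d : ℕ → ℕ} (hL : 1 ≤ L) (hm : 0 < m) (hout : 0 < d L)
    (X : Matrix (Fin (d 0)) (Fin n) ℝ) (Y : Matrix (Fin (d L)) (Fin n) ℝ) (hX : X ≠ 0)
    (Φ : Matrix (Fin (d L)) (Fin (d 0)) ℝ) (hΦ : ∀ W, regLoss X Y Φ ≤ regLoss X Y W)
    {η : ℝ} (hη : 0 < η) (hη' : η ≤ (d L : ℝ) / (3 * L * specNorm (X.transpose * X)))
    {W0 : Weights L d} (hW0 : WellConditioned L √m (1 / 20) (6000 * √L) X (toLayers W0))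
    (hbig : 500 * (6000 * √L * specNorm X *
      frobNorm (netResidual L (outScale L m d) X Φ (toLayers W0))) ≤
        gramEig X X.rank * (1 / √(d L)) * √m) (t : ℕ) :
    netLoss m X Y (gdIter m X Y η W0 t) - optLoss X Y ≤
      (1 - η * L * gramEig X X.rank / (4 * (d L : ℝ))) ^ t * (netLoss m X Y W0 - optLoss X Y) := by
  have hm' : (0 : ℝ) < m := by exact_mod_cast hm
  have hd' : (0 : ℝ) < d L := by exact_mod_cast hout
  have hL' : (0 : ℝ) < L := by exact_mod_cast hL
  have hlam := gramEig_rank_pos X hX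
  have hs := specNorm_pos X hX
  set lam := gramEig X X.rank with hlamdef
  have hρ2 : √lam ^ 2 = lam := Real.sq_sqrt hlam.le
  have hγ2 : (1 / √(d L : ℝ)) ^ 2 = 1 / d L := by rw [div_pow, one_pow, Real.sq_sqrt hd'.le]
  have h := residual_convergence (μ := √m) (γ := 1 / √(d L)) (ρ := √lam) (c := outScale L m d)
    (K := 6000 * √L) (η := η) (L := L) (X := X) (Real.sqrt_pos.2 hm') hL (by positivity)
    (by unfold outScale; positivity) hη
    (by
      rw [outScale, Real.sqrt_mul (by positivity), Real.sqrt_eq_rpow, Real.sqrt_eq_rpow,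
        Real.sqrt_eq_rpow, ← Real.rpow_natCast, ← Real.rpow_natCast, ← Real.rpow_mul hm'.le,
        ← Real.rpow_mul hm'.le, mul_comm (1 / 2 : ℝ)]
      have : (m : ℝ) ^ (((L - 1 : ℕ) : ℝ) * (1 / 2)) ≠ 0 := (Real.rpow_pos_of_pos hm' _).ne'
      field_simp)
    (by positivity) (Real.sqrt_pos.2 hlam)
    (Real.sqrt_le_iff.2 ⟨hs.le, gramEig_rank_le X hX⟩)
    (fun V => by
      refine le_of_sq_le_sq ?_ (frobNorm_nonneg _)
      rw [mul_pow, hρ2]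
      exact gramEig_rank_mul_frobNorm_le X V)
    Φ (W := fun t => toLayers (gdIter m X Y η W0 t)) hW0
    (fun t k hk => toLayers_gdIter_succ m X Y Φ hΦ η W0 t k hk)
    (by
      rw [specNorm_gram, le_div_iff₀ (by positivity)] at hη'
      rw [hγ2, show 3 * (η * L * (1 / (d L : ℝ)) * specNorm X ^ 2) =
        η * (3 * L * specNorm X ^ 2) / d L by ring, div_le_one hd']
      exact hη')
    (by rw [hρ2]; exact hbig) t
  rw [netLoss_sub_optLoss m X Y Φ hΦ, netLoss_sub_optLoss m X Y Φ hΦ]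
  rw [hγ2, hρ2, show η * L * (1 / (d L : ℝ)) * lam / 4 = η * L * lam / (4 * d L) by
    field_simp] at h
  have h' : frobNorm (netResidual L (outScale L m d) X Φ (toLayers (gdIter m X Y η W0 t))) ^ 2 ≤
    (1 - η * L * lam / (4 * d L)) ^ t *
      frobNorm (netResidual L (outScale L m d) X Φ (toLayers W0)) ^ 2 := h
  linarith

theorem theorem1 :
    ∃ C C' : ℝ, 0 < C ∧ 0 < C' ∧
      ∀ (L m n : ℕ) (d : ℕ → ℕ), 1 ≤ L → 0 < d L →
      -- all hidden layers have width `m`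
      (∀ i, 0 < i → i < L → d i = m) →
      ∀ (X : Matrix (Fin (d 0)) (Fin n) ℝ) (Y : Matrix (Fin (d L)) (Fin n) ℝ), X ≠ 0 →
      -- `Φ` is any minimizer of the linear regression objective
      ∀ Φ : Matrix (Fin (d L)) (Fin (d 0)) ℝ, (∀ W, regLoss X Y Φ ≤ regLoss X Y W) →
      ∀ δ : ℝ, 0 < δ → δ < 1 →
      C * L * max (max ((X.rank : ℝ) * condNum X ^ 3 * (d L : ℝ) * (1 + specNorm Φ ^ 2))
          ((X.rank : ℝ) * condNum X ^ 3 * Real.log ((X.rank : ℝ) / δ))) (Real.log L) ≤ (m : ℝ) →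
      ∀ η : ℝ, 0 < η → η ≤ (d L : ℝ) / (3 * L * specNorm (X.transpose * X)) →
        -- `OPT` is the global minimum of the training loss of the network
        IsLeast (Set.range (netLoss (L := L) (d := d) m X Y)) (optLoss X Y) ∧
        -- with probability at least `1 - δ` over the random initialization
        ENNReal.ofReal (1 - δ) ≤ initLaw L d {W0 : Weights L d |
          netLoss m X Y W0 - optLoss X Y ≤
            C' * max (max 1 (Real.log ((X.rank : ℝ) / δ) / (d L : ℝ))) (specNorm Φ ^ 2) *
              frobNorm X ^ 2 ∧
          ∀ t : ℕ, netLoss m X Y (gdIter m X Y η W0 t) - optLoss X Y ≤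
            (1 - η * L * gramEig X X.rank / (4 * (d L : ℝ))) ^ t *
              (netLoss m X Y W0 - optLoss X Y)} := by
  refine ⟨2 * 10 ^ 15, 60, by norm_num, by norm_num, ?_⟩
  intro L m n d hL hout hd X Y hX Φ hΦ δ hδ hδ1 hwidth η hη hη'
  have hL' : (1 : ℝ) ≤ L := by exact_mod_cast hL
  have hD : (1 : ℝ) ≤ d L := by exact_mod_cast hout
  have hr : (1 : ℝ) ≤ X.rank := by exact_mod_cast rank_pos_of_ne_zero X hX
  have hlam := gramEig_rank_pos X hX
  have hs := specNorm_pos X hX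
  have hsκ : specNorm X ^ 2 ≤ gramEig X X.rank * condNum X := by
    rw [condNum, mul_div_cancel₀ _ hlam.ne']; exact specNorm_sq_le_gramEig_one X hX
  have hκ : 1 ≤ condNum X := by
    rw [condNum, one_le_div hlam]
    exact (gramEig_rank_le X hX).trans (specNorm_sq_le_gramEig_one X hX)
  have hκ3 : 1 ≤ condNum X ^ 3 := one_le_pow₀ hκ
  have hφ : 0 ≤ specNorm Φ ^ 2 := sq_nonneg _
  have hl : Real.log (X.rank / δ) = Real.log X.rank - Real.log δ :=
    Real.log_div (by linarith) hδ.ne'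
  have hlr : 0 ≤ Real.log X.rank := Real.log_nonneg hr
  have hlδ : Real.log δ < 0 := Real.log_neg hδ hδ1
  have hlL : 0 ≤ Real.log L := Real.log_nonneg hL'
  set l := Real.log (X.rank / δ) with hldef
  have hrκ : (X.rank : ℝ) ≤ X.rank * condNum X ^ 3 := le_mul_of_one_le_right (by linarith) hκ3
  set x : ℝ := m / L with hx
  have hxm : (m : ℝ) = L * x := by rw [hx]; field_simp
  have hxmax : 2 * 10 ^ 15 * max (max (X.rank * condNum X ^ 3 * (d L : ℝ) * (1 + specNorm Φ ^ 2))
      (X.rank * condNum X ^ 3 * l)) (Real.log L) ≤ x := by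
    rw [hx, le_div_iff₀ (by linarith)]; linarith
  have hx1 : 2 * 10 ^ 15 * (X.rank * condNum X ^ 3 * (d L : ℝ) * (1 + specNorm Φ ^ 2)) ≤ x :=
    le_trans (by gcongr; exact (le_max_left _ _).trans (le_max_left _ _)) hxmax
  have hx2 : 2 * 10 ^ 15 * (X.rank * condNum X ^ 3 * l) ≤ x :=
    le_trans (by gcongr; exact (le_max_right _ _).trans (le_max_left _ _)) hxmax
  have hx3 : 2 * 10 ^ 15 * Real.log L ≤ x :=
    le_trans (by gcongr; exact le_max_right _ _) hxmax
  have hxrd : 2 * 10 ^ 15 * (X.rank * (d L : ℝ)) ≤ x := by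
    refine le_trans ?_ hx1
    refine mul_le_mul_of_nonneg_left ?_ (by norm_num)
    refine le_trans ?_ (le_mul_of_one_le_right (by positivity) (by linarith))
    exact mul_le_mul_of_nonneg_right hrκ (by linarith)
  have hxr : 2 * 10 ^ 15 * (X.rank : ℝ) ≤ x := by nlinarith
  have hxd : 2 * 10 ^ 15 * (d L : ℝ) ≤ x := by nlinarith
  have hl0 : 0 ≤ l := by rw [hl]; linarith
  have hxl : 2 * 10 ^ 15 * l ≤ x := by
    refine le_trans (mul_le_mul_of_nonneg_left ?_ (by norm_num)) hx2
    exact le_mul_of_one_le_left hl0 (hr.trans hrκ)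
  have hm : 0 < m := by
    have : (0 : ℝ) < m := by rw [hxm]; nlinarith
    exact_mod_cast this
  have hrate : initRate L m = x / 819200 := by rw [initRate, hx]; field_simp
  -- The least order for which `exp (-k) ≤ δ / 2`. It exceeds `log (r / δ)` by less than two since
  -- `r ≥ 1`.
  set k := ⌈Real.log (2 / δ)⌉₊ with hk
  have hlog2 : Real.log (2 / δ) = Real.log 2 - Real.log δ := Real.log_div two_ne_zero hδ.ne'
  have hln2 : 0 < Real.log 2 := Real.log_pos one_lt_two
  have hk0 : 0 < k := Nat.ceil_pos.2 (by linarith)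
  have hk1 : Real.log (2 / δ) ≤ k := Nat.le_ceil _
  have hkl : (k : ℝ) ≤ l + 2 := by
    have h1 := (Nat.ceil_lt_add_one (show 0 ≤ Real.log (2 / δ) by linarith)).le
    have h2 := Real.log_two_lt_d9
    rw [← hk] at h1
    linarith
  have hkm : 4 * L * k ≤ m := by
    have : 4 * (L : ℝ) * k ≤ m := by rw [hxm]; nlinarith
    exact_mod_cast this
  have hFX : 0 < frobNorm X ^ 2 :=
    pow_pos (hs.trans_le (specNorm_le_frobNorm X)) 2
  -- Half of `δ` is spent on conditioning and half on the size of the initial output. Off both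
  -- events everything else is deterministic.
  have hbad1 := (measure_not_wellConditioned_le hL hm hd X (by rw [hrate]; linarith)
    (by rw [hrate]; linarith) (by rw [hrate]; linarith)).trans
    (ENNReal.ofReal_le_ofReal (failure_prob_le hL' hδ (by rw [hrate]; linarith)))
  have hbad2 := (measure_output_ge_le hL hm hout hd hk0 hkm X hFX).trans
    (ENNReal.ofReal_le_ofReal (show Real.exp (-k) ≤ δ / 2 by
      rw [show δ / 2 = Real.exp (-Real.log (2 / δ)) by
        rw [Real.exp_neg, Real.exp_log (by positivity), inv_div]]
      exact Real.exp_le_exp.2 (neg_le_neg hk1)))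
  refine ⟨isLeast_range_netLoss hL hm hout (fun i h1 h2 => ?_) X Y Φ hΦ,
    ofReal_one_sub_le_of_compl hδ.le (fun W hW => ?_) hbad1 hbad2⟩
  · rw [hd i h1 h2]
    have : (d L : ℝ) ≤ m := by rw [hxm]; nlinarith
    exact_mod_cast this
  · by_contra hcon
    simp only [Set.mem_union, not_or, Set.mem_ofPred_eq, not_not, not_le] at hcon
    obtain ⟨hwell, hsmall⟩ := hcon
    have hloss := initial_loss_le hm hout X Φ (toLayers W) hkl hsmall.le
    refine hW ⟨?_, netLoss_gdIter_le hL hm hout X Y hX Φ hΦ hη hη' hwell ?_⟩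
    · rw [netLoss_sub_optLoss m X Y Φ hΦ]; exact hloss
    · refine residual_smallness (r := X.rank) (κ := condNum X) (φ := specNorm Φ ^ 2) (l := l)
        (by linarith) (Nat.cast_nonneg m) (by linarith) hlam hκ hsκ hD hφ
        (hloss.trans (mul_le_mul_of_nonneg_left (frobNorm_sq_le_rank_mul X) ?_)) ?_
      · have : 1 ≤ lossFactor l (d L) (specNorm Φ ^ 2) :=
          (le_max_left _ _).trans (le_max_left _ _)
        positivity
      · rw [mul_max_of_nonneg _ _ (by positivity : (0 : ℝ) ≤ X.rank * condNum X ^ 3), ← mul_assoc]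
        refine le_trans ?_ hwidth
        exact mul_le_mul_of_nonneg_left (le_max_left _ _) (by positivity)
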